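/- Let $1<p\le\infty$, $q>0$, $\alpha>0$ and $C\ge 0$. For $f:\mathbb R\to\mathbb C$ put $\|f\|_{S^p}=\sup_u\left\{\frac1\pi\int_u^{u+\pi}|f(t)|^p\,dt\right\}^{1/p}$ if $p<\infty$ and $\|f\|_{S^\infty}=\sup_u|f(u)|$. Let $S^p$ be the class of Stepanov almost periodic functions, i.e. the measurable functions that are limits in $\|\cdot\|_{S^p}$ of trigonometric polynomials $\sum_{j}c_je^{i\mu_jt}$ with real $\mu_j$. For $f\in S^p$ put $A_\mu(f)=\lim_{L\to\infty}\frac1L\int_0^Lf(t)e^{-i\mu t}\,dt$ for $\mu\in\mathbb R$, and $S_\gamma f(x)=\sum_{|\mu|\le\gamma}A_\mu(f)e^{i\mu x}$, where the sum is over the $\mu$ with $A_\mu(f)\neq0$. Let $\Omega_{\alpha,p}$ be the set of all $f\in S^p$, bounded on $\mathbb R$, such that any two distinct elements of $\{\mu>0:|A_\mu(f)|+|A_{-\mu}(f)|>0\}$ differ by at least $\alpha$. Let $E_\sigma(f)_{S^p}=\inf_g\|f-g\|_{S^p}$, the infimum being over all entire functions $g$ of exponential type at most $\sigma$ that are bounded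 on the real axis. Fix $x\in\mathbb R$, put $\varphi_x(t)=f(x+t)+f(x-t)-2f(x)$, and let $w_x$ be a function of modulus of continuity type on $[0,\infty)$, i.e. nondecreasing and continuous with $w_x(0)=0$ and $w_x(\delta_1+\delta_2)\le w_x(\delta_1)+w_x(\delta_2)$ for $\delta_1,\delta_2\ge0$. Suppose that $f\in\Omega_{\alpha,p}(w_x)$ with constant $C$: that is, $f\in\Omega_{\alpha,p}$ and, for all $\gamma,\delta>0$ and both choices of the sign, $$\left\{\frac1\delta\int_0^\delta|\varphi_x(t)-\varphi_x(t\pm\gamma)|^p\,dt\right\}^{1/p}\le C\,w_x(\gamma),\qquad \left\{\frac1\delta\int_0^\delta|\varphi_x(t)|^p\,dt\right\}^{1/p}\le C\,w_x(\delta)$$ (essential suprema over $(0,\delta]$ if $p=\infty$). Let $(a_{n,k})_{n,k\ge0}$ be a matrix of real numbers such that, for every $n$, the row $(a_{n,k})_k$ is nonnegative and nonincreasing (class $MS$) and $\sum_{k=0}^\infty a_{n,k}=1$, and such that $\lim_{n\to\infty}a_{n,0}=0$. Then for $n=0,1,2,\dots$ $$\left\{\sum_{k=0}^\infty a_{n,k}\left|S_{\alpha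 k/2}f(x)-f(x)\right|^q\right\}^{1/q}\le K\left\{\sum_{k=0}^\infty a_{n,k}\left[w_x\!\left(\frac{\pi}{k+1}\right)+E_{\alpha k/2}(f)_{S^p}\right]^q\right\}^{1/q},$$ where the constant $K>0$ depends only on $\alpha$, $p$, $q$ and $C$. -/

import Mathlib

open MeasureTheory Filter Topology
open scoped ENNReal NNReal

noncomputable section

/-- Lebesgue measure on the interval `(a, b]`, divided by the length `b - a`. For `p < ∞`,
`eLpNorm g p (averageMeasure a b)` is `((b - a)⁻¹ ∫_a^b |g|^p)^(1/p)`; for `p = ∞` it is the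
essential supremum of `|g|` on `(a, b]`. -/
def averageMeasure (a b : ℝ) : Measure ℝ :=
  (ENNReal.ofReal (b - a))⁻¹ • volume.restrict (Set.Ioc a b)

/-- The Stepanov norm over windows of length `π`, with the supremum norm for `p = ∞`. -/
def stepanovNorm (p : ℝ≥0∞) (f : ℝ → ℂ) : ℝ≥0∞ :=
  if p = ∞ then ⨆ u : ℝ, ‖f u‖ₑ
  else ⨆ u : ℝ, eLpNorm f p (averageMeasure u (u + Real.pi))

/-- The trigonometric polynomial `t ↦ ∑_{μ ∈ s} c_μ e^{iμt}` with real frequencies. -/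
def trigPoly (s : Finset ℝ) (c : ℝ → ℂ) (t : ℝ) : ℂ :=
  ∑ μ ∈ s, c μ * Complex.exp (Complex.I * μ * t)

/-- The class `S^p` of Stepanov almost periodic functions: the closure of the trigonometric
polynomials in the Stepanov norm. -/
structure IsStepanovAP (p : ℝ≥0∞) (f : ℝ → ℂ) : Prop where
  aestronglyMeasurable : AEStronglyMeasurable f volume
  approx : ∀ ε : ℝ, 0 < ε → ∃ (s : Finset ℝ) (c : ℝ → ℂ),
    stepanovNorm p (fun t => f t - trigPoly s c t) ≤ ENNReal.ofReal ε

/-- The Fourier coefficient of `f` at frequency `μ`,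
`lim_{L → ∞} (1/L) ∫_0^L f(t) e^{-iμt} dt` (the limit exists for `f` in `S^p`). -/
def apCoeff (f : ℝ → ℂ) (μ : ℝ) : ℂ :=
  limUnder atTop (fun L : ℝ =>
    ((1 / L : ℝ) : ℂ) * ∫ t in (0 : ℝ)..L, f t * Complex.exp (-(Complex.I * μ * t)))

/-- The positive Fourier exponents: those `μ > 0` such that the coefficient at `μ` or at `-μ`
does not vanish. -/
def posExponents (f : ℝ → ℂ) : Set ℝ :=
  {μ | 0 < μ ∧ (apCoeff f μ ≠ 0 ∨ apCoeff f (-μ) ≠ 0)}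

/-- The class `Ω_{α,p}`: bounded functions in `S^p` any two distinct positive Fourier exponents
of which differ by at least `α`. -/
structure MemOmega (α : ℝ) (p : ℝ≥0∞) (f : ℝ → ℂ) : Prop where
  isStepanovAP : IsStepanovAP p f
  bounded : ∃ B : ℝ, ∀ t : ℝ, ‖f t‖ ≤ B
  gap : ∀ μ ∈ posExponents f, ∀ ν ∈ posExponents f, μ < ν → α ≤ ν - μ

/-- The partial sum of the Fourier series over the exponents of modulus at most `γ`. (The sum
ranges over the frequencies with nonzero coefficient, finitely many for `f` in `Ω_{α,p}`.) -/
def apPartialSum (f : ℝ → ℂ) (γ x : ℝ) : ℂ :=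
  ∑ᶠ μ ∈ {μ : ℝ | |μ| ≤ γ}, apCoeff f μ * Complex.exp (Complex.I * μ * x)

/-- `φ_x(t) = f(x + t) + f(x - t) - 2 f(x)`. -/
def symmDiff₂ (f : ℝ → ℂ) (x t : ℝ) : ℂ :=
  f (x + t) + f (x - t) - 2 * f x

/-- Functions of modulus of continuity type on `[0, ∞)`. -/
structure IsModulusType (w : ℝ → ℝ) : Prop where
  mono : MonotoneOn w (Set.Ici 0)
  cont : ContinuousOn w (Set.Ici 0)
  zero : w 0 = 0
  subadd : ∀ δ₁ δ₂ : ℝ, 0 ≤ δ₁ → 0 ≤ δ₂ → w (δ₁ + δ₂) ≤ w δ₁ + w δ₂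

/-- The class `Ω_{α,p}(w_x)`, with `C` the constant in its two defining estimates. -/
structure MemOmegaAt (α : ℝ) (p : ℝ≥0∞) (w : ℝ → ℝ) (x : ℝ) (C : ℝ≥0) (f : ℝ → ℂ) : Prop where
  memOmega : MemOmega α p f
  shift_add : ∀ γ δ : ℝ, 0 < γ → 0 < δ →
    eLpNorm (fun t => symmDiff₂ f x t - symmDiff₂ f x (t + γ)) p (averageMeasure 0 δ)
      ≤ C * ENNReal.ofReal (w γ)
  shift_sub : ∀ γ δ : ℝ, 0 < γ → 0 < δ →
    eLpNorm (fun t => symmDiff₂ f x t - symmDiff₂ f x (t - γ)) p (averageMeasure 0 δ)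
      ≤ C * ENNReal.ofReal (w γ)
  modulus : ∀ δ : ℝ, 0 < δ →
    eLpNorm (symmDiff₂ f x) p (averageMeasure 0 δ) ≤ C * ENNReal.ofReal (w δ)

/-- The class `B_σ`: entire functions of exponential type (at most) `σ`, bounded on the
real axis. -/
structure IsExpTypeBounded (σ : ℝ) (g : ℂ → ℂ) : Prop where
  entire : Differentiable ℂ g
  expType : ∀ ε : ℝ, 0 < ε → ∃ M : ℝ, ∀ z : ℂ, ‖g z‖ ≤ M * Real.exp ((σ + ε) * ‖z‖)
  bounded : ∃ M : ℝ, ∀ t : ℝ, ‖g t‖ ≤ M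

/-- The best approximation `E_σ(f)_{S^p}`. -/
def bestApprox (p : ℝ≥0∞) (σ : ℝ) (f : ℝ → ℂ) : ℝ≥0∞ :=
  ⨅ (g : ℂ → ℂ) (_ : IsExpTypeBounded σ g), stepanovNorm p (fun t => f t - g t)

/-- The class `MS` of nonnegative nonincreasing sequences. -/
def IsMS (a : ℕ → ℝ) : Prop :=
  (∀ k, 0 ≤ a k) ∧ Antitone a

/-- The strong mean `{∑_k a_k |S_{γ_k} f(x) - f(x)|^q}^{1/q}` for one row `a` of the matrix. -/
def strongMean (q : ℝ) (a γ : ℕ → ℝ) (f : ℝ → ℂ) (x : ℝ) : ℝ≥0∞ :=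
  (∑' k : ℕ, ENNReal.ofReal (a k) * ‖apPartialSum f (γ k) x - f x‖ₑ ^ q) ^ (1 / q)

end

/-! Put c = α/2. The Fourier transform of `trapKernel c k` is the trapezoid equal to 1 on [-kc, kc]
and to 0 beyond (k+1)c. Positive exponents are at least 2c apart, so of two adjacent intervals of
length c one is free of them. Hence every S_{kc}f with k ≥ 1 is the convolution of f with the
trapezoidal kernel of index k or k-1 (`MemOmega.apPartialSum_eq_or`). This identification rests on
the uniqueness theorem for almost periodic functions (`IsUniformAP.eq_zero`), which applies because
the convolution turns Stepanov limits into uniform ones. The kernel D_k is even with integral 1, so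
the deviation from f(x) is ½∫φ_x D_k (`trapConv_sub_apply`).

These integrals are estimated jointly over a block of k comparable to n = 2^m. Write φ_x = φ_x * J +
h with a Jackson kernel J whose spectrum lies in [-nc/2, nc/2]. The trapezoids of the block
reproduce the first part, which contributes ½(φ_x * J)(0), of order w(π/n). By Jensen's inequality
and the shift conditions, the p-th power averages of h over every (0, δ] are of order w(π/n)^p
(`HasAveragedModulus.lintegral_jacksonRem_le`).

For functions with such averages the ℓ^q norm of the integrals over the block is of order n^{1/q}
times the size of the averages (`HasUnitAverages.exists_lqNorm_le`). Near 0 the kernel is O(n),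
beyond the period P = 2π/c it is O(t⁻²). On a dyadic interval between P/n and P the integrals are
Fourier coefficients on one period: truncating h and applying Bessel's inequality to the bounded
part gives bounds that decay geometrically in the dyadic index. One may assume p ≤ 2 and q ≥ 2,
since power means increase with the exponent.

The indices k = 0, 1 are exceptional, because the trapezoid of index 0 equals 1 only at the origin
and reproduces no Jackson kernel. There S_{kc}f(x) and f(x) are both compared with a constant, which
is what a bounded function of exponential type zero is by Phragmén–Lindelöf and Liouville; this is
the only place where the best approximation enters. The blocks are then summed as in Cauchy
condensation, the weights and the majorants being nonincreasing (`tsum_mul_le_of_block_le`). -/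

/-! ### The integral of (1 - cos at)/t² over the line -/

theorem integrableOn_exp_neg_mul_Ioi {s : ℝ} (hs : 0 < s) :
    IntegrableOn (fun t : ℝ => Real.exp (-(s * t))) (Set.Ioi 0) := by
  have := integrableOn_exp_mul_Ioi (a := -s) (by linarith) 0
  simpa [neg_mul] using this

theorem integrableOn_one_sub_cos_mul_exp {s : ℝ} (hs : 0 < s) :
    IntegrableOn (fun t : ℝ => (1 - Real.cos t) * Real.exp (-(s * t))) (Set.Ioi 0) := by
  refine ((integrableOn_exp_neg_mul_Ioi hs).const_mul 2).mono' (by fun_prop) (ae_of_all _ ?_)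
  intro t
  rw [norm_mul, Real.norm_eq_abs, Real.norm_eq_abs, abs_of_pos (Real.exp_pos _)]
  gcongr
  rw [abs_le]
  constructor <;> linarith [Real.cos_le_one t, Real.neg_one_le_cos t]

theorem integral_one_sub_cos_mul_exp {s : ℝ} (hs : 0 < s) :
    ∫ t in Set.Ioi (0 : ℝ), (1 - Real.cos t) * Real.exp (-(s * t)) = 1 / (s * (1 + s ^ 2)) := by
  have h1 : ∀ t : ℝ, (1 - Real.cos t) * Real.exp (-(s * t)) =
      Real.exp (-(s * t)) - Real.cos t * Real.exp (-(s * t)) := fun t => by ring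
  have hInt : IntegrableOn (fun t : ℝ => Real.cos t * Real.exp (-(s * t))) (Set.Ioi 0) := by
    have := (integrableOn_exp_neg_mul_Ioi hs).sub (integrableOn_one_sub_cos_mul_exp hs)
    refine this.congr (ae_of_all _ fun t => ?_)
    simp only [Pi.sub_apply]; ring
  have ha : ((-s : ℂ) + Complex.I).re < 0 := by simp [hs]
  have hcos : ∫ t in Set.Ioi (0 : ℝ), Real.cos t * Real.exp (-(s * t)) = s / (1 + s ^ 2) := by
    have h2 := integral_exp_mul_complex_Ioi ha 0
    have h3 := congrArg Complex.re h2
    have h4 : (∫ t in Set.Ioi (0 : ℝ), Complex.exp ((-s + Complex.I) * t)).re =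
        ∫ t in Set.Ioi (0 : ℝ), (Complex.exp ((-s + Complex.I) * t)).re :=
      (integral_re (integrableOn_exp_mul_complex_Ioi ha 0)).symm
    rw [h4] at h3
    have h5 : ∀ t : ℝ, (Complex.exp ((-s + Complex.I) * t)).re =
        Real.cos t * Real.exp (-(s * t)) := by
      intro t
      rw [Complex.exp_re]
      simp [mul_comm]
    simp_rw [h5] at h3
    rw [h3]
    simp [Complex.div_re, Complex.normSq_apply]
    ring
  simp_rw [h1]
  rw [integral_sub (integrableOn_exp_neg_mul_Ioi hs) hInt, hcos]
  have := integral_exp_mul_Ioi (a := -s) (by linarith) 0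
  simp only [neg_mul] at this
  rw [this]
  simp
  field_simp
  ring

theorem integral_mul_exp_neg_mul_Ioi {t : ℝ} (ht : 0 < t) :
    ∫ s in Set.Ioi (0 : ℝ), s * Real.exp (-(s * t)) = 1 / t ^ 2 := by
  have := Real.integral_rpow_mul_exp_neg_mul_Ioi (a := 2) (r := t) (by norm_num) ht
  norm_num at this
  rw [one_div, ← this]
  refine integral_congr_ae (ae_of_all _ fun s => ?_)
  simp [mul_comm]

/-- Write 1/t² = ∫ s e^{-st} ds and exchange the integrals, the integrand being nonnegative. The
Laplace transform of 1 - cos t then leaves ∫ ds/(1+s²) over the half-line. -/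
theorem integral_one_sub_cos_div_sq_Ioi :
    ∫ t in Set.Ioi (0 : ℝ), (1 - Real.cos t) / t ^ 2 = Real.pi / 2 := by
  have hprod : Integrable (Function.uncurry fun t s : ℝ =>
      (1 - Real.cos t) * (s * Real.exp (-(s * t))))
      ((volume.restrict (Set.Ioi 0)).prod (volume.restrict (Set.Ioi 0))) := by
    rw [integrable_prod_iff' (by unfold Function.uncurry; fun_prop)]
    constructor
    · filter_upwards [ae_restrict_mem measurableSet_Ioi] with s hs
      refine ((integrableOn_one_sub_cos_mul_exp hs).const_mul s).congr (ae_of_all _ fun t => ?_)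
      simp only [Function.uncurry]; ring
    · have : Integrable (fun s : ℝ => (1 + s ^ 2)⁻¹) (volume.restrict (Set.Ioi 0)) :=
        integrable_inv_one_add_sq.restrict
      refine this.congr ?_
      filter_upwards [ae_restrict_mem measurableSet_Ioi] with s hs
      have hs' : 0 < s := hs
      have h : ∀ t : ℝ, ‖Function.uncurry (fun t s : ℝ =>
          (1 - Real.cos t) * (s * Real.exp (-(s * t)))) (t, s)‖ =
          s * ((1 - Real.cos t) * Real.exp (-(s * t))) := by
        intro t
        simp only [Function.uncurry]
        rw [Real.norm_of_nonneg]
        · ring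
        · have := Real.cos_le_one t
          have : 0 ≤ 1 - Real.cos t := by linarith
          positivity
      simp_rw [h]
      rw [integral_const_mul, integral_one_sub_cos_mul_exp hs']
      field_simp
  have hswap := integral_integral_swap hprod
  have hl : ∫ t in Set.Ioi (0 : ℝ), ∫ s in Set.Ioi (0 : ℝ),
      (1 - Real.cos t) * (s * Real.exp (-(s * t))) =
      ∫ t in Set.Ioi (0 : ℝ), (1 - Real.cos t) / t ^ 2 := by
    refine setIntegral_congr_fun measurableSet_Ioi fun t ht => ?_
    rw [integral_const_mul, integral_mul_exp_neg_mul_Ioi ht]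
    ring
  have hr : ∫ s in Set.Ioi (0 : ℝ), ∫ t in Set.Ioi (0 : ℝ),
      (1 - Real.cos t) * (s * Real.exp (-(s * t))) =
      ∫ s in Set.Ioi (0 : ℝ), (1 + s ^ 2)⁻¹ := by
    refine setIntegral_congr_fun measurableSet_Ioi fun s hs => ?_
    have hs' : 0 < s := hs
    have h : ∀ t : ℝ, (1 - Real.cos t) * (s * Real.exp (-(s * t))) =
          s * ((1 - Real.cos t) * Real.exp (-(s * t))) := fun t => by ring
    simp only [h]
    rw [integral_const_mul, integral_one_sub_cos_mul_exp hs']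
    field_simp
  rw [← hl, hswap, hr, integral_Ioi_inv_one_add_sq]
  simp

theorem one_sub_cos_div_sq_le (a t : ℝ) :
    ‖(1 - Real.cos (a * t)) / t ^ 2‖ ≤ (2 + a ^ 2) * (1 + t ^ 2)⁻¹ := by
  have h0 : 0 ≤ 1 - Real.cos (a * t) := by linarith [Real.cos_le_one (a * t)]
  have h1 : 1 - Real.cos (a * t) ≤ (a * t) ^ 2 / 2 := by
    linarith [Real.one_sub_sq_div_two_le_cos (x := a * t)]
  have h2 : 1 - Real.cos (a * t) ≤ 2 := by linarith [Real.neg_one_le_cos (a * t)]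
  rw [Real.norm_of_nonneg (by positivity), ← div_eq_mul_inv]
  rcases eq_or_ne t 0 with rfl | ht
  · simp; positivity
  rw [div_le_div_iff₀ (by positivity) (by positivity)]
  have ht2 : 0 < t ^ 2 := by positivity
  nlinarith [mul_le_mul_of_nonneg_right h2 ht2.le, sq_nonneg (a * t)]

theorem integrable_one_sub_cos_div_sq (a : ℝ) :
    Integrable (fun t : ℝ => (1 - Real.cos (a * t)) / t ^ 2) :=
  (integrable_inv_one_add_sq.const_mul (2 + a ^ 2)).mono'
    (Measurable.aestronglyMeasurable (by fun_prop)) (ae_of_all _ (one_sub_cos_div_sq_le a))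

theorem integral_one_sub_cos_div_sq (a : ℝ) :
    ∫ t : ℝ, (1 - Real.cos (a * t)) / t ^ 2 = Real.pi * |a| := by
  have h1 : ∫ t : ℝ, (1 - Real.cos t) / t ^ 2 = Real.pi := by
    have := integral_comp_abs (f := fun t => (1 - Real.cos t) / t ^ 2)
    simp only [Real.cos_abs, sq_abs] at this
    rw [this, integral_one_sub_cos_div_sq_Ioi]; ring
  rcases eq_or_ne a 0 with rfl | ha
  · simp
  have h2 := Measure.integral_comp_mul_left (fun t : ℝ => (1 - Real.cos t) / t ^ 2) a
  rw [h1] at h2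
  have h3 : ∀ t : ℝ, (1 - Real.cos (a * t)) / t ^ 2 =
      a ^ 2 * ((1 - Real.cos (a * t)) / (a * t) ^ 2) := by
    intro t
    rcases eq_or_ne t 0 with rfl | ht
    · simp
    field_simp
  simp_rw [h3]
  rw [integral_const_mul, h2, smul_eq_mul, abs_inv, ← sq_abs]
  have := abs_pos.2 ha
  field_simp

/-! ### The trapezoidal kernel and its Fourier transform -/

/-- The kernel whose Fourier transform is the trapezoid equal to `1` on `[-kc, kc]` and to `0`
outside `[-(k+1)c, (k+1)c]`. -/
noncomputable def trapKernel (c : ℝ) (k : ℕ) (t : ℝ) : ℝ :=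
  (Real.cos (k * c * t) - Real.cos ((k + 1) * c * t)) / (Real.pi * c * t ^ 2)

theorem measurable_trapKernel (c : ℝ) (k : ℕ) : Measurable (trapKernel c k) := by
  unfold trapKernel; fun_prop

theorem trapKernel_neg (c : ℝ) (k : ℕ) (t : ℝ) : trapKernel c k (-t) = trapKernel c k t := by
  simp [trapKernel]

/-- The source of the three size bounds: estimating both sines by 1 gives O(t⁻²), only the second by
its argument gives 1/(π|t|), and both by their arguments gives O(k+1). -/
theorem abs_trapKernel_eq {c : ℝ} (hc : 0 < c) (k : ℕ) (t : ℝ) :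
    |trapKernel c k t| =
      2 * |Real.sin ((k + 1 / 2) * c * t)| * |Real.sin (c * t / 2)| / (Real.pi * c * t ^ 2) := by
  have hpi := Real.pi_pos
  rw [trapKernel, abs_div, abs_of_nonneg (by positivity : 0 ≤ Real.pi * c * t ^ 2),
    Real.cos_sub_cos, abs_mul, abs_mul]
  have h1 : (k * c * t + (k + 1) * c * t) / 2 = (k + 1 / 2) * c * t := by ring
  have h2 : (k * c * t - (k + 1) * c * t) / 2 = -(c * t / 2) := by ring
  rw [h1, h2, Real.sin_neg, abs_neg]
  norm_num

theorem abs_trapKernel_le_inv_sq {c : ℝ} (hc : 0 < c) (k : ℕ) (t : ℝ) :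
    |trapKernel c k t| ≤ 2 / (Real.pi * c * t ^ 2) := by
  have hpi := Real.pi_pos
  rw [abs_trapKernel_eq hc]
  gcongr
  have := mul_le_mul (Real.abs_sin_le_one ((k + 1 / 2) * c * t))
    (Real.abs_sin_le_one (c * t / 2)) (abs_nonneg _) zero_le_one
  linarith

theorem abs_trapKernel_le_inv {c : ℝ} (hc : 0 < c) (k : ℕ) (t : ℝ) :
    |trapKernel c k t| ≤ 1 / (Real.pi * |t|) := by
  have hpi := Real.pi_pos
  rw [abs_trapKernel_eq hc]
  rcases eq_or_ne t 0 with rfl | ht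
  · simp
  have ht' := abs_pos.2 ht
  have h1 : 2 * |Real.sin ((k + 1 / 2) * c * t)| * |Real.sin (c * t / 2)| ≤ c * |t| := by
    have h3 : |Real.sin (c * t / 2)| ≤ c * |t| / 2 := by
      refine Real.abs_sin_le_abs.trans ?_
      rw [abs_div, abs_mul, abs_of_pos hc]; norm_num
    have := mul_le_mul (Real.abs_sin_le_one ((k + 1 / 2) * c * t)) h3 (abs_nonneg _) zero_le_one
    linarith
  calc _ ≤ c * |t| / (Real.pi * c * t ^ 2) := by gcongr
    _ = 1 / (Real.pi * |t|) := by rw [← sq_abs]; field_simp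

theorem abs_trapKernel_le {c : ℝ} (hc : 0 < c) (k : ℕ) (t : ℝ) :
    |trapKernel c k t| ≤ c * (k + 1) / Real.pi := by
  have hpi := Real.pi_pos
  rw [abs_trapKernel_eq hc]
  rcases eq_or_ne t 0 with rfl | ht
  · simp; positivity
  have ht' := abs_pos.2 ht
  have h1 : |Real.sin (c * t / 2)| ≤ c * |t| / 2 := by
    refine Real.abs_sin_le_abs.trans ?_
    rw [abs_div, abs_mul, abs_of_pos hc]; norm_num
  have h2 : |Real.sin ((k + 1 / 2) * c * t)| ≤ (k + 1) * c * |t| := by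
    refine Real.abs_sin_le_abs.trans ?_
    rw [abs_mul, abs_of_nonneg (by positivity)]
    gcongr
    norm_num
  calc _ ≤ 2 * ((k + 1) * c * |t|) * (c * |t| / 2) / (Real.pi * c * t ^ 2) := by gcongr
    _ = c * (k + 1) / Real.pi := by rw [← sq_abs t]; field_simp

theorem abs_trapKernel_le_inv_one_add_sq {c : ℝ} (hc : 0 < c) (k : ℕ) (t : ℝ) :
    |trapKernel c k t| ≤ (c * (k + 1) / Real.pi + 2 / (Real.pi * c)) * (1 + t ^ 2)⁻¹ := by
  have hpi := Real.pi_pos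
  rw [← div_eq_mul_inv, le_div_iff₀ (by positivity)]
  have h2 : |trapKernel c k t| * t ^ 2 ≤ 2 / (Real.pi * c) := by
    rcases eq_or_ne t 0 with rfl | ht
    · simp; positivity
    calc _ ≤ 2 / (Real.pi * c * t ^ 2) * t ^ 2 := by gcongr; exact abs_trapKernel_le_inv_sq hc k t
      _ = _ := by field_simp
  linarith [abs_trapKernel_le hc k t]

theorem integrable_trapKernel {c : ℝ} (hc : 0 < c) (k : ℕ) : Integrable (trapKernel c k) :=
  (integrable_inv_one_add_sq.const_mul _).mono' (measurable_trapKernel c k).aestronglyMeasurable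
    (ae_of_all _ (abs_trapKernel_le_inv_one_add_sq hc k))

/-- The product formulas for cosines turn the integrand into four functions of the form (1 - cos
at)/t², whose integrals are π|a|; the trapezoid is the resulting second difference of absolute
values. -/
theorem integral_trapKernel_mul_cos {c : ℝ} (hc : 0 < c) (k : ℕ) (μ : ℝ) :
    ∫ t : ℝ, trapKernel c k t * Real.cos (μ * t) =
      (|(k + 1) * c + μ| + |(k + 1) * c - μ| - |k * c + μ| - |k * c - μ|) / (2 * c) := by
  have hpi := Real.pi_pos
  have h : ∀ t : ℝ, trapKernel c k t * Real.cos (μ * t) = (2 * Real.pi * c)⁻¹ *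
      ((1 - Real.cos (((k + 1) * c + μ) * t)) / t ^ 2 + (1 - Real.cos (((k + 1) * c - μ) * t)) / t ^ 2
        - (1 - Real.cos ((k * c + μ) * t)) / t ^ 2 - (1 - Real.cos ((k * c - μ) * t)) / t ^ 2) := by
    intro t
    rcases eq_or_ne t 0 with rfl | ht
    · simp [trapKernel]
    rw [trapKernel, add_mul _ μ, sub_mul _ μ, add_mul _ μ, sub_mul _ μ, Real.cos_add, Real.cos_sub,
      Real.cos_add, Real.cos_sub]
    field_simp
    ring
  simp_rw [h]
  rw [integral_const_mul, integral_sub, integral_sub, integral_add]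
  · simp only [integral_one_sub_cos_div_sq]
    field_simp
  all_goals first
    | exact integrable_one_sub_cos_div_sq _
    | exact (integrable_one_sub_cos_div_sq _).add (integrable_one_sub_cos_div_sq _)
    | exact ((integrable_one_sub_cos_div_sq _).add (integrable_one_sub_cos_div_sq _)).sub
        (integrable_one_sub_cos_div_sq _)

theorem integrable_trapKernel_mul_exp {c : ℝ} (hc : 0 < c) (k : ℕ) (μ : ℝ) :
    Integrable (fun t : ℝ => (trapKernel c k t : ℂ) * Complex.exp (Complex.I * μ * t)) := by
  refine (integrable_trapKernel hc k).ofReal.mul_bdd (c := 1) (by fun_prop) (ae_of_all _ fun t => ?_)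
  rw [show Complex.I * μ * t = ((μ * t : ℝ) : ℂ) * Complex.I by push_cast; ring,
    Complex.norm_exp_ofReal_mul_I]

theorem integral_eq_zero_of_odd {E : Type*} [NormedAddCommGroup E] [NormedSpace ℝ E] {g : ℝ → E}
    (hg : ∀ t, g (-t) = -g t) : ∫ t : ℝ, g t = 0 := by
  have h := integral_neg_eq_self g volume
  simp_rw [hg] at h
  rw [integral_neg] at h
  have : (2 : ℝ) • ∫ t : ℝ, g t = 0 := by
    rw [two_smul]
    nth_rw 1 [← h]
    simp
  simpa using this

/-- The Fourier transform of the trapezoidal kernel. -/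
theorem integral_trapKernel_mul_exp {c : ℝ} (hc : 0 < c) (k : ℕ) (μ : ℝ) :
    ∫ t : ℝ, (trapKernel c k t : ℂ) * Complex.exp (Complex.I * μ * t) =
      ((|(k + 1) * c + μ| + |(k + 1) * c - μ| - |k * c + μ| - |k * c - μ|) / (2 * c) : ℝ) := by
  rw [← integral_trapKernel_mul_cos hc]
  have h : ∀ t : ℝ, (trapKernel c k t : ℂ) * Complex.exp (Complex.I * μ * t) =
      ((trapKernel c k t * Real.cos (μ * t) : ℝ) : ℂ) +
        ((trapKernel c k t * Real.sin (μ * t) : ℝ) : ℂ) * Complex.I := by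
    intro t
    rw [show Complex.I * μ * t = ((μ * t : ℝ) : ℂ) * Complex.I by push_cast; ring, Complex.exp_mul_I]
    push_cast
    ring
  simp_rw [h]
  have hi1 : Integrable (fun t => trapKernel c k t * Real.cos (μ * t)) :=
    (integrable_trapKernel hc k).mul_bdd (c := 1) (by fun_prop)
      (ae_of_all _ fun t => Real.abs_cos_le_one _)
  have hi2 : Integrable (fun t => trapKernel c k t * Real.sin (μ * t)) :=
    (integrable_trapKernel hc k).mul_bdd (c := 1) (by fun_prop)
      (ae_of_all _ fun t => Real.abs_sin_le_one _)
  rw [integral_add hi1.ofReal (hi2.ofReal.mul_const _), integral_mul_const]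
  have h0 : ∫ t : ℝ, ((trapKernel c k t * Real.sin (μ * t) : ℝ) : ℂ) = 0 := by
    refine integral_eq_zero_of_odd fun t => ?_
    rw [trapKernel_neg]
    simp
  rw [h0, zero_mul, add_zero]
  exact integral_ofReal

theorem integral_trapKernel_mul_exp_of_le {c : ℝ} (hc : 0 < c) (k : ℕ) {μ : ℝ} (hμ : |μ| ≤ k * c) :
    ∫ t : ℝ, (trapKernel c k t : ℂ) * Complex.exp (Complex.I * μ * t) = 1 := by
  rw [integral_trapKernel_mul_exp hc]
  obtain ⟨h1, h2⟩ := abs_le.1 hμ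
  rw [abs_of_nonneg (by nlinarith : 0 ≤ (k + 1) * c + μ), abs_of_nonneg (by nlinarith),
    abs_of_nonneg (by linarith : 0 ≤ k * c + μ), abs_of_nonneg (by linarith)]
  rw [Complex.ofReal_eq_one]
  field_simp
  ring

theorem integral_trapKernel_mul_exp_of_ge {c : ℝ} (hc : 0 < c) (k : ℕ) {μ : ℝ}
    (hμ : (k + 1) * c ≤ |μ|) :
    ∫ t : ℝ, (trapKernel c k t : ℂ) * Complex.exp (Complex.I * μ * t) = 0 := by
  rw [integral_trapKernel_mul_exp hc]
  have hk : 0 ≤ (k : ℝ) * c := by positivity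
  rcases le_abs.1 hμ with h | h
  · rw [abs_of_nonneg (by nlinarith : 0 ≤ (k + 1) * c + μ), abs_of_nonpos (by linarith),
      abs_of_nonneg (by nlinarith : 0 ≤ k * c + μ), abs_of_nonpos (by linarith)]
    rw [Complex.ofReal_eq_zero]
    field_simp
    ring
  · rw [abs_of_nonpos (by nlinarith : (k + 1) * c + μ ≤ 0), abs_of_nonneg (by nlinarith),
      abs_of_nonpos (by nlinarith : k * c + μ ≤ 0), abs_of_nonneg (by nlinarith)]
    rw [Complex.ofReal_eq_zero]
    field_simp
    ring

/-! ### Mean values and Fourier coefficients of Stepanov functions -/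

theorem norm_exp_I_mul_mul (μ t : ℝ) : ‖Complex.exp (Complex.I * μ * t)‖ = 1 := by
  rw [show Complex.I * μ * t = ((μ * t : ℝ) : ℂ) * Complex.I by push_cast; ring,
    Complex.norm_exp_ofReal_mul_I]

theorem norm_exp_neg_I_mul_mul (μ t : ℝ) : ‖Complex.exp (-(Complex.I * μ * t))‖ = 1 := by
  rw [Complex.exp_neg, norm_inv, norm_exp_I_mul_mul, inv_one]

/-- The mean of `f(t) e^{-iμt}` over `[0, L]`. -/
noncomputable def apMean (f : ℝ → ℂ) (μ L : ℝ) : ℂ :=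
  ((1 / L : ℝ) : ℂ) * ∫ t in (0 : ℝ)..L, f t * Complex.exp (-(Complex.I * μ * t))

theorem continuous_trigPoly (s : Finset ℝ) (c : ℝ → ℂ) : Continuous (trigPoly s c) := by
  unfold trigPoly; fun_prop

theorem norm_trigPoly_le (s : Finset ℝ) (c : ℝ → ℂ) (t : ℝ) :
    ‖trigPoly s c t‖ ≤ ∑ μ ∈ s, ‖c μ‖ := by
  refine (norm_sum_le _ _).trans (Finset.sum_le_sum fun μ _ => ?_)
  rw [norm_mul, norm_exp_I_mul_mul, mul_one]

theorem tendsto_mean_exp (ν : ℝ) :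
    Tendsto (fun L : ℝ => ((1 / L : ℝ) : ℂ) * ∫ t in (0 : ℝ)..L, Complex.exp (Complex.I * ν * t))
      atTop (𝓝 (if ν = 0 then 1 else 0)) := by
  split_ifs with h
  · subst h
    refine tendsto_const_nhds.congr' ?_
    filter_upwards [eventually_gt_atTop 0] with L hL
    simp [hL.ne']
  · have hI : Complex.I * ν ≠ 0 := by simp [h]
    refine squeeze_zero_norm' (a := fun L => (1 / L) * (2 / |ν|)) ?_ ?_
    · filter_upwards [eventually_gt_atTop 0] with L hL
      rw [integral_exp_mul_complex hI, norm_mul, norm_div, Complex.norm_real,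
        Real.norm_of_nonneg (by positivity)]
      gcongr
      · refine (norm_sub_le _ _).trans ?_
        rw [norm_exp_I_mul_mul, norm_exp_I_mul_mul]; norm_num
      · simp
    · have := (tendsto_inv_atTop_zero (𝕜 := ℝ)).mul_const (2 / |ν|)
      simpa [one_div] using this

theorem tendsto_apMean_trigPoly (s : Finset ℝ) (c : ℝ → ℂ) (μ : ℝ) :
    Tendsto (apMean (trigPoly s c) μ) atTop (𝓝 (if μ ∈ s then c μ else 0)) := by
  have h1 : ∀ L : ℝ, apMean (trigPoly s c) μ L = ∑ ν ∈ s, c ν *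
      (((1 / L : ℝ) : ℂ) * ∫ t in (0 : ℝ)..L, Complex.exp (Complex.I * (ν - μ : ℝ) * t)) := by
    intro L
    have h2 : ∀ t : ℝ, trigPoly s c t * Complex.exp (-(Complex.I * μ * t)) =
        ∑ ν ∈ s, c ν * Complex.exp (Complex.I * (ν - μ : ℝ) * t) := by
      intro t
      rw [trigPoly, Finset.sum_mul]
      refine Finset.sum_congr rfl fun ν _ => ?_
      rw [mul_assoc, ← Complex.exp_add]
      congr 2
      push_cast
      ring
    simp_rw [apMean, h2]
    rw [intervalIntegral.integral_finsetSum
      (fun ν _ => Continuous.intervalIntegrable (by fun_prop) _ _), Finset.mul_sum]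
    refine Finset.sum_congr rfl fun ν _ => ?_
    rw [intervalIntegral.integral_const_mul]
    ring
  simp_rw [funext h1]
  have h3 : (if μ ∈ s then c μ else 0) = ∑ ν ∈ s, c ν * (if ν - μ = 0 then (1 : ℂ) else 0) := by
    simp [sub_eq_zero]
  rw [h3]
  exact tendsto_finsetSum _ fun ν _ => (tendsto_mean_exp (ν - μ)).const_mul _

theorem isProbabilityMeasure_averageMeasure {a b : ℝ} (h : a < b) :
    IsProbabilityMeasure (averageMeasure a b) := by
  constructor
  have : ENNReal.ofReal (b - a) ≠ 0 := by simpa using h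
  simp [averageMeasure, ENNReal.inv_mul_cancel this ENNReal.ofReal_ne_top]

theorem averageMeasure_absolutelyContinuous {a b : ℝ} : averageMeasure a b ≪ volume :=
  (Measure.smul_absolutelyContinuous).trans Measure.absolutelyContinuous_restrict

theorem eLpNorm_averageMeasure_le_stepanovNorm (p : ℝ≥0∞) (f : ℝ → ℂ) (u : ℝ) :
    eLpNorm f p (averageMeasure u (u + Real.pi)) ≤ stepanovNorm p f := by
  unfold stepanovNorm
  split_ifs with h
  · subst h
    rw [eLpNorm_exponent_top]
    exact essSup_le_of_ae_le _ (ae_of_all _ fun t => le_iSup (fun u => ‖f u‖ₑ) t)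
  · exact le_iSup (fun u => eLpNorm f p (averageMeasure u (u + Real.pi))) u

/-- An `L^p` bound with respect to the averaged measure gives an `L^1` bound. -/
theorem lintegral_le_of_eLpNorm_averageMeasure {p : ℝ≥0∞} (hp : 1 ≤ p) {f : ℝ → ℂ}
    (hf : AEStronglyMeasurable f volume) {a b : ℝ} (hab : a < b) {B : ℝ≥0∞}
    (h : eLpNorm f p (averageMeasure a b) ≤ B) :
    ∫⁻ t in Set.Ioc a b, ‖f t‖ₑ ≤ ENNReal.ofReal (b - a) * B := by
  have := isProbabilityMeasure_averageMeasure hab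
  have h1 := (eLpNorm_le_eLpNorm_of_exponent_le hp
    (hf.mono_ac averageMeasure_absolutelyContinuous)).trans h
  rw [eLpNorm_one_eq_lintegral_enorm, averageMeasure, lintegral_smul_measure, smul_eq_mul] at h1
  have h0 : ENNReal.ofReal (b - a) ≠ 0 := by simpa using hab
  calc _ = ENNReal.ofReal (b - a) * ((ENNReal.ofReal (b - a))⁻¹ * ∫⁻ t in Set.Ioc a b, ‖f t‖ₑ) := by
        rw [← mul_assoc, ENNReal.mul_inv_cancel h0 ENNReal.ofReal_ne_top, one_mul]
    _ ≤ _ := by gcongr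

theorem lintegral_window_le {p : ℝ≥0∞} (hp : 1 ≤ p) {f : ℝ → ℂ}
    (hf : AEStronglyMeasurable f volume) {ε : ℝ}
    (h : stepanovNorm p f ≤ ENNReal.ofReal ε) (u : ℝ) :
    ∫⁻ t in Set.Ioc u (u + Real.pi), ‖f t‖ₑ ≤ ENNReal.ofReal (Real.pi * ε) := by
  have := lintegral_le_of_eLpNorm_averageMeasure hp hf (b := u + Real.pi)
    (by linarith [Real.pi_pos]) ((eLpNorm_averageMeasure_le_stepanovNorm p f u).trans h)
  rwa [add_sub_cancel_left, ← ENNReal.ofReal_mul Real.pi_pos.le] at this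

theorem lintegral_Ioc_nat_mul_pi_le {f : ℝ → ℂ} {ε : ℝ} (hε : 0 ≤ ε)
    (h : ∀ u : ℝ, ∫⁻ t in Set.Ioc u (u + Real.pi), ‖f t‖ₑ ≤ ENNReal.ofReal (Real.pi * ε)) (N : ℕ) :
    ∫⁻ t in Set.Ioc 0 (N * Real.pi), ‖f t‖ₑ ≤ ENNReal.ofReal (N * (Real.pi * ε)) := by
  have hpi := Real.pi_pos
  induction N with
  | zero => simp
  | succ N ih =>
    have hsub : Set.Ioc 0 (((N + 1 : ℕ) : ℝ) * Real.pi) ⊆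
        Set.Ioc 0 (N * Real.pi) ∪ Set.Ioc (N * Real.pi) (N * Real.pi + Real.pi) := by
      intro t ht
      push_cast at ht
      rcases le_or_gt t (N * Real.pi) with h1 | h1
      · exact Or.inl ⟨ht.1, h1⟩
      · exact Or.inr ⟨h1, by linarith [ht.2]⟩
    refine (lintegral_mono_set hsub).trans ((lintegral_union_le _ _ _).trans ?_)
    refine (add_le_add ih (h _)).trans ?_
    rw [← ENNReal.ofReal_add (by positivity) (by positivity)]
    push_cast
    exact ENNReal.ofReal_le_ofReal (by linarith)

/-- Covering (0, L] by ⌈L/π⌉ windows overshoots by at most π, which is negligible after division by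
L. -/
theorem lintegral_Ioc_zero_le {f : ℝ → ℂ} {ε : ℝ} (hε : 0 ≤ ε)
    (h : ∀ u : ℝ, ∫⁻ t in Set.Ioc u (u + Real.pi), ‖f t‖ₑ ≤ ENNReal.ofReal (Real.pi * ε))
    {L : ℝ} (hL : 0 ≤ L) :
    ∫⁻ t in Set.Ioc 0 L, ‖f t‖ₑ ≤ ENNReal.ofReal ((L + Real.pi) * ε) := by
  have hpi := Real.pi_pos
  have h1 : L ≤ ⌈L / Real.pi⌉₊ * Real.pi := by
    rw [← div_le_iff₀ hpi]; exact Nat.le_ceil _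
  refine (lintegral_mono_set (Set.Ioc_subset_Ioc_right h1)).trans
    ((lintegral_Ioc_nat_mul_pi_le hε h _).trans (ENNReal.ofReal_le_ofReal ?_))
  have h2 : (⌈L / Real.pi⌉₊ : ℝ) * Real.pi ≤ L + Real.pi := by
    have := (Nat.ceil_lt_add_one (div_nonneg hL hpi.le)).le
    calc _ ≤ (L / Real.pi + 1) * Real.pi := by gcongr
      _ = _ := by field_simp
  calc _ = ((⌈L / Real.pi⌉₊ : ℝ) * Real.pi) * ε := by ring
    _ ≤ _ := by gcongr

theorem intervalIntegrable_mul_exp_neg {f : ℝ → ℂ} (hf : LocallyIntegrable f volume) (μ a b : ℝ) :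
    IntervalIntegrable (fun t : ℝ => f t * Complex.exp (-(Complex.I * μ * t))) volume a b :=
  (hf.integrableOn_isCompact isCompact_uIcc).intervalIntegrable.mul_continuousOn (by fun_prop)

theorem locallyIntegrable_of_bounded {f : ℝ → ℂ} (hf : AEStronglyMeasurable f volume)
    {B : ℝ} (hB : ∀ t, ‖f t‖ ≤ B) : LocallyIntegrable f volume :=
  ((locallyIntegrable_const B).mono hf
    (ae_of_all _ fun t => (hB t).trans (le_abs_self B)))

theorem norm_apMean_sub_le {f g : ℝ → ℂ} (hf : LocallyIntegrable f volume)
    (hg : LocallyIntegrable g volume) {ε : ℝ} (hε : 0 ≤ ε)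
    (h : ∀ u : ℝ, ∫⁻ t in Set.Ioc u (u + Real.pi), ‖f t - g t‖ₑ ≤ ENNReal.ofReal (Real.pi * ε))
    (μ : ℝ) {L : ℝ} (hL : 0 < L) :
    ‖apMean f μ L - apMean g μ L‖ ≤ (1 + Real.pi / L) * ε := by
  have hpi := Real.pi_pos
  rw [apMean, apMean, ← mul_sub, ← intervalIntegral.integral_sub
    (intervalIntegrable_mul_exp_neg hf μ 0 L) (intervalIntegrable_mul_exp_neg hg μ 0 L), norm_mul,
    Complex.norm_real, Real.norm_of_nonneg (by positivity)]
  have h1 : ‖∫ t in (0 : ℝ)..L, (f t * Complex.exp (-(Complex.I * μ * t)) -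
      g t * Complex.exp (-(Complex.I * μ * t)))‖ ≤ (L + Real.pi) * ε := by
    rw [intervalIntegral.integral_of_le hL.le]
    refine (ENNReal.ofReal_le_ofReal_iff (by positivity)).1 ?_
    rw [ofReal_norm]
    refine (enorm_integral_le_lintegral_enorm _).trans ?_
    refine le_trans (le_of_eq ?_) (lintegral_Ioc_zero_le (f := fun t => f t - g t) hε h hL.le)
    refine lintegral_congr fun t => ?_
    rw [← sub_mul, enorm_mul, ← ofReal_norm (Complex.exp _), norm_exp_neg_I_mul_mul]
    simp
  calc _ ≤ 1 / L * ((L + Real.pi) * ε) := by gcongr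
    _ = _ := by field_simp

/-- A function that is eventually uniformly close to convergent functions converges. -/
theorem exists_tendsto_of_approx {F : ℝ → ℂ}
    (h : ∀ ε : ℝ, 0 < ε → ∃ (g : ℝ → ℂ) (a : ℂ), Tendsto g atTop (𝓝 a) ∧
      ∀ᶠ L in atTop, ‖F L - g L‖ ≤ ε) : ∃ b, Tendsto F atTop (𝓝 b) := by
  rw [← cauchy_map_iff_exists_tendsto, Metric.cauchy_iff]
  refine ⟨inferInstance, fun ε hε => ?_⟩
  obtain ⟨g, a, hg, hFg⟩ := h (ε / 5) (by positivity)
  have h1 := hg.eventually (Metric.ball_mem_nhds a (by positivity : 0 < ε / 5))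
  refine ⟨F '' {L | ‖F L - g L‖ ≤ ε / 5 ∧ g L ∈ Metric.ball a (ε / 5)},
    image_mem_map (hFg.and h1), ?_⟩
  rintro _ ⟨L, ⟨h2, h3⟩, rfl⟩ _ ⟨L', ⟨h4, h5⟩, rfl⟩
  rw [← dist_eq_norm] at h2 h4
  rw [Metric.mem_ball] at h3 h5
  rw [dist_comm] at h4
  have := dist_triangle4 (F L) (g L) a (F L')
  have h6 := dist_triangle a (g L') (F L')
  rw [dist_comm a (g L')] at h6
  linarith

/-- `apCoeff` is defined through `limUnder` and carries information only once the limit exists. It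
does, because for L ≥ π the means of `f` stay within ε of the convergent means of an approximating
trigonometric polynomial. -/
theorem tendsto_apMean {p : ℝ≥0∞} (hp : 1 ≤ p) {f : ℝ → ℂ} (hf : IsStepanovAP p f)
    (hl : LocallyIntegrable f volume) (μ : ℝ) :
    Tendsto (apMean f μ) atTop (𝓝 (apCoeff f μ)) := by
  refine tendsto_nhds_limUnder (exists_tendsto_of_approx fun ε hε => ?_)
  obtain ⟨s, c, hsc⟩ := hf.approx (ε / 2) (by positivity)
  refine ⟨apMean (trigPoly s c) μ, _, tendsto_apMean_trigPoly s c μ, ?_⟩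
  have hP := (continuous_trigPoly s c)
  filter_upwards [eventually_ge_atTop Real.pi] with L hL
  have hpi := Real.pi_pos
  have hL0 : 0 < L := by linarith
  refine (norm_apMean_sub_le hl hP.locallyIntegrable (by positivity : 0 ≤ ε / 2)
    (lintegral_window_le hp (hf.aestronglyMeasurable.sub hP.aestronglyMeasurable) hsc) μ
    hL0).trans ?_
  have : Real.pi / L ≤ 1 := by rw [div_le_one hL0]; exact hL
  nlinarith

/-- The factor 1 + π/L tends to 1, so no constant is lost: coefficients are 1-Lipschitz in the
Stepanov norm. -/
theorem norm_apCoeff_sub_le {p : ℝ≥0∞} (hp : 1 ≤ p) {f : ℝ → ℂ} (hf : IsStepanovAP p f)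
    (hl : LocallyIntegrable f volume) (s : Finset ℝ) (c : ℝ → ℂ) {ε : ℝ} (hε : 0 ≤ ε)
    (h : stepanovNorm p (fun t => f t - trigPoly s c t) ≤ ENNReal.ofReal ε) (μ : ℝ) :
    ‖apCoeff f μ - if μ ∈ s then c μ else 0‖ ≤ ε := by
  have hP := (continuous_trigPoly s c)
  have h1 := ((tendsto_apMean hp hf hl μ).sub (tendsto_apMean_trigPoly s c μ)).norm
  have h2 : Tendsto (fun L : ℝ => (1 + Real.pi / L) * ε) atTop (𝓝 ((1 + 0) * ε)) :=
    ((tendsto_const_nhds.div_atTop tendsto_id).const_add 1).mul_const ε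
  rw [add_zero, one_mul] at h2
  refine le_of_tendsto_of_tendsto h1 h2 ?_
  filter_upwards [eventually_gt_atTop 0] with L hL
  exact norm_apMean_sub_le hl hP.locallyIntegrable hε
    (lintegral_window_le hp (hf.aestronglyMeasurable.sub hP.aestronglyMeasurable) h) μ hL

/-! ### Uniformly almost periodic functions and the uniqueness theorem -/

/-- Almost periods of trigonometric polynomials are relatively dense. -/
theorem exists_almostPeriod_trigPoly (s : Finset ℝ) (c : ℝ → ℂ) {η : ℝ} (hη : 0 < η) :
    ∃ ℓ : ℝ, 0 ≤ ℓ ∧ ∀ t : ℝ, ∃ τ : ℝ, |τ - t| ≤ ℓ ∧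
      ∀ y : ℝ, ‖trigPoly s c (y + τ) - trigPoly s c y‖ ≤ η := by
  set C := ∑ μ ∈ s, ‖c μ‖ with hC
  have hC0 : 0 ≤ C := Finset.sum_nonneg fun _ _ => norm_nonneg _
  set η' := η / (C + 1) with hη'
  have hη'0 : 0 < η' := by positivity
  -- The orbit t ↦ (e^{iμt})_{μ ∈ s} is bounded in a finite-dimensional space, so finitely many of
  -- its points `O (g y)` form a net of it. If `O t` is close to `O (g y)`, then t - g y is an
  -- almost period, at bounded distance from t.
  let O : ℝ → (s → ℂ) := fun t μ => Complex.exp (Complex.I * (μ : ℝ) * t)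
  have hb : Bornology.IsBounded (Set.range O) := by
    rw [isBounded_iff_forall_norm_le]
    refine ⟨1, ?_⟩
    rintro _ ⟨t, rfl⟩
    refine (pi_norm_le_iff_of_nonneg zero_le_one).2 fun μ => ?_
    rw [norm_exp_I_mul_mul]
  obtain ⟨T, hT, hTfin, hcov⟩ := (hb.isCompact_closure.totallyBounded.subset
    subset_closure).exists_subset (Metric.dist_mem_uniformity hη'0)
  choose! g hg using fun y (hy : y ∈ T) => hT hy
  obtain ⟨ℓ, hℓ⟩ := (hTfin.image (fun y => |g y|)).bddAbove
  refine ⟨max ℓ 0, le_max_right _ _, fun t => ?_⟩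
  have := hcov (Set.mem_range_self t)
  simp only [Set.mem_iUnion, Set.mem_ofPred_eq, exists_prop] at this
  obtain ⟨y, hyT, hy⟩ := this
  refine ⟨t - g y, ?_, fun z => ?_⟩
  · rw [sub_sub_cancel_left, abs_neg]
    exact (hℓ (Set.mem_image_of_mem _ hyT)).trans (le_max_left _ _)
  rw [trigPoly, trigPoly, ← Finset.sum_sub_distrib]
  refine (norm_sum_le _ _).trans ?_
  calc ∑ μ ∈ s, ‖c μ * Complex.exp (Complex.I * μ * ((z + (t - g y) : ℝ) : ℂ)) -
        c μ * Complex.exp (Complex.I * μ * z)‖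
      ≤ ∑ μ ∈ s, ‖c μ‖ * η' := by
        refine Finset.sum_le_sum fun μ hμ => ?_
        rw [← mul_sub, norm_mul]
        gcongr
        have h1 : Complex.exp (Complex.I * μ * ((z + (t - g y) : ℝ) : ℂ)) -
            Complex.exp (Complex.I * μ * z) =
            Complex.exp (Complex.I * μ * ((z - g y : ℝ) : ℂ)) *
              (Complex.exp (Complex.I * μ * t) - Complex.exp (Complex.I * μ * (g y))) := by
          rw [mul_sub, ← Complex.exp_add, ← Complex.exp_add]
          push_cast
          congr 2 <;> ring
        rw [h1, norm_mul, norm_exp_I_mul_mul, one_mul, ← dist_eq_norm]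
        rw [← hg y hyT] at hy
        exact (dist_le_pi_dist (O t) (O (g y)) ⟨μ, hμ⟩).trans hy.le
    _ = C * η' := by rw [← Finset.sum_mul]
    _ ≤ η := by
        rw [hη', mul_div_assoc', div_le_iff₀ (by positivity)]
        nlinarith

/-- Uniform limits of trigonometric polynomials. -/
def IsUniformAP (G : ℝ → ℂ) : Prop :=
  ∀ ε : ℝ, 0 < ε → ∃ (s : Finset ℝ) (c : ℝ → ℂ), ∀ t, ‖G t - trigPoly s c t‖ ≤ ε

theorem IsUniformAP.continuous {G : ℝ → ℂ} (hG : IsUniformAP G) : Continuous G := by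
  refine continuous_of_uniform_approx_of_continuous fun u hu => ?_
  obtain ⟨ε, hε, hεu⟩ := Metric.mem_uniformity_dist.1 hu
  obtain ⟨s, c, h⟩ := hG (ε / 2) (by positivity)
  refine ⟨trigPoly s c, continuous_trigPoly s c, fun t => hεu ?_⟩
  rw [dist_eq_norm]
  linarith [h t]

theorem IsUniformAP.bounded {G : ℝ → ℂ} (hG : IsUniformAP G) : ∃ B : ℝ, ∀ t, ‖G t‖ ≤ B := by
  obtain ⟨s, c, h⟩ := hG 1 one_pos
  refine ⟨1 + ∑ μ ∈ s, ‖c μ‖, fun t => ?_⟩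
  calc ‖G t‖ = ‖(G t - trigPoly s c t) + trigPoly s c t‖ := by rw [sub_add_cancel]
    _ ≤ _ := norm_add_le_of_le (h t) (norm_trigPoly_le s c t)

/-- With P a uniform approximant, |G|² = G·conj P + G·conj(G - P). The mean of the first term is a
finite combination of the vanishing Fourier means; the second is at most sup|G| times sup|G - P|. -/
theorem IsUniformAP.tendsto_mean_sq {G : ℝ → ℂ} (hG : IsUniformAP G)
    (h0 : ∀ μ, Tendsto (apMean G μ) atTop (𝓝 0)) :
    Tendsto (fun L : ℝ => (1 / L) * ∫ t in (0 : ℝ)..L, ‖G t‖ ^ 2) atTop (𝓝 0) := by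
  obtain ⟨B, hB⟩ := hG.bounded
  have hB0 : 0 ≤ B := (norm_nonneg _).trans (hB 0)
  have hc := hG.continuous
  rw [Metric.tendsto_atTop']
  intro ε hε
  obtain ⟨s, c, h⟩ := hG (ε / (2 * (B + 1))) (by positivity)
  have hP := continuous_trigPoly s c
  have hlim : Tendsto (fun L => ∑ μ ∈ s, (starRingEnd ℂ) (c μ) * apMean G μ L) atTop (𝓝 0) := by
    have := tendsto_finsetSum s fun μ _ => (h0 μ).const_mul ((starRingEnd ℂ) (c μ))
    simpa using this
  obtain ⟨N, hN⟩ := (Metric.tendsto_atTop'.1 hlim) (ε / 2) (by positivity)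
  refine ⟨max N 0, fun L hL => ?_⟩
  have hL0 : 0 < L := (le_max_right _ _).trans_lt hL
  have hN' := hN L ((le_max_left _ _).trans_lt hL)
  rw [dist_zero_right] at hN' ⊢
  have e1 : ∑ μ ∈ s, (starRingEnd ℂ) (c μ) * apMean G μ L =
      ((1 / L : ℝ) : ℂ) * ∫ t in (0 : ℝ)..L, G t * (starRingEnd ℂ) (trigPoly s c t) := by
    have h2 : ∀ t : ℝ, G t * (starRingEnd ℂ) (trigPoly s c t) =
        ∑ μ ∈ s, (starRingEnd ℂ) (c μ) * (G t * Complex.exp (-(Complex.I * μ * t))) := by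
      intro t
      rw [trigPoly, map_sum, Finset.mul_sum]
      refine Finset.sum_congr rfl fun μ _ => ?_
      rw [map_mul, ← Complex.exp_conj]
      simp only [map_mul, Complex.conj_I, Complex.conj_ofReal, neg_mul]
      ring
    simp_rw [h2]
    rw [intervalIntegral.integral_finsetSum
      (fun ν _ => Continuous.intervalIntegrable (by fun_prop) _ _), Finset.mul_sum]
    refine Finset.sum_congr rfl fun ν _ => ?_
    rw [intervalIntegral.integral_const_mul, apMean]
    ring
  have e2 : (((1 / L) * ∫ t in (0 : ℝ)..L, ‖G t‖ ^ 2 : ℝ) : ℂ) =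
      ((1 / L : ℝ) : ℂ) * (∫ t in (0 : ℝ)..L, G t * (starRingEnd ℂ) (trigPoly s c t)) +
      ((1 / L : ℝ) : ℂ) * (∫ t in (0 : ℝ)..L, G t * (starRingEnd ℂ) (G t - trigPoly s c t)) := by
    rw [← mul_add, ← intervalIntegral.integral_add
      (Continuous.intervalIntegrable (by fun_prop) _ _)
      (Continuous.intervalIntegrable (by fun_prop) _ _)]
    rw [Complex.ofReal_mul, ← intervalIntegral.integral_ofReal]
    congr 2
    ext t
    rw [← mul_add, ← map_add, add_sub_cancel, Complex.mul_conj, Complex.normSq_eq_norm_sq]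
  have e3 : ‖((1 / L : ℝ) : ℂ) *
      (∫ t in (0 : ℝ)..L, G t * (starRingEnd ℂ) (G t - trigPoly s c t))‖ ≤ ε / 2 := by
    have : ‖∫ t in (0 : ℝ)..L, G t * (starRingEnd ℂ) (G t - trigPoly s c t)‖ ≤
        B * (ε / (2 * (B + 1))) * |L - 0| := by
      refine intervalIntegral.norm_integral_le_of_norm_le_const fun t _ => ?_
      rw [norm_mul, RCLike.norm_conj]
      exact mul_le_mul (hB t) (h t) (norm_nonneg _) hB0
    rw [sub_zero, abs_of_pos hL0] at this
    rw [norm_mul, Complex.norm_real, Real.norm_of_nonneg (by positivity)]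
    calc _ ≤ 1 / L * (B * (ε / (2 * (B + 1))) * L) := by gcongr
      _ = (B / (B + 1)) * (ε / 2) := by field_simp
      _ ≤ 1 * (ε / 2) := by
        gcongr
        rw [div_le_one (by positivity)]; linarith
      _ = ε / 2 := one_mul _
  rw [← Complex.norm_real, e2, ← e1]
  exact (norm_add_le _ _).trans_lt (by linarith)

/-- Uniqueness: an almost periodic function all of whose Fourier coefficients vanish is zero. -/
theorem IsUniformAP.eq_zero {G : ℝ → ℂ} (hG : IsUniformAP G)
    (h0 : ∀ μ, Tendsto (apMean G μ) atTop (𝓝 0)) (x : ℝ) : G x = 0 := by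
  by_contra hx
  have ha : 0 < ‖G x‖ := norm_pos_iff.2 hx
  set a := ‖G x‖ with ha'
  have hc := hG.continuous
  obtain ⟨s, c, hP⟩ := hG (a / 8) (by positivity)
  obtain ⟨ℓ, hℓ0, hℓ⟩ := exists_almostPeriod_trigPoly s c (by positivity : 0 < a / 8)
  obtain ⟨d, hd, hdx⟩ := Metric.continuous_iff.1 hc x (a / 8) (by positivity)
  -- An almost period of P carries the neighbourhood of x where |G| is large close to any prescribed
  -- t. Four errors of a/8 (continuity at x, the almost period, and two approximations by P) leave
  -- |G| ≥ a/2.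
  have hper : ∀ t : ℝ, ∃ v : ℝ, |v - t| ≤ ℓ + |x| ∧
      ∀ y ∈ Set.Ioo (v - d) (v + d), a / 2 ≤ ‖G y‖ := by
    intro t
    obtain ⟨τ, hτ, hτP⟩ := hℓ t
    refine ⟨x + τ, ?_, fun y hy => ?_⟩
    · calc |x + τ - t| = |(τ - t) + x| := by ring_nf
        _ ≤ _ := (abs_add_le _ _).trans (by linarith)
    · have h1 := hdx (y - τ) (by
        rw [Real.dist_eq, abs_lt]; constructor <;> linarith [hy.1, hy.2])
      have h2 := hτP (y - τ)
      rw [sub_add_cancel] at h2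
      have h3 := hP y
      have h4 := hP (y - τ)
      rw [dist_eq_norm] at h1
      have e : G x = G y - (G y - trigPoly s c y)
          - (trigPoly s c y - trigPoly s c (y - τ))
          + (G (y - τ) - trigPoly s c (y - τ)) - (G (y - τ) - G x) := by ring
      have h5 : a ≤ ‖G y‖ + a / 8 + a / 8 + a / 8 + a / 8 := by
        rw [ha', e]
        exact norm_sub_le_of_le (norm_add_le_of_le (norm_sub_le_of_le
          (norm_sub_le_of_le le_rfl (by rw [← e]; exact h3)) (by rw [← e]; exact h2))
          (by rw [← e]; exact h4)) (by rw [← e]; exact h1.le)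
      linarith
  set R := ℓ + |x| + d with hR
  have hR0 : 0 < R := by positivity
  have hii : ∀ u v : ℝ, IntervalIntegrable (fun t => ‖G t‖ ^ 2) volume u v := fun u v =>
    Continuous.intervalIntegrable (by fun_prop) _ _
  have hwin : ∀ t : ℝ, 2 * d * (a / 2) ^ 2 ≤ ∫ y in (t - R)..(t + R), ‖G y‖ ^ 2 := by
    intro t
    obtain ⟨v, hv, hvG⟩ := hper t
    obtain ⟨hv1, hv2⟩ := abs_le.1 hv
    calc 2 * d * (a / 2) ^ 2 = ∫ y in (v - d)..(v + d), (a / 2) ^ 2 := by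
          rw [intervalIntegral.integral_const, smul_eq_mul]; ring
      _ ≤ ∫ y in (v - d)..(v + d), ‖G y‖ ^ 2 := by
          refine intervalIntegral.integral_mono_on_of_le_Ioo (by linarith) (by simp) (hii _ _) ?_
          intro y hy
          gcongr
          exact hvG y hy
      _ ≤ _ := by
          refine intervalIntegral.integral_mono_interval (by linarith) (by linarith) (by linarith)
            (ae_of_all _ fun y => by positivity) (hii _ _)
  have hN : ∀ N : ℕ, N * (2 * d * (a / 2) ^ 2) ≤ ∫ y in (0 : ℝ)..(N * (2 * R)), ‖G y‖ ^ 2 := by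
    intro N
    induction N with
    | zero => simp
    | succ N ih =>
      rw [← intervalIntegral.integral_add_adjacent_intervals (hii 0 (N * (2 * R))) (hii _ _)]
      have := hwin (N * (2 * R) + R)
      rw [add_sub_cancel_right, show (N : ℝ) * (2 * R) + R + R = (N + 1 : ℕ) * (2 * R) by
        push_cast; ring] at this
      push_cast at *
      linarith
  have hlim := (hG.tendsto_mean_sq h0).comp
    (tendsto_natCast_atTop_atTop.atTop_mul_const (by positivity : 0 < 2 * R))
  -- Along L = 2RN the mean square stays above a fixed positive number, while it tends to 0.
  have hge : 2 * d * (a / 2) ^ 2 / (2 * R) ≤ 0 := by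
    refine ge_of_tendsto hlim ?_
    filter_upwards [eventually_gt_atTop 0] with N hN0
    have hN0' : (0 : ℝ) < N := by exact_mod_cast hN0
    simp only [Function.comp]
    calc 2 * d * (a / 2) ^ 2 / (2 * R) = 1 / (N * (2 * R)) * (N * (2 * d * (a / 2) ^ 2)) := by
          field_simp
      _ ≤ _ := by gcongr; exact hN N
  have : 0 < 2 * d * (a / 2) ^ 2 / (2 * R) := by positivity
  linarith

/-! ### Convolution with the trapezoidal kernel -/

theorem summable_int_inv_one_add_sq : Summable fun j : ℤ => (1 + (j : ℝ) ^ 2)⁻¹ := by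
  have h1 : Summable fun j : ℤ => 1 / (j : ℝ) ^ 2 + if j = 0 then (1 : ℝ) else 0 :=
    (Real.summable_one_div_int_pow.2 one_lt_two).add (hasSum_ite_eq 0 (1 : ℝ)).summable
  refine Summable.of_nonneg_of_le (fun j => by positivity) (fun j => ?_) h1
  rcases eq_or_ne j 0 with rfl | hj
  · simp
  · have : (0 : ℝ) < (j : ℝ) ^ 2 := by positivity
    simp only [hj, if_false, add_zero, one_div]
    gcongr
    linarith

theorem setLIntegral_comp_add_left (g : ℝ → ℝ≥0∞) (y a b : ℝ) :
    ∫⁻ t in Set.Ioc a b, g (y + t) = ∫⁻ t in Set.Ioc (y + a) (y + b), g t := by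
  have := (measurePreserving_add_left volume y).setLIntegral_comp_preimage_emb
    (measurableEmbedding_addLeft y) g (Set.Ioc (y + a) (y + b))
  rw [← this]
  simp

/-- Convolution with an integrable kernel of order `(1 + t²)⁻¹` is bounded by the averages over
windows. -/
theorem exists_lintegral_mul_inv_one_add_sq_le : ∃ D : ℝ, 0 ≤ D ∧ ∀ (g : ℝ → ℂ) (ε : ℝ), 0 ≤ ε →
    (∀ u : ℝ, ∫⁻ t in Set.Ioc u (u + Real.pi), ‖g t‖ₑ ≤ ENNReal.ofReal (Real.pi * ε)) →
    ∀ y : ℝ, ∫⁻ t : ℝ, ‖g (y + t)‖ₑ * ENNReal.ofReal ((1 + t ^ 2)⁻¹) ≤ ENNReal.ofReal (D * ε) := by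
  have hpi := Real.pi_pos
  refine ⟨∑' j : ℤ, 3 * Real.pi * (1 + (j : ℝ) ^ 2)⁻¹, tsum_nonneg fun j => by positivity, ?_⟩
  intro g ε hε h y
  have hcov := iUnion_Ioc_add_zsmul hpi 0
  rw [← setLIntegral_univ, ← hcov]
  refine (lintegral_iUnion_le _ _).trans ?_
  rw [← tsum_mul_right, ENNReal.ofReal_tsum_of_nonneg (fun j => by positivity)
    ((summable_int_inv_one_add_sq.mul_left _).mul_right _)]
  refine ENNReal.tsum_le_tsum fun j => ?_
  simp only [zero_add, zsmul_eq_mul, Int.cast_add, Int.cast_one]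
  calc ∫⁻ t in Set.Ioc (j * Real.pi) ((j + 1) * Real.pi),
        ‖g (y + t)‖ₑ * ENNReal.ofReal ((1 + t ^ 2)⁻¹)
      ≤ ∫⁻ t in Set.Ioc (j * Real.pi) ((j + 1) * Real.pi),
        ‖g (y + t)‖ₑ * ENNReal.ofReal (3 * (1 + (j : ℝ) ^ 2)⁻¹) := by
        refine setLIntegral_mono' measurableSet_Ioc fun t ht => ?_
        gcongr
        rw [← div_eq_mul_inv, inv_le_comm₀ (by positivity) (by positivity), inv_div,
          div_le_iff₀ (by norm_num)]
        -- On the window jπ < t ≤ (j+1)π one has |j| ≤ |t| + 1 because π > 1, and 1 + (|t|+1)² ≤ 3(1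
        -- + t²) explains the factor 3.
        have h1 : (j : ℝ) ^ 2 ≤ (|t| + 1) ^ 2 := by
          refine sq_le_sq' ?_ ?_
          · have h3 : (j + 1 : ℝ) * Real.pi ≥ -|t| := (neg_abs_le t).trans ht.2
            by_contra! hcon
            have : (j + 1 : ℝ) < -|t| := by linarith
            have h4 : (j + 1 : ℝ) * Real.pi ≤ (j + 1) * 1 := by
              refine mul_le_mul_of_nonpos_left (by linarith [Real.pi_gt_three]) ?_
              linarith [abs_nonneg t]
            linarith
          · have h3 : (j : ℝ) * Real.pi ≤ |t| := ht.1.le.trans (le_abs_self t)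
            by_contra! hcon
            have h4 : (j : ℝ) * 1 ≤ j * Real.pi := by
              refine mul_le_mul_of_nonneg_left (by linarith [Real.pi_gt_three]) ?_
              linarith [abs_nonneg t]
            linarith
        nlinarith [sq_abs t, sq_nonneg (|t| - 1)]
    _ = (∫⁻ t in Set.Ioc (y + j * Real.pi) (y + j * Real.pi + Real.pi), ‖g t‖ₑ) *
          ENNReal.ofReal (3 * (1 + (j : ℝ) ^ 2)⁻¹) := by
        rw [lintegral_mul_const' _ _ ENNReal.ofReal_ne_top,
          setLIntegral_comp_add_left (fun t => ‖g t‖ₑ)]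
        congr 4
        ring
    _ ≤ ENNReal.ofReal (Real.pi * ε) * ENNReal.ofReal (3 * (1 + (j : ℝ) ^ 2)⁻¹) := by
        gcongr; exact h _
    _ = _ := by
        rw [← ENNReal.ofReal_mul (by positivity)]
        congr 1
        ring

/-- Convolution with the trapezoidal kernel. -/
noncomputable def trapConv (c : ℝ) (k : ℕ) (f : ℝ → ℂ) (y : ℝ) : ℂ :=
  ∫ t : ℝ, f (y + t) * trapKernel c k t

theorem integrable_mul_trapKernel {c : ℝ} (hc : 0 < c) (k : ℕ) {g : ℝ → ℂ}
    (hg : AEStronglyMeasurable g volume) {B : ℝ} (hB : ∀ t, ‖g t‖ ≤ B) :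
    Integrable fun t : ℝ => g t * trapKernel c k t :=
  (integrable_trapKernel hc k).ofReal.bdd_mul (c := B) hg (ae_of_all _ hB)

theorem aestronglyMeasurable_comp_add_left {f : ℝ → ℂ} (hf : AEStronglyMeasurable f volume)
    (y : ℝ) : AEStronglyMeasurable (fun t => f (y + t)) volume :=
  hf.comp_measurePreserving (measurePreserving_add_left volume y)

/-- The kernel is O((1+t²)⁻¹), so closeness in window averages becomes uniform closeness of the
convolutions. The constant `D` depends on `k`; this is harmless, since it serves only to prove exact
identities. -/
theorem exists_norm_trapConv_sub_le {c : ℝ} (hc : 0 < c) (k : ℕ) : ∃ D : ℝ, 0 ≤ D ∧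
    ∀ (f g : ℝ → ℂ) (ε : ℝ), 0 ≤ ε → AEStronglyMeasurable f volume →
    AEStronglyMeasurable g volume → (∃ B, ∀ t, ‖f t‖ ≤ B) → (∃ B, ∀ t, ‖g t‖ ≤ B) →
    (∀ u : ℝ, ∫⁻ t in Set.Ioc u (u + Real.pi), ‖f t - g t‖ₑ ≤ ENNReal.ofReal (Real.pi * ε)) →
    ∀ y : ℝ, ‖trapConv c k f y - trapConv c k g y‖ ≤ D * ε := by
  obtain ⟨D, hD0, hD⟩ := exists_lintegral_mul_inv_one_add_sq_le
  have hpi := Real.pi_pos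
  set M := c * (k + 1) / Real.pi + 2 / (Real.pi * c) with hM
  have hM0 : 0 ≤ M := by positivity
  refine ⟨M * D, by positivity, ?_⟩
  rintro f g ε hε hf hg ⟨B, hB⟩ ⟨B', hB'⟩ h y
  have hi1 := integrable_mul_trapKernel hc k (aestronglyMeasurable_comp_add_left hf y)
    (fun t => hB (y + t))
  have hi2 := integrable_mul_trapKernel hc k (aestronglyMeasurable_comp_add_left hg y)
    (fun t => hB' (y + t))
  rw [trapConv, trapConv, ← integral_sub hi1 hi2, ← ENNReal.ofReal_le_ofReal_iff (by positivity),
    ofReal_norm]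
  refine (enorm_integral_le_lintegral_enorm _).trans ?_
  calc ∫⁻ t : ℝ, ‖f (y + t) * (trapKernel c k t : ℂ) - g (y + t) * trapKernel c k t‖ₑ
      ≤ ∫⁻ t : ℝ, ENNReal.ofReal M *
          (‖f (y + t) - g (y + t)‖ₑ * ENNReal.ofReal ((1 + t ^ 2)⁻¹)) := by
        refine lintegral_mono fun t => ?_
        rw [← sub_mul, enorm_mul, mul_left_comm]
        gcongr
        rw [← ENNReal.ofReal_mul hM0, ← ofReal_norm, Complex.norm_real]
        exact ENNReal.ofReal_le_ofReal (abs_trapKernel_le_inv_one_add_sq hc k t)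
    _ = ENNReal.ofReal M *
          ∫⁻ t : ℝ, ‖f (y + t) - g (y + t)‖ₑ * ENNReal.ofReal ((1 + t ^ 2)⁻¹) :=
        lintegral_const_mul' _ _ ENNReal.ofReal_ne_top
    _ ≤ ENNReal.ofReal M * ENNReal.ofReal (D * ε) := by
        gcongr
        exact hD (fun t => f t - g t) ε hε h y
    _ = _ := by rw [← ENNReal.ofReal_mul hM0, mul_assoc]

/-- The Fourier transform of the trapezoidal kernel as a multiplier. -/
noncomputable def trapMult (c : ℝ) (k : ℕ) (μ : ℝ) : ℂ :=
  ∫ t : ℝ, (trapKernel c k t : ℂ) * Complex.exp (Complex.I * μ * t)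

theorem trapConv_trigPoly {c : ℝ} (hc : 0 < c) (k : ℕ) (s : Finset ℝ) (a : ℝ → ℂ) (y : ℝ) :
    trapConv c k (trigPoly s a) y = trigPoly s (fun μ => trapMult c k μ * a μ) y := by
  have h : ∀ t : ℝ, trigPoly s a (y + t) * (trapKernel c k t : ℂ) =
      ∑ μ ∈ s, a μ * Complex.exp (Complex.I * μ * y) *
        ((trapKernel c k t : ℂ) * Complex.exp (Complex.I * μ * t)) := by
    intro t
    rw [trigPoly, Finset.sum_mul]
    refine Finset.sum_congr rfl fun μ _ => ?_
    rw [Complex.ofReal_add, mul_add, Complex.exp_add]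
    ring
  simp_rw [trapConv, h]
  rw [integral_finsetSum _ fun μ _ => (integrable_trapKernel_mul_exp hc k μ).const_mul _, trigPoly]
  refine Finset.sum_congr rfl fun μ _ => ?_
  rw [integral_const_mul, trapMult]
  ring

theorem trigPoly_sub (s s' : Finset ℝ) (a a' : ℝ → ℂ) (t : ℝ) :
    trigPoly s a t - trigPoly s' a' t = trigPoly (s ∪ s')
      (fun μ => (if μ ∈ s then a μ else 0) - if μ ∈ s' then a' μ else 0) t := by
  simp_rw [trigPoly, sub_mul, Finset.sum_sub_distrib, ite_mul, zero_mul]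
  rw [Finset.sum_ite_mem, Finset.sum_ite_mem, Finset.union_inter_cancel_left,
    Finset.union_inter_cancel_right]

theorem IsUniformAP.sub_trigPoly {G : ℝ → ℂ} (hG : IsUniformAP G) (s : Finset ℝ) (a : ℝ → ℂ) :
    IsUniformAP fun t => G t - trigPoly s a t := by
  intro ε hε
  obtain ⟨s', a', h⟩ := hG ε hε
  refine ⟨s' ∪ s, fun μ => (if μ ∈ s' then a' μ else 0) - if μ ∈ s then a μ else 0, fun t => ?_⟩
  rw [← trigPoly_sub s' s a' a, sub_sub_sub_cancel_right]
  exact h t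

/-- The kernel maps trigonometric polynomials to trigonometric polynomials and turns Stepanov
approximation into uniform approximation, so the uniqueness theorem becomes available. -/
theorem isUniformAP_trapConv {c : ℝ} (hc : 0 < c) (k : ℕ) {p : ℝ≥0∞} (hp : 1 ≤ p) {f : ℝ → ℂ}
    (hf : IsStepanovAP p f) (hb : ∃ B, ∀ t, ‖f t‖ ≤ B) : IsUniformAP (trapConv c k f) := by
  obtain ⟨D, hD0, hD⟩ := exists_norm_trapConv_sub_le hc k
  intro ε hε
  obtain ⟨s, a, hsa⟩ := hf.approx (ε / (D + 1)) (by positivity)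
  have hP := continuous_trigPoly s a
  refine ⟨s, fun μ => trapMult c k μ * a μ, fun y => ?_⟩
  rw [← trapConv_trigPoly hc]
  refine (hD f (trigPoly s a) _ (by positivity) hf.aestronglyMeasurable hP.aestronglyMeasurable
    hb ⟨_, norm_trigPoly_le s a⟩ (lintegral_window_le hp
      (hf.aestronglyMeasurable.sub hP.aestronglyMeasurable) hsa) y).trans ?_
  rw [mul_div_assoc', div_le_iff₀ (by positivity)]
  nlinarith

theorem norm_trapMult_le {c : ℝ} (k : ℕ) (μ : ℝ) :
    ‖trapMult c k μ‖ ≤ ∫ t : ℝ, |trapKernel c k t| := by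
  refine (norm_integral_le_integral_norm _).trans (le_of_eq ?_)
  refine integral_congr_ae (ae_of_all _ fun t => ?_)
  simp only
  rw [norm_mul, norm_exp_I_mul_mul, mul_one, Complex.norm_real, Real.norm_eq_abs]

/-- Convolution multiplies the Fourier coefficients by the multiplier. -/
theorem tendsto_apMean_trapConv {c : ℝ} (hc : 0 < c) (k : ℕ) {p : ℝ≥0∞} (hp : 1 ≤ p) {f : ℝ → ℂ}
    (hf : IsStepanovAP p f) (hb : ∃ B, ∀ t, ‖f t‖ ≤ B) (μ : ℝ) :
    Tendsto (apMean (trapConv c k f) μ) atTop (𝓝 (trapMult c k μ * apCoeff f μ)) := by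
  obtain ⟨D, hD0, hD⟩ := exists_norm_trapConv_sub_le hc k
  have hpi := Real.pi_pos
  have hF := (isUniformAP_trapConv hc k hp hf hb).continuous
  obtain ⟨B, hB⟩ := hb
  have hl := locallyIntegrable_of_bounded hf.aestronglyMeasurable hB
  set M := ∫ t : ℝ, |trapKernel c k t| with hM
  have hM0 : 0 ≤ M := integral_nonneg fun t => abs_nonneg _
  rw [Metric.tendsto_atTop']
  intro ε hε
  -- The errors are 2Dε' from convolving f - P (for L > π), ε' from the mean of the polynomial, Mε'
  -- from the coefficient of f - P times the multiplier, and one spare ε'.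
  set ε' := ε / (2 * D + M + 2) with hε'
  have hε'0 : 0 < ε' := by positivity
  obtain ⟨s, a, hsa⟩ := hf.approx ε' hε'0
  have hP := continuous_trigPoly s a
  set a' : ℝ → ℂ := fun μ => trapMult c k μ * a μ with ha'
  have hP' := continuous_trigPoly s a'
  obtain ⟨N, hN⟩ := Metric.tendsto_atTop'.1 (tendsto_apMean_trigPoly s a' μ) ε' hε'0
  refine ⟨max N Real.pi, fun L hL => ?_⟩
  have hLpi : Real.pi < L := (le_max_right _ _).trans_lt hL
  have hL0 : 0 < L := hpi.trans hLpi
  have h1 := hN L ((le_max_left _ _).trans_lt hL)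
  have h2 : ‖apMean (trapConv c k f) μ L - apMean (trigPoly s a') μ L‖ ≤
      (1 + Real.pi / L) * (D * ε') := by
    refine norm_apMean_sub_le hF.locallyIntegrable hP'.locallyIntegrable (by positivity) ?_ μ hL0
    intro u
    calc ∫⁻ t in Set.Ioc u (u + Real.pi), ‖trapConv c k f t - trigPoly s a' t‖ₑ
        ≤ ∫⁻ t in Set.Ioc u (u + Real.pi), ENNReal.ofReal (D * ε') := by
          refine lintegral_mono fun t => ?_
          rw [← ofReal_norm, ha', ← trapConv_trigPoly hc]
          refine ENNReal.ofReal_le_ofReal ?_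
          exact hD f (trigPoly s a) _ hε'0.le hf.aestronglyMeasurable hP.aestronglyMeasurable
            ⟨B, hB⟩ ⟨_, norm_trigPoly_le s a⟩ (lintegral_window_le hp
            (hf.aestronglyMeasurable.sub hP.aestronglyMeasurable) hsa) t
      _ = _ := by
          rw [setLIntegral_const, Real.volume_Ioc, add_sub_cancel_left,
            ← ENNReal.ofReal_mul (by positivity), mul_comm]
  have h3 : (1 + Real.pi / L) * (D * ε') ≤ 2 * (D * ε') := by
    gcongr
    have : Real.pi / L ≤ 1 := by rw [div_le_one hL0]; exact hLpi.le
    linarith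
  have h4 : ‖(if μ ∈ s then a' μ else 0) - trapMult c k μ * apCoeff f μ‖ ≤ M * ε' := by
    have e : (if μ ∈ s then a' μ else 0) - trapMult c k μ * apCoeff f μ =
        -(trapMult c k μ * (apCoeff f μ - if μ ∈ s then a μ else 0)) := by
      split_ifs <;> simp [ha', mul_sub]
    rw [e, norm_neg, norm_mul]
    exact mul_le_mul (norm_trapMult_le k μ) (norm_apCoeff_sub_le hp hf hl s a hε'0.le hsa μ)
      (norm_nonneg _) hM0
  rw [← dist_eq_norm] at h2 h4
  calc dist (apMean (trapConv c k f) μ L) (trapMult c k μ * apCoeff f μ)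
      ≤ _ := dist_triangle4 _ (apMean (trigPoly s a') μ L) (if μ ∈ s then a' μ else 0) _
    _ < 2 * (D * ε') + ε' + M * ε' + ε' := by linarith
    _ = ε := by rw [hε']; field_simp; ring

/-! ### Partial sums as convolutions -/

/-- A `finsum` over an infinite support would be 0 by convention; the finite set `s` containing all
nonvanishing frequencies gives the sum its intended value. `s` may contain further frequencies with
coefficient 0. -/
theorem apPartialSum_eq_trigPoly {f : ℝ → ℂ} {γ : ℝ} {s : Finset ℝ} (hs : ∀ μ ∈ s, |μ| ≤ γ)
    (hs' : ∀ μ, |μ| ≤ γ → apCoeff f μ ≠ 0 → μ ∈ s) (x : ℝ) :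
    apPartialSum f γ x = trigPoly s (apCoeff f) x := by
  rw [apPartialSum, trigPoly]
  refine finsum_mem_eq_sum_of_inter_support_eq _ ?_
  ext μ
  simp only [Set.mem_inter_iff, Function.mem_support, Finset.mem_coe]
  refine and_congr_left fun h => ⟨fun h1 => hs' μ h1 (left_ne_zero_of_mul h), fun h1 => hs μ h1⟩

/-- If no Fourier exponents lie in the gap of the trapezoid, the partial sum is the convolution
with the trapezoidal kernel. -/
theorem apPartialSum_eq_trapConv {c : ℝ} (hc : 0 < c) (k : ℕ) {p : ℝ≥0∞} (hp : 1 ≤ p) {f : ℝ → ℂ}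
    (hf : IsStepanovAP p f) (hb : ∃ B, ∀ t, ‖f t‖ ≤ B)
    (hfin : {μ : ℝ | |μ| ≤ k * c ∧ apCoeff f μ ≠ 0}.Finite)
    (hgap : ∀ μ : ℝ, k * c < |μ| → |μ| < (k + 1) * c → apCoeff f μ = 0) (x : ℝ) :
    apPartialSum f (k * c) x = trapConv c k f x := by
  set s := hfin.toFinset with hs
  have hmem : ∀ μ, μ ∈ s ↔ |μ| ≤ k * c ∧ apCoeff f μ ≠ 0 := fun μ => by simp [hs]
  rw [apPartialSum_eq_trigPoly (s := s) (fun μ h => ((hmem μ).1 h).1)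
    (fun μ h1 h2 => (hmem μ).2 ⟨h1, h2⟩)]
  have hF := isUniformAP_trapConv hc k hp hf hb
  have hP := continuous_trigPoly s (apCoeff f)
  have h := (hF.sub_trigPoly s (apCoeff f)).eq_zero (fun μ => ?_) x
  · exact (sub_eq_zero.1 h).symm
  have h1 := (tendsto_apMean_trapConv hc k hp hf hb μ).sub
    (tendsto_apMean_trigPoly s (apCoeff f) μ)
  -- All coefficients of convolution minus partial sum vanish: the multiplier is 1 up to kc and 0
  -- from (k+1)c on, and in between the coefficient of `f` is zero.
  have h2 : trapMult c k μ * apCoeff f μ - (if μ ∈ s then apCoeff f μ else 0) = 0 := by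
    rcases le_or_gt |μ| (k * c) with h | h
    · rw [trapMult, integral_trapKernel_mul_exp_of_le hc k h, one_mul]
      split_ifs with h3
      · exact sub_self _
      · rw [hmem] at h3
        have : apCoeff f μ = 0 := by
          by_contra h4
          exact h3 ⟨h, h4⟩
        rw [this, sub_zero]
    · rw [if_neg (fun h3 => absurd ((hmem μ).1 h3).1 (not_le.2 h)), sub_zero]
      rcases lt_or_ge |μ| ((k + 1) * c) with h3 | h3
      · rw [hgap μ h h3, mul_zero]
      · rw [trapMult, integral_trapKernel_mul_exp_of_ge hc k h3, zero_mul]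
  rw [h2] at h1
  refine h1.congr fun L => ?_
  rw [apMean, apMean, apMean, ← mul_sub, ← intervalIntegral.integral_sub
    (intervalIntegrable_mul_exp_neg hF.continuous.locallyIntegrable μ 0 L)
    (intervalIntegrable_mul_exp_neg hP.locallyIntegrable μ 0 L)]
  simp_rw [sub_mul]

theorem abs_mem_posExponents {f : ℝ → ℂ} {μ : ℝ} (h0 : μ ≠ 0) (h : apCoeff f μ ≠ 0) :
    |μ| ∈ posExponents f := by
  refine ⟨abs_pos.2 h0, ?_⟩
  rcases abs_choice μ with h1 | h1 <;> rw [h1]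
  · exact Or.inl h
  · rw [neg_neg]; exact Or.inr h

/-- The gap condition makes μ ↦ ⌊μ/α⌋ injective on the positive exponents, and on those up to γ it
takes finitely many values. -/
theorem MemOmega.finite_exponents {α : ℝ} (hα : 0 < α) {p : ℝ≥0∞} {f : ℝ → ℂ}
    (hf : MemOmega α p f) (γ : ℝ) : {μ : ℝ | |μ| ≤ γ ∧ apCoeff f μ ≠ 0}.Finite := by
  have h1 : (posExponents f ∩ Set.Iic γ).Finite := by
    refine Set.Finite.of_finite_image (f := fun μ : ℝ => ⌊μ / α⌋)
      ((Set.finite_Icc (0 : ℤ) ⌊γ / α⌋).subset ?_) ?_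
    · rintro _ ⟨μ, ⟨hμ, hμγ⟩, rfl⟩
      refine ⟨Int.floor_nonneg.2 (div_nonneg hμ.1.le hα.le), Int.floor_le_floor ?_⟩
      exact div_le_div_of_nonneg_right hμγ hα.le
    · have key : ∀ μ ∈ posExponents f, ∀ ν ∈ posExponents f, μ < ν → ⌊μ / α⌋ ≠ ⌊ν / α⌋ := by
        intro μ hμ ν hν hlt heq
        have h2 := hf.gap μ hμ ν hν hlt
        have h3 : μ / α + 1 ≤ ν / α := by
          rw [div_add_one hα.ne']
          exact div_le_div_of_nonneg_right (by linarith) hα.le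
        have h4 := Int.floor_le_floor h3
        rw [Int.floor_add_one] at h4
        omega
      intro μ hμ ν hν heq
      rcases lt_trichotomy μ ν with h | h | h
      · exact absurd heq (key μ hμ.1 ν hν.1 h)
      · exact h
      · exact absurd heq.symm (key ν hν.1 μ hμ.1 h)
  refine ((h1.union (h1.image fun μ => -μ)).union (Set.finite_singleton 0)).subset ?_
  rintro μ ⟨hμ, hμ0⟩
  rcases eq_or_ne μ 0 with rfl | h0
  · exact Or.inr rfl
  · left
    have h2 := abs_mem_posExponents h0 hμ0
    rcases abs_choice μ with h3 | h3
    · left; rw [← h3]; exact ⟨h2, hμ⟩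
    · right; exact ⟨|μ|, ⟨h2, hμ⟩, by simp only [h3, neg_neg]⟩

/-! ### Integrals against the kernel on dyadic intervals -/

/-- Bessel's inequality on a period. -/
theorem sum_sq_norm_integral_exp_le {c : ℝ} (hc : 0 < c) {g : ℝ → ℂ} (hg : Measurable g) {B : ℝ}
    (hB : ∀ t, ‖g t‖ ≤ B) (s : Finset ℤ) :
    ∑ k ∈ s, ‖∫ t in Set.Ioc 0 (2 * Real.pi / c), g t * Complex.exp (Complex.I * (k * c : ℝ) * t)‖ ^ 2
      ≤ 2 * Real.pi / c * ∫ t in Set.Ioc 0 (2 * Real.pi / c), ‖g t‖ ^ 2 := by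
  have hpi := Real.pi_pos
  have hP : 0 < 2 * Real.pi / c := by positivity
  set P := 2 * Real.pi / c with hPdef
  have hL2 : MemLp g 2 (volume.restrict (Set.Ioc 0 P)) :=
    MemLp.of_bound hg.aestronglyMeasurable B (ae_of_all _ hB)
  have h1 := hasSum_sq_fourierCoeffOn hP hL2
  have h2 : ∀ k : ℤ, ∫ t in Set.Ioc 0 P, g t * Complex.exp (Complex.I * (k * c : ℝ) * t) =
      P * fourierCoeffOn hP g (-k) := by
    intro k
    rw [fourierCoeffOn_eq_integral, intervalIntegral.integral_of_le hP.le, sub_zero,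
      Complex.real_smul, ← mul_assoc, ← Complex.ofReal_mul, mul_one_div_cancel hP.ne',
      Complex.ofReal_one, one_mul]
    refine integral_congr_ae (ae_of_all _ fun t => ?_)
    simp only [neg_neg, smul_eq_mul]
    rw [mul_comm, fourier_coe_apply]
    congr 2
    rw [hPdef]
    have : (c : ℂ) ≠ 0 := by exact_mod_cast hc.ne'
    have : (Real.pi : ℂ) ≠ 0 := by exact_mod_cast hpi.ne'
    push_cast
    field_simp
  have h3 : ∑ k ∈ s, ‖fourierCoeffOn hP g (-k)‖ ^ 2 ≤ (P - 0)⁻¹ • ∫ x in (0 : ℝ)..P, ‖g x‖ ^ 2 :=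
    sum_le_hasSum _ (fun _ _ => by positivity) ((Equiv.neg ℤ).hasSum_iff.2 h1)
  rw [intervalIntegral.integral_of_le hP.le, sub_zero, smul_eq_mul] at h3
  calc _ = P ^ 2 * ∑ k ∈ s, ‖fourierCoeffOn hP g (-k)‖ ^ 2 := by
        rw [Finset.mul_sum]
        refine Finset.sum_congr rfl fun k _ => ?_
        rw [h2, norm_mul, mul_pow, Complex.norm_real, Real.norm_of_nonneg hP.le]
    _ ≤ P ^ 2 * (P⁻¹ * ∫ t in Set.Ioc 0 P, ‖g t‖ ^ 2) := by gcongr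
    _ = _ := by field_simp

/-- Bounded measurable functions whose `p`-th power has averages at most `1` over the
intervals `(0, δ]`. -/
structure HasUnitAverages (p : ℝ) (h : ℝ → ℂ) : Prop where
  measurable : Measurable h
  bounded : ∃ B : ℝ, ∀ t, ‖h t‖ ≤ B
  average : ∀ δ : ℝ, 0 < δ → ∫ t in Set.Ioc 0 δ, ‖h t‖ ^ p ≤ δ

namespace HasUnitAverages

variable {p : ℝ} {h : ℝ → ℂ}

theorem integrableOn_norm (H : HasUnitAverages p h) (a b : ℝ) :
    IntegrableOn (fun t => ‖h t‖) (Set.Ioc a b) := by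
  obtain ⟨B, hB⟩ := H.bounded
  exact Measure.integrableOn_of_bounded (M := B) (by simp) H.measurable.norm.aestronglyMeasurable
    (ae_of_all _ fun t => by simpa using hB t)

theorem integrableOn_rpow (H : HasUnitAverages p h) (hp : 0 ≤ p) (a b : ℝ) :
    IntegrableOn (fun t => ‖h t‖ ^ p) (Set.Ioc a b) := by
  obtain ⟨B, hB⟩ := H.bounded
  refine Measure.integrableOn_of_bounded (M := B ^ p) (by simp)
    (H.measurable.norm.pow_const p).aestronglyMeasurable (ae_of_all _ fun t => ?_)
  rw [Real.norm_of_nonneg (by positivity)]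
  exact Real.rpow_le_rpow (norm_nonneg _) (hB t) hp

/-- The pointwise bound |h| ≤ 1 + |h|^p replaces Hölder's inequality, at the price of the factor 2.
-/
theorem integral_norm_le (H : HasUnitAverages p h) (hp : 1 ≤ p) {δ : ℝ} (hδ : 0 < δ) :
    ∫ t in Set.Ioc 0 δ, ‖h t‖ ≤ 2 * δ := by
  calc ∫ t in Set.Ioc 0 δ, ‖h t‖ ≤ ∫ t in Set.Ioc 0 δ, (1 + ‖h t‖ ^ p) := by
        refine integral_mono (H.integrableOn_norm 0 δ)
          ((integrable_const (1 : ℝ)).add (H.integrableOn_rpow (by linarith) 0 δ)) fun t => ?_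
        simp only
        rcases le_total ‖h t‖ 1 with h1 | h1
        · have : 0 ≤ ‖h t‖ ^ p := by positivity
          linarith
        · have := Real.rpow_le_rpow_of_exponent_le h1 hp
          rw [Real.rpow_one] at this
          linarith
    _ = δ + ∫ t in Set.Ioc 0 δ, ‖h t‖ ^ p := by
        rw [integral_add (integrable_const (1 : ℝ)) (H.integrableOn_rpow (by linarith) 0 δ)]
        simp [hδ.le]
    _ ≤ 2 * δ := by linarith [H.average δ hδ]

theorem integral_norm_Ioc_le (H : HasUnitAverages p h) (hp : 1 ≤ p) {a b : ℝ} (ha : 0 ≤ a)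
    (hb : 0 < b) : ∫ t in Set.Ioc a b, ‖h t‖ ≤ 2 * b :=
  (setIntegral_mono_set (H.integrableOn_norm 0 b) (ae_of_all _ fun _ => norm_nonneg _)
    (Set.Ioc_subset_Ioc_left ha).eventuallyLE).trans (H.integral_norm_le hp hb)

theorem integral_rpow_Ioc_le (H : HasUnitAverages p h) (hp : 0 ≤ p) {a b : ℝ} (ha : 0 ≤ a)
    (hb : 0 < b) : ∫ t in Set.Ioc a b, ‖h t‖ ^ p ≤ b :=
  (setIntegral_mono_set (H.integrableOn_rpow hp 0 b)
    (ae_of_all _ fun _ => Real.rpow_nonneg (norm_nonneg _) _)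
    (Set.Ioc_subset_Ioc_left ha).eventuallyLE).trans (H.average b hb)

theorem integrable_mul_trapKernel (H : HasUnitAverages p h) {c : ℝ} (hc : 0 < c) (k : ℕ) :
    Integrable fun t : ℝ => h t * trapKernel c k t := by
  obtain ⟨B, hB⟩ := H.bounded
  exact _root_.integrable_mul_trapKernel hc k H.measurable.aestronglyMeasurable hB

theorem norm_integral_Ioc_zero_le (H : HasUnitAverages p h) (hp : 1 ≤ p) {c : ℝ} (hc : 0 < c)
    (k : ℕ) {δ : ℝ} (hδ : 0 < δ) :
    ‖∫ t in Set.Ioc 0 δ, h t * trapKernel c k t‖ ≤ c * (k + 1) / Real.pi * (2 * δ) := by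
  have hpi := Real.pi_pos
  calc _ ≤ ∫ t in Set.Ioc 0 δ, c * (k + 1) / Real.pi * ‖h t‖ := by
        refine norm_integral_le_of_norm_le ((H.integrableOn_norm 0 δ).const_mul _)
          (ae_of_all _ fun t => ?_)
        rw [norm_mul, mul_comm, Complex.norm_real]
        gcongr
        exact abs_trapKernel_le hc k t
    _ = c * (k + 1) / Real.pi * ∫ t in Set.Ioc 0 δ, ‖h t‖ := integral_const_mul _ _
    _ ≤ _ := by gcongr; exact H.integral_norm_le hp hδ

/-- On (a, 2a] the integral of |h|/t² is at most 4a/a² = 4/a; over a = 2^j P this is a geometric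
series with sum 8/P. -/
theorem lintegral_Ioi_div_sq_le (H : HasUnitAverages p h) (hp : 1 ≤ p) {P : ℝ} (hP : 0 < P) :
    ∫⁻ t in Set.Ioi P, ‖h t‖ₑ * ENNReal.ofReal (1 / t ^ 2) ≤ ENNReal.ofReal (8 / P) := by
  have hsub : Set.Ioi P ⊆ ⋃ j : ℕ, Set.Ioc (P * 2 ^ j) (2 * (P * 2 ^ j)) := by
    intro t ht
    have ht' : P < t := ht
    obtain ⟨n, hn1, hn2⟩ := exists_nat_pow_near (x := t / P) (y := 2)
      (by rw [le_div_iff₀ hP]; linarith) one_lt_two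
    -- The intervals are open on the left, so a point t = 2^n P belongs to the preceding one; n = 0
    -- is excluded by t > P.
    rcases eq_or_lt_of_le hn1 with h1 | h1
    · have hn : n ≠ 0 := by
        rintro rfl
        rw [pow_zero, eq_div_iff hP.ne'] at h1
        linarith
      obtain ⟨j, rfl⟩ := Nat.exists_eq_succ_of_ne_zero hn
      rw [eq_div_iff hP.ne', pow_succ] at h1
      refine Set.mem_iUnion.2 ⟨j, ?_, ?_⟩
      · have : 0 < P * 2 ^ j := by positivity
        linarith
      · linarith
    · refine Set.mem_iUnion.2 ⟨n, ?_, ?_⟩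
      · rw [lt_div_iff₀ hP] at h1; linarith
      · rw [div_lt_iff₀ hP, pow_succ] at hn2; linarith
  refine (lintegral_mono_set hsub).trans ((lintegral_iUnion_le _ _).trans ?_)
  have hgeo : HasSum (fun j : ℕ => 4 / P * (1 / 2 : ℝ) ^ j) (4 / P * 2) :=
    hasSum_geometric_two.mul_left _
  rw [show 8 / P = 4 / P * 2 by ring, ← hgeo.tsum_eq,
    ENNReal.ofReal_tsum_of_nonneg (fun j => by positivity) hgeo.summable]
  refine ENNReal.tsum_le_tsum fun j => ?_
  set a := P * 2 ^ j with ha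
  have ha0 : 0 < a := by positivity
  calc ∫⁻ t in Set.Ioc a (2 * a), ‖h t‖ₑ * ENNReal.ofReal (1 / t ^ 2)
      ≤ ∫⁻ t in Set.Ioc a (2 * a), ‖h t‖ₑ * ENNReal.ofReal (1 / a ^ 2) := by
        refine setLIntegral_mono' measurableSet_Ioc fun t ht => ?_
        have := ht.1.le
        gcongr
    _ = ENNReal.ofReal (∫ t in Set.Ioc a (2 * a), ‖h t‖) * ENNReal.ofReal (1 / a ^ 2) := by
        rw [lintegral_mul_const' _ _ ENNReal.ofReal_ne_top,
          ofReal_integral_eq_lintegral_ofReal (H.integrableOn_norm _ _)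
            (ae_of_all _ fun _ => norm_nonneg _)]
        simp_rw [ofReal_norm]
    _ ≤ ENNReal.ofReal (2 * (2 * a)) * ENNReal.ofReal (1 / a ^ 2) := by
        gcongr; exact H.integral_norm_Ioc_le hp ha0.le (by positivity)
    _ = _ := by
        rw [← ENNReal.ofReal_mul (by positivity)]
        congr 1
        rw [ha, div_pow, one_pow]
        field_simp
        norm_num

theorem norm_integral_Ioi_le (H : HasUnitAverages p h) (hp : 1 ≤ p) {c : ℝ} (hc : 0 < c)
    (k : ℕ) : ‖∫ t in Set.Ioi (2 * Real.pi / c), h t * trapKernel c k t‖ ≤ 1 := by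
  have hpi := Real.pi_pos
  have hP : 0 < 2 * Real.pi / c := by positivity
  rw [← ENNReal.ofReal_le_ofReal_iff zero_le_one, ofReal_norm]
  refine (enorm_integral_le_lintegral_enorm _).trans ?_
  calc ∫⁻ t in Set.Ioi (2 * Real.pi / c), ‖h t * (trapKernel c k t : ℂ)‖ₑ
      ≤ ∫⁻ t in Set.Ioi (2 * Real.pi / c),
          ENNReal.ofReal (2 / (Real.pi * c)) * (‖h t‖ₑ * ENNReal.ofReal (1 / t ^ 2)) := by
        refine lintegral_mono fun t => ?_
        rw [enorm_mul, mul_left_comm]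
        gcongr
        rw [← ENNReal.ofReal_mul (by positivity), ← ofReal_norm, Complex.norm_real]
        refine ENNReal.ofReal_le_ofReal ((abs_trapKernel_le_inv_sq hc k t).trans (le_of_eq ?_))
        rw [div_mul_div_comm, mul_one]
    _ = ENNReal.ofReal (2 / (Real.pi * c)) *
          ∫⁻ t in Set.Ioi (2 * Real.pi / c), ‖h t‖ₑ * ENNReal.ofReal (1 / t ^ 2) :=
        lintegral_const_mul' _ _ ENNReal.ofReal_ne_top
    _ ≤ ENNReal.ofReal (2 / (Real.pi * c)) * ENNReal.ofReal (8 / (2 * Real.pi / c)) := by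
        gcongr; exact H.lintegral_Ioi_div_sq_le hp hP
    _ ≤ _ := by
        rw [← ENNReal.ofReal_mul (by positivity)]
        -- The product of the two constants is 8/π² < 1.
        refine ENNReal.ofReal_le_ofReal ?_
        rw [div_div_eq_mul_div, div_mul_div_comm, div_le_one (by positivity)]
        nlinarith [Real.pi_gt_three, mul_pos hpi hc, mul_pos hc (mul_pos hpi hpi)]

end HasUnitAverages

/-- The amplitude of the trapezoidal kernel. -/
noncomputable def trapAmp (c t : ℝ) : ℂ :=
  (1 - Complex.exp (Complex.I * c * t)) / (Real.pi * c * t ^ 2)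

theorem measurable_trapAmp (c : ℝ) : Measurable (trapAmp c) := by
  unfold trapAmp; fun_prop

theorem norm_trapAmp_le {c : ℝ} (hc : 0 < c) (t : ℝ) : ‖trapAmp c t‖ ≤ 1 / (Real.pi * |t|) := by
  have hpi := Real.pi_pos
  rcases eq_or_ne t 0 with rfl | ht
  · simp [trapAmp]
  have ht' := abs_pos.2 ht
  have h1 : ‖(1 : ℂ) - Complex.exp (Complex.I * c * t)‖ ≤ c * |t| := by
    rw [norm_sub_rev, show Complex.I * c * t = Complex.I * ((c * t : ℝ) : ℂ) by push_cast; ring]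
    refine (Real.norm_exp_I_mul_ofReal_sub_one_le).trans (le_of_eq ?_)
    rw [Real.norm_eq_abs, abs_mul, abs_of_pos hc]
  have h2 : ‖(Real.pi * c * t ^ 2 : ℂ)‖ = Real.pi * c * |t| ^ 2 := by
    simp [abs_of_pos hpi, abs_of_pos hc]
  rw [trapAmp, norm_div, h2]
  calc _ ≤ c * |t| / (Real.pi * c * |t| ^ 2) := by gcongr
    _ = _ := by field_simp

/-- The kernel is the real part of amplitude times e^{ikct}, so `k` enters only through exponentials
of period 2π/c. Integrals over part of one period thus become sums of Fourier coefficients at the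
frequencies k and -k. -/
theorem trapKernel_eq_trapAmp (c : ℝ) (k : ℕ) (t : ℝ) :
    (trapKernel c k t : ℂ) = 1 / 2 *
      (trapAmp c t * Complex.exp (Complex.I * (((k : ℤ) : ℝ) * c : ℝ) * t) +
      (starRingEnd ℂ) (trapAmp c t) * Complex.exp (Complex.I * (((-k : ℤ) : ℝ) * c : ℝ) * t)) := by
  have e : ∀ x : ℝ, Complex.exp (-(x * Complex.I)) = (starRingEnd ℂ) (Complex.exp (x * Complex.I)) := by
    intro x
    rw [← Complex.exp_conj]; simp
  have e1 : trapAmp c t * Complex.exp (Complex.I * (((k : ℤ) : ℝ) * c : ℝ) * t) =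
      (Complex.exp ((k * c * t : ℝ) * Complex.I) - Complex.exp (((k + 1) * c * t : ℝ) * Complex.I)) /
        ((Real.pi * c * t ^ 2 : ℝ) : ℂ) := by
    rw [trapAmp, div_mul_eq_mul_div, sub_mul, one_mul, ← Complex.exp_add]
    push_cast
    congr 3 <;> ring_nf
  have e2 : Complex.exp (Complex.I * (((-k : ℤ) : ℝ) * c : ℝ) * t) =
      (starRingEnd ℂ) (Complex.exp (Complex.I * (((k : ℤ) : ℝ) * c : ℝ) * t)) := by
    rw [← Complex.exp_conj]
    simp only [map_mul, Complex.conj_I, Complex.conj_ofReal]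
    push_cast
    ring_nf
  rw [e2, ← map_mul, e1, Complex.add_conj, trapKernel, Complex.div_ofReal_re, Complex.sub_re,
    Complex.exp_ofReal_mul_I_re, Complex.exp_ofReal_mul_I_re]
  push_cast
  ring

/-- The Fourier side estimate on a dyadic interval for bounded functions. -/
theorem sum_sq_norm_integral_Ioc_trapKernel_le {c : ℝ} (hc : 0 < c) {g : ℝ → ℂ}
    (hg : Measurable g) {B : ℝ} (hB : ∀ t, ‖g t‖ ≤ B) {a : ℝ} (ha : 0 < a)
    (haP : 2 * a ≤ 2 * Real.pi / c) (N : ℕ) :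
    ∑ k ∈ Finset.range N, ‖∫ t in Set.Ioc a (2 * a), g t * trapKernel c k t‖ ^ 2
      ≤ 2 * Real.pi / c * ((1 / (Real.pi * a)) ^ 2 * ∫ t in Set.Ioc a (2 * a), ‖g t‖ ^ 2) := by
  have hpi := Real.pi_pos
  set P := 2 * Real.pi / c with hP
  have hP0 : 0 < P := by positivity
  set I := Set.Ioc a (2 * a) with hI
  have hIm : MeasurableSet I := measurableSet_Ioc
  have hIP : I ⊆ Set.Ioc 0 P := Set.Ioc_subset_Ioc ha.le haP
  -- Extended by zero from the dyadic interval to the period (0, P], g times the amplitude is a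
  -- single function, independent of `k`, to which Bessel's inequality applies; the amplitude is at
  -- most 1/(πa) there.
  set u : ℝ → ℂ := I.indicator fun t => g t * trapAmp c t with hu
  set v : ℝ → ℂ := I.indicator fun t => g t * (starRingEnd ℂ) (trapAmp c t) with hv
  have hB0 : 0 ≤ B := (norm_nonneg _).trans (hB 0)
  have hamp : ∀ t ∈ I, ‖trapAmp c t‖ ≤ 1 / (Real.pi * a) := by
    intro t ht
    refine (norm_trapAmp_le hc t).trans ?_
    rw [abs_of_pos (ha.trans ht.1)]
    have := ht.1.le
    gcongr
  have hum : Measurable u := (hg.mul (measurable_trapAmp c)).indicator hIm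
  have hvm : Measurable v :=
    (hg.mul (Complex.continuous_conj.measurable.comp (measurable_trapAmp c))).indicator hIm
  have hub : ∀ t, ‖u t‖ ≤ I.indicator (fun t => ‖g t‖ * (1 / (Real.pi * a))) t := by
    intro t
    by_cases ht : t ∈ I
    · rw [hu, Set.indicator_of_mem ht, Set.indicator_of_mem ht, norm_mul]
      gcongr
      exact hamp t ht
    · simp [hu, ht]
  have hvu : ∀ t, ‖v t‖ = ‖u t‖ := by
    intro t
    by_cases ht : t ∈ I <;> simp [hu, hv, ht]
  have huB : ∀ t, ‖u t‖ ≤ B * (1 / (Real.pi * a)) := by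
    intro t
    refine (hub t).trans ?_
    by_cases ht : t ∈ I
    · rw [Set.indicator_of_mem ht]; gcongr; exact hB t
    · rw [Set.indicator_of_notMem ht]; positivity
  have hInt : ∀ (w : ℝ → ℂ) (n : ℤ), Measurable w → (∀ t, ‖w t‖ ≤ B * (1 / (Real.pi * a))) →
      IntegrableOn (fun t => w t * Complex.exp (Complex.I * ((n : ℝ) * c : ℝ) * t)) (Set.Ioc 0 P) := by
    intro w n hw hwB
    refine Measure.integrableOn_of_bounded (M := B * (1 / (Real.pi * a))) (by simp)
      (hw.mul (by fun_prop)).aestronglyMeasurable (ae_of_all _ fun t => ?_)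
    rw [norm_mul, norm_exp_I_mul_mul, mul_one]
    exact hwB t
  have key : ∀ k : ℕ, ∫ t in I, g t * trapKernel c k t = 1 / 2 *
      ((∫ t in Set.Ioc 0 P, u t * Complex.exp (Complex.I * (((k : ℤ) : ℝ) * c : ℝ) * t)) +
      ∫ t in Set.Ioc 0 P, v t * Complex.exp (Complex.I * (((-k : ℤ) : ℝ) * c : ℝ) * t)) := by
    intro k
    rw [← integral_add (hInt u k hum huB) (hInt v (-k) hvm fun t => by rw [hvu]; exact huB t),
      ← integral_const_mul, ← Set.inter_eq_self_of_subset_right hIP, ← setIntegral_indicator hIm]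
    refine integral_congr_ae (ae_of_all _ fun t => ?_)
    by_cases ht : t ∈ I
    · simp only [hu, hv, Set.indicator_of_mem ht, trapKernel_eq_trapAmp]
      ring
    · simp [hu, hv, ht]
  have hu2 : ∫ t in Set.Ioc 0 P, ‖u t‖ ^ 2 ≤ (1 / (Real.pi * a)) ^ 2 * ∫ t in I, ‖g t‖ ^ 2 := by
    rw [← integral_const_mul]
    have hgI : IntegrableOn (fun t => (1 / (Real.pi * a)) ^ 2 * ‖g t‖ ^ 2) I := by
      refine Measure.integrableOn_of_bounded (M := (1 / (Real.pi * a)) ^ 2 * B ^ 2) (by simp [hI])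
        (Measurable.aestronglyMeasurable (by fun_prop)) (ae_of_all _ fun t => ?_)
      rw [Real.norm_of_nonneg (by positivity)]
      gcongr
      exact hB t
    rw [← Set.inter_eq_self_of_subset_right hIP, ← setIntegral_indicator hIm]
    refine integral_mono_of_nonneg (ae_of_all _ fun t => by positivity)
      (hgI.integrable_indicator hIm).restrict (ae_of_all _ fun t => ?_)
    by_cases ht : t ∈ I
    · have := hub t
      rw [Set.indicator_of_mem ht] at this
      simp only [Set.indicator_of_mem ht]
      calc ‖u t‖ ^ 2 ≤ (‖g t‖ * (1 / (Real.pi * a))) ^ 2 := by gcongr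
        _ = _ := by ring
    · simp [hu, ht]
  have hv2 : ∫ t in Set.Ioc 0 P, ‖v t‖ ^ 2 = ∫ t in Set.Ioc 0 P, ‖u t‖ ^ 2 := by simp_rw [hvu]
  set U : ℤ → ℂ := fun k =>
    ∫ t in Set.Ioc 0 P, u t * Complex.exp (Complex.I * ((k : ℝ) * c : ℝ) * t) with hU
  set V : ℤ → ℂ := fun k =>
    ∫ t in Set.Ioc 0 P, v t * Complex.exp (Complex.I * ((k : ℝ) * c : ℝ) * t) with hV
  have bU := sum_sq_norm_integral_exp_le hc hum huB
    ((Finset.range N).map Nat.castEmbedding)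
  have bV := sum_sq_norm_integral_exp_le hc hvm (fun t => by rw [hvu]; exact huB t)
    (((Finset.range N).map Nat.castEmbedding).map (Equiv.neg ℤ).toEmbedding)
  rw [Finset.sum_map] at bU
  rw [Finset.sum_map, Finset.sum_map, ← hP, hv2] at bV
  have hkey : ∀ k : ℕ, ‖∫ t in I, g t * trapKernel c k t‖ ^ 2 ≤
      1 / 2 * (‖U k‖ ^ 2 + ‖V (-k)‖ ^ 2) := by
    intro k
    rw [key k]
    change ‖1 / 2 * (U k + V (-k))‖ ^ 2 ≤ _
    rw [norm_mul, mul_pow]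
    have h1 : ‖U k + V (-k)‖ ^ 2 ≤ (‖U k‖ + ‖V (-k)‖) ^ 2 := by
      gcongr; exact norm_add_le _ _
    have h2 : ‖(1 / 2 : ℂ)‖ = 1 / 2 := by norm_num
    rw [h2]
    nlinarith [sq_nonneg (‖U k‖ - ‖V (-k)‖)]
  calc _ ≤ ∑ k ∈ Finset.range N, 1 / 2 * (‖U k‖ ^ 2 + ‖V (-k)‖ ^ 2) :=
        Finset.sum_le_sum fun k _ => hkey k
    _ = 1 / 2 * (∑ k ∈ Finset.range N, ‖U k‖ ^ 2 + ∑ k ∈ Finset.range N, ‖V (-k)‖ ^ 2) := by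
        rw [← Finset.mul_sum, Finset.sum_add_distrib]
    _ ≤ 1 / 2 * (P * (∫ t in Set.Ioc 0 P, ‖u t‖ ^ 2) + P * ∫ t in Set.Ioc 0 P, ‖u t‖ ^ 2) := by
        gcongr
        · exact bU
        · exact bV
    _ = P * ∫ t in Set.Ioc 0 P, ‖u t‖ ^ 2 := by ring
    _ ≤ _ := by gcongr

namespace HasUnitAverages

variable {p : ℝ} {h : ℝ → ℂ}

theorem norm_integral_Ioc_trapKernel_le {g : ℝ → ℂ} {a b M c : ℝ} (hc : 0 < c) (ha : 0 < a)
    (k : ℕ) {φ : ℝ → ℝ} (hφ : IntegrableOn φ (Set.Ioc a b)) (hg : ∀ t, ‖g t‖ ≤ φ t)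
    (hM : ∫ t in Set.Ioc a b, φ t ≤ M) :
    ‖∫ t in Set.Ioc a b, g t * trapKernel c k t‖ ≤ 1 / (Real.pi * a) * M := by
  have hpi := Real.pi_pos
  calc _ ≤ ∫ t in Set.Ioc a b, 1 / (Real.pi * a) * φ t := by
        refine norm_integral_le_of_norm_le (hφ.const_mul _) ?_
        filter_upwards [ae_restrict_mem measurableSet_Ioc] with t ht
        rw [norm_mul, mul_comm, Complex.norm_real]
        refine mul_le_mul ((abs_trapKernel_le_inv hc k t).trans ?_) (hg t) (norm_nonneg _)
          (by positivity)
        rw [abs_of_pos (ha.trans ht.1)]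
        have := ht.1.le
        gcongr
    _ = 1 / (Real.pi * a) * ∫ t in Set.Ioc a b, φ t := integral_const_mul _ _
    _ ≤ _ := by gcongr

/-- On a dyadic interval the integrals split into a small part and a square summable part. -/
theorem exists_split_dyadic (H : HasUnitAverages p h) (hp : 1 < p) (hp2 : p ≤ 2) {c : ℝ}
    (hc : 0 < c) {a : ℝ} (ha : 0 < a) (haP : 2 * a ≤ 2 * Real.pi / c) {T : ℝ} (hT : 1 ≤ T) (N : ℕ) :
    ∃ y z : ℕ → ℂ, (∀ k, ∫ t in Set.Ioc a (2 * a), h t * trapKernel c k t = y k + z k) ∧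
      (∀ k, ‖z k‖ ≤ T ^ (1 - p)) ∧ (∀ k, ‖y k‖ ≤ 2) ∧
      ∑ k ∈ Finset.range N, ‖y k‖ ^ 2 ≤ 2 * Real.pi / c / a * T := by
  have hpi := Real.pi_pos
  have hpi3 := Real.pi_gt_three
  have hT0 : 0 < T := by linarith
  -- Truncation at height T. Where |h| > T one has |h| ≤ T^{1-p}|h|^p, which yields the small part
  -- z. Where |h| ≤ T one has |h|² ≤ T^{2-p}|h|^p with T^{2-p} ≤ T, which feeds Bessel's inequality
  -- and yields y. The bound 2 for y uses only the L¹ average.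
  set S := {t : ℝ | ‖h t‖ ≤ T} with hS
  have hSm : MeasurableSet S := measurableSet_le H.measurable.norm measurable_const
  obtain ⟨B, hB⟩ := H.bounded
  set h₁ := S.indicator h with hh₁
  set h₂ := Sᶜ.indicator h with hh₂
  have hm₁ : Measurable h₁ := H.measurable.indicator hSm
  have hm₂ : Measurable h₂ := H.measurable.indicator hSm.compl
  have hsum : ∀ t, h t = h₁ t + h₂ t := fun t => by
    rw [hh₁, hh₂, Set.indicator_self_add_compl_apply]
  have hle₁ : ∀ t, ‖h₁ t‖ ≤ ‖h t‖ := fun t => by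
    rw [hh₁]; exact norm_indicator_le_norm_self _ _
  have hle₂ : ∀ t, ‖h₂ t‖ ≤ ‖h t‖ := fun t => by
    rw [hh₂]; exact norm_indicator_le_norm_self _ _
  have hInt₁ : ∀ k, Integrable fun t => h₁ t * (trapKernel c k t : ℂ) := fun k =>
    _root_.integrable_mul_trapKernel hc k hm₁.aestronglyMeasurable fun t => (hle₁ t).trans (hB t)
  have hInt₂ : ∀ k, Integrable fun t => h₂ t * (trapKernel c k t : ℂ) := fun k =>
    _root_.integrable_mul_trapKernel hc k hm₂.aestronglyMeasurable fun t => (hle₂ t).trans (hB t)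
  have hpow : ∫ t in Set.Ioc a (2 * a), ‖h t‖ ^ p ≤ 2 * a :=
    H.integral_rpow_Ioc_le (by linarith) ha.le (by linarith)
  refine ⟨fun k => ∫ t in Set.Ioc a (2 * a), h₁ t * trapKernel c k t,
    fun k => ∫ t in Set.Ioc a (2 * a), h₂ t * trapKernel c k t, fun k => ?_, fun k => ?_,
    fun k => ?_, ?_⟩
  · rw [← integral_add (hInt₁ k).integrableOn (hInt₂ k).integrableOn]
    refine integral_congr_ae (ae_of_all _ fun t => ?_)
    simp only
    rw [hsum t, add_mul]
  · have := norm_integral_Ioc_trapKernel_le (g := h₂) (M := T ^ (1 - p) * (2 * a)) hc ha k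
      ((H.integrableOn_rpow (by linarith) a (2 * a)).const_mul (T ^ (1 - p))) (fun t => ?_) ?_
    · refine this.trans ?_
      calc 1 / (Real.pi * a) * (T ^ (1 - p) * (2 * a)) = T ^ (1 - p) * (2 / Real.pi) := by
            field_simp
        _ ≤ T ^ (1 - p) * 1 := by
            gcongr
            rw [div_le_one hpi]; linarith
        _ = _ := mul_one _
    · by_cases ht : t ∈ S
      · have : h₂ t = 0 := by simp [hh₂, ht]
        rw [this, norm_zero]; positivity
      · have e : h₂ t = h t := by simp [hh₂, ht]
        have hlt : T < ‖h t‖ := not_le.1 ht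
        rw [e]
        calc ‖h t‖ = ‖h t‖ ^ (1 - p) * ‖h t‖ ^ p := by
              rw [← Real.rpow_add (hT0.trans hlt)]; simp
          _ ≤ _ := by
              exact mul_le_mul_of_nonneg_right
                (Real.rpow_le_rpow_of_nonpos hT0 hlt.le (by linarith)) (by positivity)
    · rw [integral_const_mul]
      gcongr
  · refine (norm_integral_Ioc_trapKernel_le (g := h₁) hc ha k (H.integrableOn_norm a (2 * a)) hle₁
      (H.integral_norm_Ioc_le hp.le ha.le (by linarith))).trans ?_
    calc 1 / (Real.pi * a) * (2 * (2 * a)) = 4 / Real.pi := by field_simp; norm_num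
      _ ≤ 2 := by rw [div_le_iff₀ hpi]; linarith
  · refine (sum_sq_norm_integral_Ioc_trapKernel_le hc hm₁ (fun t => (hle₁ t).trans (hB t)) ha haP
      N).trans ?_
    have h2 : ∫ t in Set.Ioc a (2 * a), ‖h₁ t‖ ^ 2 ≤ T * (2 * a) := by
      calc _ ≤ ∫ t in Set.Ioc a (2 * a), T ^ (2 - p) * ‖h t‖ ^ p := by
            refine integral_mono_of_nonneg (ae_of_all _ fun t => by positivity)
              ((H.integrableOn_rpow (by linarith) a (2 * a)).const_mul _) (ae_of_all _ fun t => ?_)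
            simp only
            by_cases ht : t ∈ S
            · have e : h₁ t = h t := by simp [hh₁, ht]
              have hle : ‖h t‖ ≤ T := ht
              rw [e]
              rcases eq_or_lt_of_le (norm_nonneg (h t)) with h0 | h0
              · rw [← h0]; simp; positivity
              calc ‖h t‖ ^ 2 = ‖h t‖ ^ (2 - p) * ‖h t‖ ^ p := by
                    rw [← Real.rpow_add h0]; simp
                _ ≤ _ := by gcongr
            · have : h₁ t = 0 := by simp [hh₁, ht]
              rw [this]; simp; positivity
        _ = T ^ (2 - p) * ∫ t in Set.Ioc a (2 * a), ‖h t‖ ^ p := integral_const_mul _ _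
        _ ≤ T * (2 * a) := by
            refine mul_le_mul ?_ hpow (integral_nonneg fun t => by positivity) hT0.le
            calc T ^ (2 - p) ≤ T ^ (1 : ℝ) := Real.rpow_le_rpow_of_exponent_le hT (by linarith)
              _ = T := Real.rpow_one T
    calc _ ≤ 2 * Real.pi / c * ((1 / (Real.pi * a)) ^ 2 * (T * (2 * a))) := by gcongr
      _ = 2 * Real.pi / c / a * T * (2 / Real.pi ^ 2) := by field_simp
      _ ≤ 2 * Real.pi / c / a * T * 1 := by
          gcongr
          rw [div_le_one (by positivity)]; nlinarith
      _ = _ := mul_one _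

end HasUnitAverages

/-! ### The ℓ^q estimate over a block of indices -/

/-- The `ℓ^q` norm of the first `N` terms. -/
noncomputable def lqNorm (q : ℝ) (N : ℕ) (x : ℕ → ℂ) : ℝ :=
  (∑ k ∈ Finset.range N, ‖x k‖ ^ q) ^ (1 / q)

theorem lqNorm_add_le {q : ℝ} (hq : 1 ≤ q) (N : ℕ) (x y : ℕ → ℂ) :
    lqNorm q N (x + y) ≤ lqNorm q N x + lqNorm q N y := by
  refine le_trans ?_ (Real.Lp_add_le_of_nonneg (Finset.range N) hq
    (fun k _ => norm_nonneg (x k)) (fun k _ => norm_nonneg (y k)))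
  unfold lqNorm
  have : 0 ≤ q := by linarith
  gcongr with k
  exact norm_add_le _ _

theorem lqNorm_zero {q : ℝ} (hq : 0 < q) (N : ℕ) : lqNorm q N 0 = 0 := by
  simp [lqNorm, hq.ne']

theorem lqNorm_sum_le {q : ℝ} (hq : 1 ≤ q) (N : ℕ) {ι : Type*} (s : Finset ι) (x : ι → ℕ → ℂ) :
    lqNorm q N (∑ i ∈ s, x i) ≤ ∑ i ∈ s, lqNorm q N (x i) :=
  Finset.le_sum_of_subadditive _ (lqNorm_zero (by linarith) N).le (lqNorm_add_le hq N) s x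

theorem lqNorm_le_of_norm_le {q : ℝ} (hq : 0 < q) (N : ℕ) {x : ℕ → ℂ} {M : ℝ} (hM : 0 ≤ M)
    (hx : ∀ k < N, ‖x k‖ ≤ M) : lqNorm q N x ≤ (N : ℝ) ^ (1 / q) * M := by
  have h1 : ∑ k ∈ Finset.range N, ‖x k‖ ^ q ≤ N * M ^ q := by
    calc _ ≤ ∑ k ∈ Finset.range N, M ^ q := by
          refine Finset.sum_le_sum fun k hk => ?_
          exact Real.rpow_le_rpow (norm_nonneg _) (hx k (Finset.mem_range.1 hk)) hq.le
      _ = N * M ^ q := by simp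
  calc lqNorm q N x ≤ (N * M ^ q) ^ (1 / q) := by
        unfold lqNorm
        exact Real.rpow_le_rpow (Finset.sum_nonneg fun _ _ => by positivity) h1 (by positivity)
    _ = _ := by
        rw [Real.mul_rpow (by positivity) (by positivity), ← Real.rpow_mul hM,
          mul_one_div_cancel hq.ne', Real.rpow_one]

/-- For q ≥ 2 and terms at most 2, |x|^q ≤ 2^{q-2}|x|². This is how a Bessel bound becomes an ℓ^q
bound. -/
theorem lqNorm_le_of_sum_sq_le {q : ℝ} (hq : 2 ≤ q) (N : ℕ) {x : ℕ → ℂ} {S : ℝ}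
    (hx : ∀ k, ‖x k‖ ≤ 2) (hS : ∑ k ∈ Finset.range N, ‖x k‖ ^ 2 ≤ S) :
    lqNorm q N x ≤ 2 * S ^ (1 / q) := by
  have hq0 : 0 < q := by linarith
  have hS0 : 0 ≤ S := (Finset.sum_nonneg fun _ _ => by positivity).trans hS
  have h1 : ∑ k ∈ Finset.range N, ‖x k‖ ^ q ≤ 2 ^ q * S := by
    calc _ ≤ ∑ k ∈ Finset.range N, 2 ^ q * ‖x k‖ ^ 2 := by
          refine Finset.sum_le_sum fun k _ => ?_
          rcases eq_or_lt_of_le (norm_nonneg (x k)) with h0 | h0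
          · rw [← h0, Real.zero_rpow hq0.ne']; simp
          calc ‖x k‖ ^ q = ‖x k‖ ^ (q - 2) * ‖x k‖ ^ 2 := by
                rw [← Real.rpow_natCast, ← Real.rpow_add h0]; congr 1; push_cast; ring
            _ ≤ 2 ^ q * ‖x k‖ ^ 2 := by
                gcongr
                calc ‖x k‖ ^ (q - 2) ≤ 2 ^ (q - 2) :=
                      Real.rpow_le_rpow h0.le (hx k) (by linarith)
                  _ ≤ 2 ^ q := Real.rpow_le_rpow_of_exponent_le one_le_two (by linarith)
      _ = 2 ^ q * ∑ k ∈ Finset.range N, ‖x k‖ ^ 2 := by rw [Finset.mul_sum]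
      _ ≤ _ := by gcongr
  calc lqNorm q N x ≤ (2 ^ q * S) ^ (1 / q) := by
        unfold lqNorm
        exact Real.rpow_le_rpow (Finset.sum_nonneg fun _ _ => by positivity) h1 (by positivity)
    _ = _ := by
        rw [Real.mul_rpow (by positivity) hS0, ← Real.rpow_mul (by norm_num),
          mul_one_div_cancel hq0.ne', Real.rpow_one]

theorem two_mul_rpow_inv_le {q : ℝ} (hq : 2 ≤ q) {n : ℝ} (hn : 0 ≤ n) :
    (2 * n) ^ (1 / q) ≤ 2 * n ^ (1 / q) := by
  rw [Real.mul_rpow (by norm_num) hn]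
  gcongr
  calc (2 : ℝ) ^ (1 / q) ≤ 2 ^ (1 : ℝ) := by
        refine Real.rpow_le_rpow_of_exponent_le one_le_two ?_
        rw [div_le_one (by linarith)]; linarith
    _ = 2 := Real.rpow_one 2

theorem integral_Ioi_zero_eq_dyadic {g : ℝ → ℂ} (hg : Integrable g) {δ : ℝ} (hδ : 0 < δ) (m : ℕ) :
    ∫ t in Set.Ioi 0, g t = (∫ t in Set.Ioc 0 δ, g t) +
      (∑ j ∈ Finset.range m, ∫ t in Set.Ioc (2 ^ j * δ) (2 * (2 ^ j * δ)), g t) +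
      ∫ t in Set.Ioi (2 ^ m * δ), g t := by
  have hi : ∀ a b : ℝ, IntervalIntegrable g volume a b := fun a b => hg.intervalIntegrable
  have hle : ∀ j : ℕ, (2 : ℝ) ^ j * δ ≤ 2 ^ (j + 1) * δ := fun j => by
    rw [pow_succ]; have : 0 < (2 : ℝ) ^ j * δ := by positivity
    linarith
  have h1 := intervalIntegral.sum_integral_adjacent_intervals (f := g) (μ := volume)
    (a := fun j : ℕ => (2 : ℝ) ^ j * δ) (n := m) (fun k _ => hi _ _)
  have h2 : ∀ j : ℕ, ∫ t in Set.Ioc (2 ^ j * δ) (2 * (2 ^ j * δ)), g t =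
      ∫ t in ((2 : ℝ) ^ j * δ)..(2 ^ (j + 1) * δ), g t := by
    intro j
    rw [intervalIntegral.integral_of_le (hle j), pow_succ]
    congr 3
    ring
  simp_rw [h2]
  rw [h1, ← intervalIntegral.integral_of_le hδ.le, pow_zero, one_mul,
    intervalIntegral.integral_add_adjacent_intervals (hi _ _) (hi _ _),
    intervalIntegral.integral_of_le (by positivity),
    ← setIntegral_union (Set.Ioc_disjoint_Ioi le_rfl) measurableSet_Ioi
      hg.integrableOn hg.integrableOn, Set.Ioc_union_Ioi_eq_Ioi (by positivity)]

/-- The `ℓ^q` estimate for functions with averages at most `1`. -/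
theorem HasUnitAverages.exists_lqNorm_le {c : ℝ} (hc : 0 < c) {p : ℝ} (hp : 1 < p) (hp2 : p ≤ 2)
    {q : ℝ} (hq : 2 ≤ q) : ∃ K : ℝ, 0 < K ∧ ∀ h : ℝ → ℂ, HasUnitAverages p h → ∀ m : ℕ,
      lqNorm q (2 * 2 ^ m) (fun k => ∫ t in Set.Ioi 0, h t * trapKernel c k t) ≤
        K * ((2 : ℝ) ^ m) ^ (1 / q) := by
  have hpi := Real.pi_pos
  have hq0 : 0 < q := by linarith
  -- On the j-th dyadic interval the square summable part decays like T^{-1/q} and the small part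
  -- like T^{1-p}, with T = 2^{j/2}. The slower of the two rates gives the ratio ρ, with T^{-θ} =
  -- ρ^j.
  set θ := min (1 / q) (p - 1) with hθ
  have hθ0 : 0 < θ := lt_min (by positivity) (by linarith)
  set ρ : ℝ := (2 : ℝ) ^ (-(θ / 2)) with hρ
  have hρ0 : 0 < ρ := by positivity
  have hρ1 : ρ < 1 := Real.rpow_lt_one_of_one_lt_of_neg one_lt_two (by linarith)
  have hρ1' : 0 < 1 - ρ := by linarith
  -- The contributions are 16 from (0, δ], 2 from beyond the period, and 4 times a geometric series
  -- from the dyadic intervals.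
  refine ⟨18 + 4 * (1 - ρ)⁻¹, by positivity, fun h H m => ?_⟩
  set n : ℝ := 2 ^ m with hn
  have hn0 : 0 < n := by positivity
  set P := 2 * Real.pi / c with hP
  have hP0 : 0 < P := by positivity
  -- Up to P/n the bound O(k+1) for the kernel suffices, as k < 2n; exactly m dyadic steps lead from
  -- δ to P.
  set δ := P / n with hδ
  have hδ0 : 0 < δ := by positivity
  set N := 2 * 2 ^ m with hN
  have hNn : (N : ℝ) = 2 * n := by rw [hN, hn]; push_cast; ring
  have hmδ : 2 ^ m * δ = P := by rw [hδ, ← hn]; field_simp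
  set Nq := n ^ (1 / q) with hNq
  have hNq0 : 0 < Nq := by positivity
  have hsup : ∀ (x : ℕ → ℂ) (M : ℝ), 0 ≤ M → (∀ k < N, ‖x k‖ ≤ M) →
      lqNorm q N x ≤ 2 * M * Nq := by
    intro x M hM hx
    refine (lqNorm_le_of_norm_le hq0 N hM hx).trans ?_
    rw [hNn]
    calc (2 * n) ^ (1 / q) * M ≤ (2 * n ^ (1 / q)) * M := by
          gcongr; exact two_mul_rpow_inv_le hq hn0.le
      _ = _ := by rw [hNq]; ring
  set x₀ : ℕ → ℂ := fun k => ∫ t in Set.Ioc 0 δ, h t * trapKernel c k t with hx₀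
  set x : ℕ → ℕ → ℂ := fun j k =>
    ∫ t in Set.Ioc (2 ^ j * δ) (2 * (2 ^ j * δ)), h t * trapKernel c k t with hx
  set x₁ : ℕ → ℂ := fun k => ∫ t in Set.Ioi P, h t * trapKernel c k t with hx₁
  have hdec : (fun k : ℕ => ∫ t in Set.Ioi 0, h t * trapKernel c k t) =
      x₀ + ∑ j ∈ Finset.range m, x j + x₁ := by
    funext k
    rw [integral_Ioi_zero_eq_dyadic (H.integrable_mul_trapKernel hc k) hδ0 m, hmδ]
    simp [hx₀, hx, hx₁]
  have hb₀ : lqNorm q N x₀ ≤ 2 * 8 * Nq := by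
    refine hsup _ _ (by norm_num) fun k hk => ?_
    refine (H.norm_integral_Ioc_zero_le hp.le hc k hδ0).trans ?_
    have hk' : (k : ℝ) + 1 ≤ 2 * n := by rw [← hNn]; exact_mod_cast hk
    calc c * (k + 1) / Real.pi * (2 * δ) ≤ c * (2 * n) / Real.pi * (2 * δ) := by gcongr
      _ = 8 := by rw [hδ, hP]; field_simp; norm_num
  have hb₁ : lqNorm q N x₁ ≤ 2 * 1 * Nq :=
    hsup _ _ (by norm_num) fun k _ => H.norm_integral_Ioi_le hp.le hc k
  have hbj : ∀ j ∈ Finset.range m, lqNorm q N (x j) ≤ 4 * Nq * ρ ^ j := by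
    intro j hj
    have hjm : j + 1 ≤ m := Finset.mem_range.1 hj
    have ha0 : 0 < 2 ^ j * δ := by positivity
    have haP : 2 * (2 ^ j * δ) ≤ P := by
      rw [← hmδ, ← mul_assoc, ← pow_succ']
      gcongr
      exact one_le_two
    -- With a = 2^j δ the Bessel bound is (P/a)T = n 2^{-j} T. Taking T² = 2^j makes it n/T, while
    -- T^{1-p} still decays in j.
    set T : ℝ := (2 : ℝ) ^ ((j : ℝ) / 2) with hT
    have hT1 : 1 ≤ T := Real.one_le_rpow one_le_two (by positivity)
    have hT0 : 0 < T := by positivity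
    have hTρ : T ^ (-θ) = ρ ^ j := by
      rw [hT, hρ, ← Real.rpow_mul (by norm_num), ← Real.rpow_natCast, ← Real.rpow_mul (by norm_num)]
      congr 1; ring
    have hTT : T * T = 2 ^ j := by
      rw [hT, ← Real.rpow_add (by norm_num), add_halves, Real.rpow_natCast]
    obtain ⟨y, z, hyz, hz, hy, hy2⟩ := H.exists_split_dyadic hp hp2 hc ha0 haP hT1 N
    have hxj : x j = y + z := funext hyz
    have hS : 2 * Real.pi / c / (2 ^ j * δ) * T = n * T⁻¹ := by
      rw [← hTT, ← hP, hδ]; field_simp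
    rw [hS] at hy2
    have hyb : lqNorm q N y ≤ 2 * Nq * ρ ^ j := by
      refine (lqNorm_le_of_sum_sq_le hq N hy hy2).trans ?_
      rw [Real.mul_rpow hn0.le (by positivity), Real.inv_rpow hT0.le, ← Real.rpow_neg hT0.le,
        ← mul_assoc, ← hNq, ← hTρ]
      gcongr 2 * Nq * ?_
      exact Real.rpow_le_rpow_of_exponent_le hT1 (neg_le_neg (min_le_left _ _))
    have hzb : lqNorm q N z ≤ 2 * Nq * ρ ^ j := by
      refine (hsup z _ (by positivity) fun k _ => hz k).trans ?_
      rw [mul_right_comm, ← hTρ]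
      gcongr 2 * Nq * ?_
      refine Real.rpow_le_rpow_of_exponent_le hT1 ?_
      have := min_le_right (1 / q) (p - 1)
      linarith
    rw [hxj]
    refine (lqNorm_add_le (by linarith) N y z).trans ?_
    linarith
  have hsum : lqNorm q N (∑ j ∈ Finset.range m, x j) ≤ 4 * Nq * (1 - ρ)⁻¹ := by
    refine (lqNorm_sum_le (by linarith) N _ _).trans ((Finset.sum_le_sum hbj).trans ?_)
    rw [← Finset.mul_sum]
    gcongr
    rw [← tsum_geometric_of_lt_one hρ0.le hρ1]
    exact (summable_geometric_of_lt_one hρ0.le hρ1).sum_le_tsum _ fun _ _ => by positivity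
  rw [hdec]
  have h1 := lqNorm_add_le (by linarith : 1 ≤ q) N (x₀ + ∑ j ∈ Finset.range m, x j) x₁
  have h2 := lqNorm_add_le (by linarith : 1 ≤ q) N x₀ (∑ j ∈ Finset.range m, x j)
  calc _ ≤ 2 * 8 * Nq + 4 * Nq * (1 - ρ)⁻¹ + 2 * 1 * Nq := by linarith
    _ = _ := by ring

/-- The `ℓ^q` estimate for functions whose `p`-th power averages are at most `A ^ p`. -/
theorem exists_lqNorm_trapKernel_le {c : ℝ} (hc : 0 < c) {p : ℝ} (hp : 1 < p) (hp2 : p ≤ 2)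
    {q : ℝ} (hq : 2 ≤ q) : ∃ K : ℝ, 0 < K ∧ ∀ h : ℝ → ℂ, Measurable h →
      (∃ B : ℝ, ∀ t, ‖h t‖ ≤ B) → ∀ A : ℝ, 0 ≤ A →
      (∀ δ : ℝ, 0 < δ → ∫ t in Set.Ioc 0 δ, ‖h t‖ ^ p ≤ A ^ p * δ) → ∀ m : ℕ,
      lqNorm q (2 * 2 ^ m) (fun k => ∫ t in Set.Ioi 0, h t * trapKernel c k t) ≤
        K * A * ((2 : ℝ) ^ m) ^ (1 / q) := by
  obtain ⟨K, hK0, hK⟩ := HasUnitAverages.exists_lqNorm_le hc hp hp2 hq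
  refine ⟨K, hK0, fun h hm hb A hA hav m => ?_⟩
  have hq0 : 0 < q := by linarith
  -- Normalising by a number strictly larger than A avoids division by zero when A = 0; afterwards
  -- A' decreases to A.
  have key : ∀ A' : ℝ, A < A' →
      lqNorm q (2 * 2 ^ m) (fun k => ∫ t in Set.Ioi 0, h t * trapKernel c k t) ≤
        K * A' * ((2 : ℝ) ^ m) ^ (1 / q) := by
    intro A' hA'
    have hA'0 : 0 < A' := by linarith
    set g : ℝ → ℂ := fun t => ((A'⁻¹ : ℝ) : ℂ) * h t with hg
    have hgn : ∀ t, ‖g t‖ = A'⁻¹ * ‖h t‖ := fun t => by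
      rw [hg, norm_mul, Complex.norm_real, Real.norm_of_nonneg (by positivity)]
    have H : HasUnitAverages p g := by
      refine ⟨hm.const_mul _, ?_, fun δ hδ => ?_⟩
      · obtain ⟨B, hB⟩ := hb
        refine ⟨A'⁻¹ * B, fun t => ?_⟩
        rw [hgn]; gcongr; exact hB t
      · simp_rw [hgn, Real.mul_rpow (inv_nonneg.2 hA'0.le) (norm_nonneg _)]
        rw [integral_const_mul]
        calc A'⁻¹ ^ p * ∫ t in Set.Ioc 0 δ, ‖h t‖ ^ p ≤ A'⁻¹ ^ p * (A' ^ p * δ) := by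
              gcongr
              refine (hav δ hδ).trans ?_
              gcongr
          _ = δ := by
              rw [← mul_assoc, ← Real.mul_rpow (by positivity) hA'0.le,
                inv_mul_cancel₀ hA'0.ne', Real.one_rpow, one_mul]
    have h1 := hK g H m
    have h2 : ∀ k : ℕ, ∫ t in Set.Ioi 0, h t * (trapKernel c k t : ℂ) =
        A' * ∫ t in Set.Ioi 0, g t * trapKernel c k t := by
      intro k
      rw [← integral_const_mul]
      refine integral_congr_ae (ae_of_all _ fun t => ?_)
      have : (A' : ℂ) ≠ 0 := by exact_mod_cast hA'0.ne'
      simp only [hg]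
      push_cast
      field_simp
    have h3 : lqNorm q (2 * 2 ^ m) (fun k => ∫ t in Set.Ioi 0, h t * trapKernel c k t) =
        A' * lqNorm q (2 * 2 ^ m) (fun k => ∫ t in Set.Ioi 0, g t * trapKernel c k t) := by
      simp_rw [lqNorm, h2, norm_mul, Complex.norm_real, Real.norm_of_nonneg hA'0.le,
        Real.mul_rpow hA'0.le (norm_nonneg _)]
      rw [← Finset.mul_sum, Real.mul_rpow (by positivity)
        (Finset.sum_nonneg fun _ _ => by positivity), ← Real.rpow_mul hA'0.le,
        mul_one_div_cancel hq0.ne', Real.rpow_one]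
    rw [h3]
    calc _ ≤ A' * (K * ((2 : ℝ) ^ m) ^ (1 / q)) := by gcongr
      _ = _ := by ring
  have hcont : Tendsto (fun A' : ℝ => K * A' * ((2 : ℝ) ^ m) ^ (1 / q)) (𝓝[>] A)
      (𝓝 (K * A * ((2 : ℝ) ^ m) ^ (1 / q))) :=
    ((continuous_const.mul continuous_id).mul continuous_const).continuousAt.tendsto.mono_left
      nhdsWithin_le_nhds
  exact ge_of_tendsto hcont (eventually_mem_nhdsWithin.mono fun A' h => key A' h)

/-! ### Jackson kernels -/

theorem sinc_pow_four_le (t : ℝ) : Real.sinc t ^ 4 ≤ 16 / (1 + |t|) ^ 4 := by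
  have habs := abs_nonneg t
  rw [le_div_iff₀ (by positivity), ← mul_pow, ← Even.pow_abs (by decide : Even 4), abs_mul,
    abs_of_nonneg (by positivity : 0 ≤ 1 + |t|)]
  have h : |Real.sinc t| * (1 + |t|) ≤ 2 := by
    have h1 := Real.abs_sinc_le_one t
    have h2 : |Real.sinc t| * |t| ≤ 1 := by
      rcases eq_or_ne t 0 with rfl | ht
      · simp
      · rw [Real.sinc_of_ne_zero ht, abs_div, div_mul_cancel₀ _ (abs_ne_zero.2 ht)]
        exact Real.abs_sin_le_one t
    linarith
  calc _ ≤ (2 : ℝ) ^ 4 := by gcongr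
    _ = 16 := by norm_num

theorem sinc_pow_four_nonneg (t : ℝ) : 0 ≤ Real.sinc t ^ 4 := Even.pow_nonneg (by decide) _

/-- The fourth power makes the first moment of the kernel finite; the square would leave a decay of
order 1/|t| only. -/
theorem sinc_pow_four_mul_le (t : ℝ) :
    Real.sinc t ^ 4 * (1 + |t|) ≤ 16 * (1 + t ^ 2)⁻¹ := by
  have habs := abs_nonneg t
  calc _ ≤ 16 / (1 + |t|) ^ 4 * (1 + |t|) := by gcongr; exact sinc_pow_four_le t
    _ = 16 / (1 + |t|) ^ 3 := by field_simp
    _ ≤ 16 / (1 + t ^ 2) := by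
        gcongr
        rw [← sq_abs]
        nlinarith [mul_nonneg habs habs, mul_nonneg habs (mul_nonneg habs habs)]
    _ = _ := div_eq_mul_inv _ _

theorem integrable_sinc_pow_four_mul :
    Integrable fun t : ℝ => Real.sinc t ^ 4 * (1 + |t|) := by
  have hc := Real.continuous_sinc
  refine (integrable_inv_one_add_sq.const_mul 16).mono'
    (Continuous.aestronglyMeasurable (by fun_prop)) (ae_of_all _ fun t => ?_)
  have := sinc_pow_four_nonneg t
  rw [Real.norm_of_nonneg (by positivity)]
  exact sinc_pow_four_mul_le t

theorem integrable_sinc_pow_four : Integrable fun t : ℝ => Real.sinc t ^ 4 := by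
  have hc := Real.continuous_sinc
  refine integrable_sinc_pow_four_mul.mono' (Continuous.aestronglyMeasurable (by fun_prop))
    (ae_of_all _ fun t => ?_)
  have := sinc_pow_four_nonneg t
  rw [Real.norm_of_nonneg this]
  nlinarith [abs_nonneg t]

theorem integral_sinc_pow_four_pos : 0 < ∫ t : ℝ, Real.sinc t ^ 4 := by
  have hc := Real.continuous_sinc
  exact integral_pos_of_integrable_nonneg_nonzero (x := 0) (by fun_prop) integrable_sinc_pow_four
    sinc_pow_four_nonneg (by simp)

/-- The Jackson kernel of order `r` on the line. -/
noncomputable def jackson (r t : ℝ) : ℝ :=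
  r / (∫ s : ℝ, Real.sinc s ^ 4) * Real.sinc (r * t) ^ 4

theorem continuous_jackson (r : ℝ) : Continuous (jackson r) := by
  have hc := Real.continuous_sinc
  unfold jackson; fun_prop

theorem jackson_neg (r t : ℝ) : jackson r (-t) = jackson r t := by
  rw [jackson, jackson, mul_neg, Real.sinc_neg]

theorem jackson_nonneg {r : ℝ} (hr : 0 < r) (t : ℝ) : 0 ≤ jackson r t := by
  have := integral_sinc_pow_four_pos
  have := sinc_pow_four_nonneg (r * t)
  unfold jackson; positivity

theorem integrable_jackson {r : ℝ} (hr : 0 < r) : Integrable (jackson r) :=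
  ((integrable_sinc_pow_four.comp_mul_left' hr.ne').const_mul _)

theorem integral_jackson {r : ℝ} (hr : 0 < r) : ∫ t : ℝ, jackson r t = 1 := by
  have h0 := integral_sinc_pow_four_pos
  simp_rw [jackson]
  rw [integral_const_mul, Measure.integral_comp_mul_left (fun s : ℝ => Real.sinc s ^ 4) r,
    smul_eq_mul, abs_of_pos (by positivity)]
  field_simp

/-- The weighted mass of the Jackson kernel, which does not depend on the order. -/
noncomputable def jacksonMass : ℝ :=
  (∫ s : ℝ, Real.sinc s ^ 4)⁻¹ * ∫ s : ℝ, Real.sinc s ^ 4 * (1 + |s|)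

theorem jacksonMass_pos : 0 < jacksonMass := by
  have hc := Real.continuous_sinc
  refine mul_pos (inv_pos.2 integral_sinc_pow_four_pos) ?_
  refine integral_pos_of_integrable_nonneg_nonzero (x := 0) (by fun_prop)
    integrable_sinc_pow_four_mul (fun t => ?_) (by simp)
  have := sinc_pow_four_nonneg t
  have := abs_nonneg t
  simp only [Pi.zero_apply]
  positivity

theorem jackson_mul_eq {r : ℝ} (hr : 0 < r) (t : ℝ) : jackson r t * (1 + r * |t|) =
    r / (∫ s : ℝ, Real.sinc s ^ 4) * (Real.sinc (r * t) ^ 4 * (1 + |r * t|)) := by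
  rw [jackson, abs_mul, abs_of_pos hr]; ring

theorem integrable_jackson_mul {r : ℝ} (hr : 0 < r) :
    Integrable fun t : ℝ => jackson r t * (1 + r * |t|) := by
  simp_rw [jackson_mul_eq hr]
  exact (integrable_sinc_pow_four_mul.comp_mul_left' hr.ne').const_mul _

theorem integral_jackson_mul {r : ℝ} (hr : 0 < r) :
    ∫ t : ℝ, jackson r t * (1 + r * |t|) = jacksonMass := by
  simp_rw [jackson_mul_eq hr]
  rw [integral_const_mul,
    Measure.integral_comp_mul_left (fun s : ℝ => Real.sinc s ^ 4 * (1 + |s|)) r,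
    smul_eq_mul, abs_of_pos (by positivity), jacksonMass]
  field_simp

theorem jackson_le {r : ℝ} (hr : 0 < r) (t : ℝ) :
    jackson r t ≤ r / (∫ s : ℝ, Real.sinc s ^ 4) * (16 / (1 + r * |t|) ^ 4) := by
  have h0 := integral_sinc_pow_four_pos
  have := sinc_pow_four_le (r * t)
  rw [abs_mul, abs_of_pos hr] at this
  unfold jackson
  gcongr

theorem integral_exp_eq_sinc (s : ℝ) :
    ∫ x in Set.Ioc (-1 : ℝ) 1, Complex.exp (Complex.I * x * s) = 2 * Real.sinc s := by
  rw [← intervalIntegral.integral_of_le (by norm_num)]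
  rcases eq_or_ne s 0 with rfl | hs
  · simp; norm_num
  have hs' : (s : ℂ) ≠ 0 := by exact_mod_cast hs
  have hI : Complex.I * s ≠ 0 := mul_ne_zero Complex.I_ne_zero hs'
  have : ∀ x : ℝ, Complex.I * x * s = Complex.I * s * x := fun x => by ring
  simp_rw [this]
  rw [integral_exp_mul_complex hI, Real.sinc_of_ne_zero hs]
  push_cast
  rw [Complex.sin]
  field_simp
  rw [Complex.I_sq]
  ring_nf

/-- The finite measure on `ℝ⁴` giving the Fourier representation of the Jackson kernel. -/
noncomputable def cubeMeasure : Measure (Fin 4 → ℝ) :=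
  Measure.pi fun _ => volume.restrict (Set.Ioc (-1 : ℝ) 1)

instance : IsFiniteMeasure cubeMeasure := by
  unfold cubeMeasure; infer_instance

/-- `sinc` is half the Fourier transform of Lebesgue measure on (-1, 1], so its fourth power is a
superposition of exponentials with frequencies ∑ x_i in [-4, 4]. Hence the Jackson kernel of order r
has spectrum in [-4r, 4r]. -/
theorem sinc_pow_four_eq_integral (s : ℝ) :
    ((Real.sinc s ^ 4 : ℝ) : ℂ) =
      1 / 16 * ∫ x, Complex.exp (Complex.I * ((∑ i, x i : ℝ) : ℂ) * s) ∂cubeMeasure := by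
  have h := integral_fintype_prod_eq_pow (ι := Fin 4)
    (fun x : ℝ => Complex.exp (Complex.I * x * s)) (μ := volume.restrict (Set.Ioc (-1 : ℝ) 1))
  rw [integral_exp_eq_sinc] at h
  have h2 : ∀ x : Fin 4 → ℝ, ∏ i, Complex.exp (Complex.I * (x i) * s) =
      Complex.exp (Complex.I * ((∑ i, x i : ℝ) : ℂ) * s) := by
    intro x
    rw [← Complex.exp_sum]
    congr 1
    push_cast
    rw [Finset.mul_sum, Finset.sum_mul]
  simp_rw [h2] at h
  rw [cubeMeasure, h]
  simp only [Fintype.card_fin]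
  push_cast
  ring

theorem ae_cubeMeasure_abs_sum_le : ∀ᵐ x ∂cubeMeasure, |∑ i, x i| ≤ 4 := by
  have h : ∀ᵐ x ∂cubeMeasure, ∀ i, x i ∈ Set.Ioc (-1 : ℝ) 1 := by
    rw [ae_all_iff]
    intro i
    exact (Measure.tendsto_eval_ae_ae (i := i)).eventually (ae_restrict_mem measurableSet_Ioc)
  filter_upwards [h] with x hx
  refine (Finset.abs_sum_le_sum_abs _ _).trans ?_
  calc ∑ i, |x i| ≤ ∑ _i : Fin 4, (1 : ℝ) :=
        Finset.sum_le_sum fun i _ => abs_le.2 ⟨(hx i).1.le, (hx i).2⟩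
    _ = 4 := by simp

/-- The trapezoidal kernel reproduces Jackson kernels of small order. -/
theorem integral_jackson_sub_mul_trapKernel {c r : ℝ} (hc : 0 < c) (hr : 0 < r) {k : ℕ}
    (hk : 4 * r ≤ k * c) (u : ℝ) :
    ∫ t : ℝ, (jackson r (t - u) : ℂ) * trapKernel c k t = jackson r u := by
  set κ : ℂ := ((r / ∫ s : ℝ, Real.sinc s ^ 4 : ℝ) : ℂ) * (1 / 16) with hκ
  have hrep : ∀ v : ℝ, (jackson r v : ℂ) = κ *
      ∫ x, Complex.exp (Complex.I * ((∑ i, x i : ℝ) : ℂ) * ((r * v : ℝ) : ℂ)) ∂cubeMeasure := by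
    intro v
    rw [jackson, Complex.ofReal_mul, sinc_pow_four_eq_integral, hκ]
    ring
  have hexp : ∀ (x : Fin 4 → ℝ) (t : ℝ),
      Complex.exp (Complex.I * ((∑ i, x i : ℝ) : ℂ) * ((r * (t - u) : ℝ) : ℂ)) =
      Complex.exp (Complex.I * ((∑ i, x i : ℝ) : ℂ) * ((r * (-u) : ℝ) : ℂ)) *
        Complex.exp (Complex.I * ((r * ∑ i, x i : ℝ) : ℂ) * t) := by
    intro x t
    rw [← Complex.exp_add]
    congr 1
    push_cast
    ring
  have hprod : Integrable (Function.uncurry fun (t : ℝ) (x : Fin 4 → ℝ) =>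
      Complex.exp (Complex.I * ((∑ i, x i : ℝ) : ℂ) * ((r * (t - u) : ℝ) : ℂ)) * trapKernel c k t)
      (volume.prod cubeMeasure) := by
    have h1 : Integrable (fun z : ℝ × (Fin 4 → ℝ) => (trapKernel c k z.1 : ℂ) * (1 : ℂ))
        (volume.prod cubeMeasure) :=
      (integrable_trapKernel hc k).ofReal.mul_prod
        (integrable_const (μ := cubeMeasure) (1 : ℂ))
    simp only [mul_one] at h1
    refine h1.bdd_mul (c := 1) (Continuous.aestronglyMeasurable (by fun_prop)) (ae_of_all _ fun z => ?_)
    rw [norm_exp_I_mul_mul]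
  calc ∫ t : ℝ, (jackson r (t - u) : ℂ) * trapKernel c k t
      = ∫ t : ℝ, κ * ∫ x, Complex.exp (Complex.I * ((∑ i, x i : ℝ) : ℂ) *
          ((r * (t - u) : ℝ) : ℂ)) * trapKernel c k t ∂cubeMeasure := by
        refine integral_congr_ae (ae_of_all _ fun t => ?_)
        simp only
        rw [hrep, integral_mul_const, mul_assoc]
    _ = κ * ∫ x, (∫ t : ℝ, Complex.exp (Complex.I * ((∑ i, x i : ℝ) : ℂ) *
          ((r * (t - u) : ℝ) : ℂ)) * trapKernel c k t) ∂cubeMeasure := by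
        rw [integral_const_mul, integral_integral_swap hprod]
    _ = κ * ∫ x, Complex.exp (Complex.I * ((∑ i, x i : ℝ) : ℂ) * ((r * (-u) : ℝ) : ℂ))
          ∂cubeMeasure := by
        congr 1
        refine integral_congr_ae ?_
        filter_upwards [ae_cubeMeasure_abs_sum_le] with x hx
        -- The inner integral is the multiplier at the frequency r∑x_i, which lies on the flat top
        -- of the trapezoid.
        have h2 : |r * ∑ i, x i| ≤ k * c := by
          rw [abs_mul, abs_of_pos hr]
          nlinarith
        calc _ = ∫ t : ℝ, Complex.exp (Complex.I * ((∑ i, x i : ℝ) : ℂ) * ((r * (-u) : ℝ) : ℂ)) *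
              ((trapKernel c k t : ℂ) * Complex.exp (Complex.I * ((r * ∑ i, x i : ℝ) : ℂ) * t)) := by
              refine integral_congr_ae (ae_of_all _ fun t => ?_)
              simp only
              rw [hexp]
              ring
          _ = _ := by
              rw [integral_const_mul, integral_trapKernel_mul_exp_of_le hc k h2, mul_one]
    _ = jackson r u := by rw [← hrep, jackson_neg]

/-! ### Approximation of the symmetric difference by Jackson convolutions -/

namespace IsModulusType

variable {w : ℝ → ℝ}

theorem nonneg (hw : IsModulusType w) {s : ℝ} (hs : 0 ≤ s) : 0 ≤ w s := by
  rw [← hw.zero]; exact hw.mono (Set.mem_Ici.2 le_rfl) hs hs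

theorem natCast_mul_le (hw : IsModulusType w) (n : ℕ) {s : ℝ} (hs : 0 ≤ s) :
    w (n * s) ≤ n * w s := by
  induction n with
  | zero => simp [hw.zero]
  | succ n ih =>
    have := hw.subadd (n * s) s (by positivity) hs
    push_cast
    rw [add_mul, one_mul]
    linarith

/-- Monotonicity and subadditivity with s ≤ ⌈rs⌉·(1/r) and ⌈rs⌉ ≤ 1 + rs. -/
theorem le_one_add_mul (hw : IsModulusType w) {r s : ℝ} (hr : 0 < r) (hs : 0 ≤ s) :
    w s ≤ (1 + r * s) * w (1 / r) := by
  have h0 : 0 ≤ w (1 / r) := hw.nonneg (by positivity)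
  have h1 : s ≤ ⌈r * s⌉₊ * (1 / r) := by
    rw [mul_one_div, le_div_iff₀ hr, mul_comm]
    exact Nat.le_ceil _
  have h2 := (Nat.ceil_lt_add_one (by positivity : 0 ≤ r * s)).le
  calc w s ≤ w (⌈r * s⌉₊ * (1 / r)) := hw.mono hs (by positivity : (0 : ℝ) ≤ _) h1
    _ ≤ ⌈r * s⌉₊ * w (1 / r) := hw.natCast_mul_le _ (by positivity)
    _ ≤ _ := by gcongr; linarith

end IsModulusType

/-- Even bounded measurable functions satisfying the two averaged smoothness estimates. -/
structure HasAveragedModulus (p : ℝ) (w : ℝ → ℝ) (C : ℝ≥0) (φ : ℝ → ℂ) : Prop where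
  measurable : Measurable φ
  bounded : ∃ B : ℝ, ∀ t, ‖φ t‖ ≤ B
  even : ∀ t, φ (-t) = φ t
  shift_add : ∀ γ δ : ℝ, 0 < γ → 0 < δ →
    eLpNorm (fun t => φ t - φ (t + γ)) (ENNReal.ofReal p) (averageMeasure 0 δ)
      ≤ C * ENNReal.ofReal (w γ)
  shift_sub : ∀ γ δ : ℝ, 0 < γ → 0 < δ →
    eLpNorm (fun t => φ t - φ (t - γ)) (ENNReal.ofReal p) (averageMeasure 0 δ)
      ≤ C * ENNReal.ofReal (w γ)
  modulus : ∀ δ : ℝ, 0 < δ →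
    eLpNorm φ (ENNReal.ofReal p) (averageMeasure 0 δ) ≤ C * ENNReal.ofReal (w δ)

theorem lintegral_rpow_le_of_eLpNorm_averageMeasure {p : ℝ} (hp : 0 < p) {g : ℝ → ℂ} {δ : ℝ}
    (hδ : 0 < δ) {B : ℝ≥0∞}
    (h : eLpNorm g (ENNReal.ofReal p) (averageMeasure 0 δ) ≤ B) :
    ∫⁻ t in Set.Ioc 0 δ, ‖g t‖ₑ ^ p ≤ B ^ p * ENNReal.ofReal δ := by
  have hp0 : ENNReal.ofReal p ≠ 0 := by simpa using hp
  rw [eLpNorm_eq_lintegral_rpow_enorm_toReal hp0 ENNReal.ofReal_ne_top,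
    ENNReal.toReal_ofReal hp.le, averageMeasure, lintegral_smul_measure, smul_eq_mul, sub_zero,
    one_div, ENNReal.rpow_inv_le_iff hp] at h
  have h0 : ENNReal.ofReal δ ≠ 0 := by simpa using hδ
  rw [mul_comm (B ^ p)]
  calc _ = ENNReal.ofReal δ * ((ENNReal.ofReal δ)⁻¹ * ∫⁻ t in Set.Ioc 0 δ, ‖g t‖ₑ ^ p) := by
        rw [← mul_assoc, ENNReal.mul_inv_cancel h0 ENNReal.ofReal_ne_top, one_mul]
    _ ≤ _ := by gcongr

/-- Jensen's inequality for powers with respect to a density of total mass one. -/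
theorem lintegral_mul_rpow_le {p : ℝ} (hp : 1 ≤ p) {W X : ℝ → ℝ≥0∞} (hW : Measurable W)
    (hX : Measurable X) (h1 : ∫⁻ γ, W γ = 1) :
    (∫⁻ γ, W γ * X γ) ^ p ≤ ∫⁻ γ, W γ * X γ ^ p := by
  have hprob : IsProbabilityMeasure (volume.withDensity W) := ⟨by
    rw [withDensity_apply _ MeasurableSet.univ, setLIntegral_univ, h1]⟩
  have hp0 : 0 < p := by linarith
  have h := eLpNorm'_le_eLpNorm'_of_exponent_le one_pos hp (volume.withDensity W)
    (f := X) hX.aestronglyMeasurable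
  simp only [eLpNorm'_eq_lintegral_enorm, enorm_eq_self, ENNReal.rpow_one, div_one, one_div] at h
  rw [ENNReal.le_rpow_inv_iff hp0, lintegral_withDensity_eq_lintegral_mul _ hW hX,
    lintegral_withDensity_eq_lintegral_mul _ hW (hX.pow_const p)] at h
  exact h

/-- The remainder of the approximation by the convolution with a Jackson kernel. -/
noncomputable def jacksonRem (r : ℝ) (φ : ℝ → ℂ) (t : ℝ) : ℂ :=
  φ t - ∫ γ : ℝ, (jackson r γ : ℂ) * φ (t - γ)

theorem integrable_jackson_mul_comp {r : ℝ} (hr : 0 < r) {g : ℝ → ℂ} (hg : Measurable g)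
    (hB : ∃ B : ℝ, ∀ t, ‖g t‖ ≤ B) : Integrable fun γ : ℝ => (jackson r γ : ℂ) * g γ := by
  obtain ⟨B, hB⟩ := hB
  exact (integrable_jackson hr).ofReal.mul_bdd (c := B) hg.aestronglyMeasurable (ae_of_all _ hB)

theorem norm_jackson_conv_le {r : ℝ} (hr : 0 < r) {φ : ℝ → ℂ} {B : ℝ}
    (hB : ∀ t, ‖φ t‖ ≤ B) (t : ℝ) : ‖∫ γ : ℝ, (jackson r γ : ℂ) * φ (t - γ)‖ ≤ B := by
  calc _ ≤ ∫ γ : ℝ, jackson r γ * B := by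
        refine norm_integral_le_of_norm_le ((integrable_jackson hr).mul_const B)
          (ae_of_all _ fun γ => ?_)
        rw [norm_mul, Complex.norm_real, Real.norm_of_nonneg (jackson_nonneg hr γ)]
        exact mul_le_mul_of_nonneg_left (hB _) (jackson_nonneg hr γ)
    _ = B := by rw [integral_mul_const, integral_jackson hr, one_mul]

namespace HasAveragedModulus

variable {p : ℝ} {w : ℝ → ℝ} {C : ℝ≥0} {φ : ℝ → ℂ}

theorem measurable_jacksonRem (H : HasAveragedModulus p w C φ) (r : ℝ) :
    Measurable (jacksonRem r φ) := by
  refine H.measurable.sub ?_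
  have hφ := H.measurable
  have hJ := (continuous_jackson r).measurable
  have : StronglyMeasurable (Function.uncurry fun t γ : ℝ => (jackson r γ : ℂ) * φ (t - γ)) := by
    refine Measurable.stronglyMeasurable ?_
    unfold Function.uncurry
    fun_prop
  exact this.integral_prod_right.measurable

theorem integrable_comp_sub (H : HasAveragedModulus p w C φ) {r : ℝ} (hr : 0 < r) (t : ℝ) :
    Integrable fun γ : ℝ => (jackson r γ : ℂ) * φ (t - γ) := by
  have hφ := H.measurable
  obtain ⟨B, hB⟩ := H.bounded
  exact integrable_jackson_mul_comp hr (g := fun γ => φ (t - γ)) (by fun_prop) ⟨B, fun γ => hB _⟩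

theorem bounded_jacksonRem (H : HasAveragedModulus p w C φ) {r : ℝ} (hr : 0 < r) :
    ∃ B : ℝ, ∀ t, ‖jacksonRem r φ t‖ ≤ B := by
  obtain ⟨B, hB⟩ := H.bounded
  exact ⟨B + B, fun t => norm_sub_le_of_le (hB t) (norm_jackson_conv_le hr hB t)⟩

theorem jacksonRem_neg (H : HasAveragedModulus p w C φ) (r t : ℝ) :
    jacksonRem r φ (-t) = jacksonRem r φ t := by
  rw [jacksonRem, jacksonRem, H.even]
  congr 1
  rw [← integral_neg_eq_self]
  refine integral_congr_ae (ae_of_all _ fun γ => ?_)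
  simp only
  rw [jackson_neg, ← H.even, neg_sub, sub_neg_eq_add, neg_add_eq_sub]

theorem jacksonRem_eq (H : HasAveragedModulus p w C φ) {r : ℝ} (hr : 0 < r) (t : ℝ) :
    jacksonRem r φ t = ∫ γ : ℝ, (jackson r γ : ℂ) * (φ t - φ (t - γ)) := by
  simp_rw [mul_sub]
  have hi : Integrable fun γ : ℝ => (jackson r γ : ℂ) * φ t :=
    (integrable_jackson hr).ofReal.mul_const _
  rw [integral_sub hi (H.integrable_comp_sub hr t),
    integral_mul_const]
  have : ∫ γ : ℝ, (jackson r γ : ℂ) = 1 := by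
    rw [integral_complex_ofReal, integral_jackson hr, Complex.ofReal_one]
  rw [this, one_mul, jacksonRem]

/-- The Jackson kernel is two-sided while the averages are taken over (0, δ], so the sign of γ
decides which of the two shift conditions applies. -/
theorem lintegral_shift_le (H : HasAveragedModulus p w C φ) (hp : 1 ≤ p) (hw : IsModulusType w)
    {r : ℝ} (hr : 0 < r) (γ : ℝ) {δ : ℝ} (hδ : 0 < δ) :
    ∫⁻ t in Set.Ioc 0 δ, ‖φ t - φ (t - γ)‖ₑ ^ p ≤
      (ENNReal.ofReal (1 + r * |γ|) * (C * ENNReal.ofReal (w (1 / r)))) ^ p * ENNReal.ofReal δ := by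
  have hp0 : 0 < p := by linarith
  have hle : ∀ s : ℝ, 0 ≤ s → C * ENNReal.ofReal (w s) ≤
      ENNReal.ofReal (1 + r * s) * (C * ENNReal.ofReal (w (1 / r))) := by
    intro s hs
    rw [mul_left_comm, ← ENNReal.ofReal_mul (by positivity)]
    gcongr
    exact hw.le_one_add_mul hr hs
  rcases lt_trichotomy γ 0 with h | h | h
  · rw [abs_of_neg h]
    have := (H.shift_add (-γ) δ (by linarith) hδ).trans (hle (-γ) (by linarith))
    simp only [← sub_eq_add_neg] at this
    exact lintegral_rpow_le_of_eLpNorm_averageMeasure hp0 hδ this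
  · subst h
    simp [hp0]
  · rw [abs_of_pos h]
    exact lintegral_rpow_le_of_eLpNorm_averageMeasure hp0 hδ
      ((H.shift_sub γ δ h hδ).trans (hle γ h.le))

/-- The remainder averages φ(t) - φ(t-γ) against J(γ). Dividing the difference by 1 + r|γ| offsets
the growth of w(|γ|), and multiplying J by it gives, after normalisation, the probability density
`W`. Jensen's inequality and Tonelli's theorem then reduce the claim to the shift estimate; the
normalising mass does not depend on r. -/
theorem lintegral_jacksonRem_le (H : HasAveragedModulus p w C φ) (hp : 1 ≤ p)
    (hw : IsModulusType w) {r : ℝ} (hr : 0 < r) {δ : ℝ} (hδ : 0 < δ) :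
    ∫⁻ t in Set.Ioc 0 δ, ‖jacksonRem r φ t‖ₑ ^ p ≤
      (ENNReal.ofReal jacksonMass * (C * ENNReal.ofReal (w (1 / r)))) ^ p * ENNReal.ofReal δ := by
  have hp0 : 0 < p := by linarith
  have hM := jacksonMass_pos
  have hφ := H.measurable
  have hJ := (continuous_jackson r).measurable
  set M := jacksonMass with hMdef
  set W : ℝ → ℝ≥0∞ := fun γ => ENNReal.ofReal (M⁻¹ * (jackson r γ * (1 + r * |γ|))) with hW
  have hWm : Measurable W := by
    refine ENNReal.measurable_ofReal.comp ?_
    have : Measurable fun γ : ℝ => |γ| := continuous_abs.measurable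
    fun_prop
  have hWnn : ∀ γ, 0 ≤ M⁻¹ * (jackson r γ * (1 + r * |γ|)) := fun γ => by
    have := jackson_nonneg hr γ
    positivity
  have hW1 : ∫⁻ γ, W γ = 1 := by
    rw [hW, ← ofReal_integral_eq_lintegral_ofReal ((integrable_jackson_mul hr).const_mul _)
      (ae_of_all _ hWnn), integral_const_mul, integral_jackson_mul hr, ← hMdef,
      inv_mul_cancel₀ hM.ne', ENNReal.ofReal_one]
  set X : ℝ → ℝ → ℝ≥0∞ := fun t γ =>
    (ENNReal.ofReal (1 + r * |γ|))⁻¹ * ‖φ t - φ (t - γ)‖ₑ with hX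
  have hXm2 : Measurable (Function.uncurry X) := by
    unfold Function.uncurry
    refine Measurable.mul ?_ ?_
    · have : Measurable fun z : ℝ × ℝ => |z.2| := (continuous_abs.comp continuous_snd).measurable
      fun_prop
    · have : Measurable fun z : ℝ × ℝ => φ z.1 - φ (z.1 - z.2) := by fun_prop
      exact this.enorm
  have hXm : ∀ t, Measurable (X t) := fun t => hXm2.of_uncurry_left
  have hpos : ∀ γ : ℝ, ENNReal.ofReal (1 + r * |γ|) ≠ 0 := fun γ => by
    have : 0 < 1 + r * |γ| := by positivity
    simpa using this
  have hrem : ∀ t, ‖jacksonRem r φ t‖ₑ ≤ ENNReal.ofReal M * ∫⁻ γ, W γ * X t γ := by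
    intro t
    rw [H.jacksonRem_eq hr, ← lintegral_const_mul' _ _ ENNReal.ofReal_ne_top]
    refine (enorm_integral_le_lintegral_enorm _).trans (lintegral_mono fun γ => le_of_eq ?_)
    rw [enorm_mul, ← ofReal_norm (jackson r γ : ℂ), Complex.norm_real,
      Real.norm_of_nonneg (jackson_nonneg hr γ), hW, hX, ← mul_assoc, ← mul_assoc,
      ← ENNReal.ofReal_mul hM.le, mul_inv_cancel_left₀ hM.ne',
      ENNReal.ofReal_mul (jackson_nonneg hr γ), mul_assoc (ENNReal.ofReal (jackson r γ)),
      ENNReal.mul_inv_cancel (hpos γ) ENNReal.ofReal_ne_top, mul_one]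
  calc ∫⁻ t in Set.Ioc 0 δ, ‖jacksonRem r φ t‖ₑ ^ p
      ≤ ∫⁻ t in Set.Ioc 0 δ, ENNReal.ofReal M ^ p * ∫⁻ γ, W γ * X t γ ^ p := by
        refine lintegral_mono fun t => ?_
        calc ‖jacksonRem r φ t‖ₑ ^ p ≤ (ENNReal.ofReal M * ∫⁻ γ, W γ * X t γ) ^ p := by
              gcongr; exact hrem t
          _ = ENNReal.ofReal M ^ p * (∫⁻ γ, W γ * X t γ) ^ p :=
              ENNReal.mul_rpow_of_nonneg _ _ hp0.le
          _ ≤ _ := by gcongr; exact lintegral_mul_rpow_le hp hWm (hXm t) hW1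
    _ = ENNReal.ofReal M ^ p * ∫⁻ t in Set.Ioc 0 δ, ∫⁻ γ, W γ * X t γ ^ p := by
        rw [lintegral_const_mul' _ _ (ENNReal.rpow_ne_top_of_nonneg hp0.le ENNReal.ofReal_ne_top)]
    _ = ENNReal.ofReal M ^ p * ∫⁻ γ, W γ * ∫⁻ t in Set.Ioc 0 δ, X t γ ^ p := by
        rw [lintegral_lintegral_swap]
        · congr 1
          refine lintegral_congr fun γ => ?_
          rw [lintegral_const_mul' _ _ ENNReal.ofReal_ne_top]
        · refine Measurable.aemeasurable ?_
          exact (hWm.comp measurable_snd).mul (hXm2.pow_const p)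
    _ ≤ ENNReal.ofReal M ^ p * ∫⁻ γ, W γ * ((C * ENNReal.ofReal (w (1 / r))) ^ p *
          ENNReal.ofReal δ) := by
        gcongr with γ
        simp only [hX, ENNReal.mul_rpow_of_nonneg _ _ hp0.le]
        rw [lintegral_const_mul' _ _ (ENNReal.rpow_ne_top_of_nonneg hp0.le
          (ENNReal.inv_ne_top.2 (hpos γ)))]
        calc _ ≤ (ENNReal.ofReal (1 + r * |γ|))⁻¹ ^ p *
              ((ENNReal.ofReal (1 + r * |γ|) * (C * ENNReal.ofReal (w (1 / r)))) ^ p *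
                ENNReal.ofReal δ) := by
              gcongr; exact H.lintegral_shift_le hp hw hr γ hδ
          _ = _ := by
              rw [← mul_assoc, ← ENNReal.mul_rpow_of_nonneg _ _ hp0.le, ← mul_assoc,
                ENNReal.inv_mul_cancel (hpos γ) ENNReal.ofReal_ne_top, one_mul,
                ENNReal.mul_rpow_of_nonneg _ _ hp0.le]
    _ = _ := by
        rw [lintegral_mul_const _ hWm, hW1, one_mul, ← mul_assoc,
          ← ENNReal.mul_rpow_of_nonneg _ _ hp0.le]

theorem integral_jacksonRem_le (H : HasAveragedModulus p w C φ) (hp : 1 ≤ p)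
    (hw : IsModulusType w) {r : ℝ} (hr : 0 < r) {δ : ℝ} (hδ : 0 < δ) :
    ∫ t in Set.Ioc 0 δ, ‖jacksonRem r φ t‖ ^ p ≤ (jacksonMass * (C * w (1 / r))) ^ p * δ := by
  have hp0 : 0 < p := by linarith
  have hM := jacksonMass_pos
  have hw0 : 0 ≤ w (1 / r) := hw.nonneg (by positivity)
  have h := H.lintegral_jacksonRem_le hp hw hr hδ
  rw [integral_eq_lintegral_of_nonneg_ae (ae_of_all _ fun t => by positivity)
    ((H.measurable_jacksonRem r).norm.pow_const p).aestronglyMeasurable]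
  refine ENNReal.toReal_le_of_le_ofReal (by positivity) ?_
  have e : ENNReal.ofReal ((jacksonMass * (C * w (1 / r))) ^ p * δ) =
      (ENNReal.ofReal jacksonMass * (C * ENNReal.ofReal (w (1 / r)))) ^ p * ENNReal.ofReal δ := by
    rw [ENNReal.ofReal_mul (by positivity), ← ENNReal.ofReal_rpow_of_nonneg (by positivity) hp0.le,
      ENNReal.ofReal_mul hM.le, ENNReal.ofReal_mul (NNReal.coe_nonneg C), ENNReal.ofReal_coe_nnreal]
  rw [e]
  refine le_trans (le_of_eq (lintegral_congr fun t => ?_)) h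
  rw [← ENNReal.ofReal_rpow_of_nonneg (norm_nonneg _) hp0.le, ofReal_norm]

end HasAveragedModulus

/-! ### The trapezoidal kernel applied to the Jackson decomposition -/

theorem integral_eq_two_mul_Ioi_of_even {g : ℝ → ℂ} (hg : Integrable g) (he : ∀ t, g (-t) = g t) :
    ∫ t : ℝ, g t = 2 * ∫ t in Set.Ioi 0, g t := by
  rw [← intervalIntegral.integral_Iic_add_Ioi (b := 0) hg.integrableOn hg.integrableOn, two_mul]
  congr 1
  have := integral_comp_neg_Ioi (0 : ℝ) g
  simp only [he, neg_zero] at this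
  exact this.symm

namespace HasAveragedModulus

variable {p : ℝ} {w : ℝ → ℝ} {C : ℝ≥0} {φ : ℝ → ℂ}

/-- The trapezoidal kernel acts trivially on the convolution with a Jackson kernel. -/
theorem integral_conv_mul_trapKernel (H : HasAveragedModulus p w C φ) {c r : ℝ} (hc : 0 < c)
    (hr : 0 < r) {k : ℕ} (hk : 4 * r ≤ k * c) :
    ∫ t : ℝ, (∫ γ : ℝ, (jackson r γ : ℂ) * φ (t - γ)) * trapKernel c k t =
      ∫ s : ℝ, (jackson r s : ℂ) * φ s := by
  have hφ := H.measurable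
  obtain ⟨B, hB⟩ := H.bounded
  have hsub : ∀ t : ℝ, ∫ γ : ℝ, (jackson r γ : ℂ) * φ (t - γ) =
      ∫ s : ℝ, (jackson r (t - s) : ℂ) * φ s := by
    intro t
    rw [← integral_sub_left_eq_self (fun s : ℝ => (jackson r (t - s) : ℂ) * φ s) volume t]
    simp
  have hprod : Integrable (Function.uncurry fun t s : ℝ =>
      (jackson r (t - s) : ℂ) * φ s * trapKernel c k t) (volume.prod volume) := by
    -- Fubini is justified by the integrability of the convolution integrand of two integrable
    -- kernels, multiplied by the bounded function φ.
    have h1 := (Integrable.convolution_integrand (ContinuousLinearMap.mul ℝ ℝ)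
      (μ := volume) (ν := volume) (integrable_trapKernel hc k) (integrable_jackson hr)).ofReal
      (𝕜 := ℂ)
    have h2 := h1.swap.mul_bdd (g := fun z : ℝ × ℝ => φ z.2) (c := B)
      (hφ.comp measurable_snd).aestronglyMeasurable (ae_of_all _ fun z => hB _)
    refine h2.congr (ae_of_all _ fun z => ?_)
    simp only [Function.comp, Prod.swap, Function.uncurry, ContinuousLinearMap.mul_apply']
    rw [← neg_sub z.1 z.2, jackson_neg]
    push_cast
    simp only [Complex.coe_algebraMap]
    ring
  calc _ = ∫ t : ℝ, ∫ s : ℝ, (jackson r (t - s) : ℂ) * φ s * trapKernel c k t := by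
        refine integral_congr_ae (ae_of_all _ fun t => ?_)
        simp only
        rw [hsub, integral_mul_const]
    _ = ∫ s : ℝ, ∫ t : ℝ, (jackson r (t - s) : ℂ) * φ s * trapKernel c k t :=
        integral_integral_swap hprod
    _ = _ := by
        refine integral_congr_ae (ae_of_all _ fun s => ?_)
        simp only
        rw [← integral_jackson_sub_mul_trapKernel hc hr hk s, ← integral_mul_const]
        refine integral_congr_ae (ae_of_all _ fun t => ?_)
        simp only
        ring

/-- Splitting φ into remainder and Jackson convolution, the kernel reproduces the value of the
convolution at 0, a term independent of `k`. The remainder is even, so only the half-line is left,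
where the averages are controlled. -/
theorem half_integral_mul_trapKernel (H : HasAveragedModulus p w C φ) {c r : ℝ} (hc : 0 < c)
    (hr : 0 < r) {k : ℕ} (hk : 4 * r ≤ k * c) :
    1 / 2 * ∫ t : ℝ, φ t * trapKernel c k t =
      (∫ t in Set.Ioi 0, jacksonRem r φ t * trapKernel c k t) +
        1 / 2 * ∫ s : ℝ, (jackson r s : ℂ) * φ s := by
  obtain ⟨B, hB⟩ := H.bounded
  obtain ⟨B', hB'⟩ := H.bounded_jacksonRem hr
  have hm := H.measurable_jacksonRem r
  have hi1 : Integrable fun t => jacksonRem r φ t * (trapKernel c k t : ℂ) :=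
    integrable_mul_trapKernel hc k hm.aestronglyMeasurable hB'
  have hi2 : Integrable fun t => (∫ γ : ℝ, (jackson r γ : ℂ) * φ (t - γ)) *
      (trapKernel c k t : ℂ) := by
    have : (fun t => ∫ γ : ℝ, (jackson r γ : ℂ) * φ (t - γ)) = fun t => φ t - jacksonRem r φ t := by
      funext t; rw [jacksonRem, sub_sub_cancel]
    refine integrable_mul_trapKernel hc k ?_ (norm_jackson_conv_le hr hB)
    rw [this]
    exact (H.measurable.sub hm).aestronglyMeasurable
  have h1 := integral_eq_two_mul_Ioi_of_even hi1 fun t => by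
    rw [H.jacksonRem_neg, trapKernel_neg]
  rw [← H.integral_conv_mul_trapKernel hc hr hk, show ∀ z u : ℂ, z + 1 / 2 * u =
    1 / 2 * (2 * z + u) from fun z u => by ring, ← h1, ← integral_add hi1 hi2]
  congr 1
  refine integral_congr_ae (ae_of_all _ fun t => ?_)
  simp only
  rw [← add_mul, jacksonRem, sub_add_cancel]

/-- The window (jδ, (j+1)δ] is the translate by jδ of (0, δ]. The shift condition costs w(jδ) ≤ j
w(δ), and the first window itself costs w(δ). -/
theorem lintegral_window_le (H : HasAveragedModulus p w C φ) (hp : 1 ≤ p) (hw : IsModulusType w)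
    {δ : ℝ} (hδ : 0 < δ) (j : ℕ) :
    ∫⁻ t in Set.Ioc (j * δ) ((j + 1) * δ), ‖φ t‖ₑ ≤
      ENNReal.ofReal δ * (C * ENNReal.ofReal ((j + 1) * w δ)) := by
  have hp' : (1 : ℝ≥0∞) ≤ ENNReal.ofReal p := by simpa using hp
  have hw0 := hw.nonneg hδ.le
  have hφ := H.measurable
  have h0 := lintegral_le_of_eLpNorm_averageMeasure hp' hφ.aestronglyMeasurable hδ (H.modulus δ hδ)
  rw [sub_zero] at h0
  rcases Nat.eq_zero_or_pos j with rfl | hj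
  · simpa using h0
  have hj' : (0 : ℝ) < j := by exact_mod_cast hj
  have h1 := lintegral_le_of_eLpNorm_averageMeasure hp'
    (f := fun t => φ t - φ (t + j * δ)) (Measurable.aestronglyMeasurable (by fun_prop)) hδ
    (H.shift_add (j * δ) δ (by positivity) hδ)
  rw [sub_zero] at h1
  calc ∫⁻ t in Set.Ioc (j * δ) ((j + 1) * δ), ‖φ t‖ₑ
      = ∫⁻ t in Set.Ioc 0 δ, ‖φ (j * δ + t)‖ₑ := by
        rw [setLIntegral_comp_add_left (fun t => ‖φ t‖ₑ)]
        congr 3 <;> ring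
    _ ≤ ∫⁻ t in Set.Ioc 0 δ, (‖φ t‖ₑ + ‖φ t - φ (t + j * δ)‖ₑ) := by
        refine lintegral_mono fun t => ?_
        rw [add_comm (j * δ : ℝ) t]
        calc ‖φ (t + j * δ)‖ₑ = ‖φ t - (φ t - φ (t + j * δ))‖ₑ := by rw [sub_sub_cancel]
          _ ≤ _ := enorm_sub_le
    _ = (∫⁻ t in Set.Ioc 0 δ, ‖φ t‖ₑ) + ∫⁻ t in Set.Ioc 0 δ, ‖φ t - φ (t + j * δ)‖ₑ :=
        lintegral_add_left hφ.enorm _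
    _ ≤ ENNReal.ofReal δ * (C * ENNReal.ofReal (w δ)) +
          ENNReal.ofReal δ * (C * ENNReal.ofReal (w (j * δ))) := add_le_add h0 h1
    _ ≤ ENNReal.ofReal δ * (C * ENNReal.ofReal (w δ)) +
          ENNReal.ofReal δ * (C * ENNReal.ofReal (j * w δ)) := by
        gcongr
        exact hw.natCast_mul_le j hδ.le
    _ = _ := by
        rw [← mul_add, ← mul_add, ← ENNReal.ofReal_add hw0 (by positivity)]
        congr 3
        ring

/-- On the j-th window of length 1/r the kernel is O(r(1+j)⁻⁴) and φ has integral O((j+1)w(1/r)/r),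
so the contributions are O((j+1)⁻³ w(1/r)); for summation (j+1)⁻² suffices. -/
theorem exists_norm_integral_jackson_mul_le : ∃ D : ℝ, 0 ≤ D ∧ ∀ (p : ℝ) (w : ℝ → ℝ) (C : ℝ≥0)
    (φ : ℝ → ℂ), 1 ≤ p → IsModulusType w → HasAveragedModulus p w C φ → ∀ r : ℝ, 0 < r →
    ‖∫ s : ℝ, (jackson r s : ℂ) * φ s‖ ≤ D * (C * w (1 / r)) := by
  have hs0 := integral_sinc_pow_four_pos
  set c₁ := ∫ s : ℝ, Real.sinc s ^ 4 with hc₁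
  have hsum : Summable fun j : ℕ => 16 / c₁ * (1 / ((j : ℝ) + 1) ^ 2) := by
    have := (summable_nat_add_iff 1).2 (Real.summable_one_div_nat_pow.2 one_lt_two)
    refine Summable.mul_left _ (this.congr fun j => ?_)
    push_cast; ring
  set D := ∑' j : ℕ, 16 / c₁ * (1 / ((j : ℝ) + 1) ^ 2) with hD
  have hD0 : 0 ≤ D := tsum_nonneg fun j => by positivity
  refine ⟨2 * D, by positivity, fun p w C φ hp hw H r hr => ?_⟩
  have hw0 : 0 ≤ w (1 / r) := hw.nonneg (by positivity)
  have hCw : (C : ℝ≥0∞) * ENNReal.ofReal (w (1 / r)) = ENNReal.ofReal (C * w (1 / r)) := by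
    rw [ENNReal.ofReal_mul (NNReal.coe_nonneg C), ENNReal.ofReal_coe_nnreal]
  rw [integral_eq_two_mul_Ioi_of_even (integrable_jackson_mul_comp hr H.measurable H.bounded)
    (fun t => by rw [jackson_neg, H.even]), norm_mul, Complex.norm_ofNat, mul_assoc]
  gcongr
  rw [← ENNReal.ofReal_le_ofReal_iff (by positivity), ofReal_norm]
  refine (enorm_integral_le_lintegral_enorm _).trans ?_
  have hcov : Set.Ioi (0 : ℝ) ⊆ ⋃ j : ℕ, Set.Ioc (j * (1 / r)) ((j + 1) * (1 / r)) := by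
    intro t ht
    have ht' : 0 < t := ht
    have h1 : 0 < r * t := by positivity
    obtain ⟨j, hj⟩ : ∃ j : ℕ, ⌈r * t⌉₊ = j + 1 :=
      Nat.exists_eq_succ_of_ne_zero (Nat.ceil_pos.2 h1).ne'
    have h2 := Nat.le_ceil (r * t)
    have h3 := Nat.ceil_lt_add_one h1.le
    rw [hj] at h2 h3
    push_cast at h2 h3
    refine Set.mem_iUnion.2 ⟨j, ?_, ?_⟩
    · rw [mul_one_div, div_lt_iff₀ hr]; linarith
    · rw [mul_one_div, le_div_iff₀ hr]; linarith
  refine (lintegral_mono_set hcov).trans ((lintegral_iUnion_le _ _).trans ?_)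
  rw [hD, ← tsum_mul_right, ENNReal.ofReal_tsum_of_nonneg (fun j => by positivity)
    (hsum.mul_right _)]
  refine ENNReal.tsum_le_tsum fun j => ?_
  calc ∫⁻ t in Set.Ioc (j * (1 / r)) ((j + 1) * (1 / r)), ‖(jackson r t : ℂ) * φ t‖ₑ
      ≤ ∫⁻ t in Set.Ioc (j * (1 / r)) ((j + 1) * (1 / r)),
          ENNReal.ofReal (r / c₁ * (16 / (1 + j) ^ 4)) * ‖φ t‖ₑ := by
        refine setLIntegral_mono' measurableSet_Ioc fun t ht => ?_
        rw [enorm_mul, ← ofReal_norm (jackson r t : ℂ), Complex.norm_real,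
          Real.norm_of_nonneg (jackson_nonneg hr t)]
        gcongr
        refine (jackson_le hr t).trans ?_
        have ht0 : 0 ≤ t := (by positivity : (0 : ℝ) ≤ j * (1 / r)).trans ht.1.le
        have : (j : ℝ) ≤ r * |t| := by
          rw [abs_of_nonneg ht0]
          have := ht.1.le
          rw [mul_one_div, div_le_iff₀ hr] at this
          linarith
        rw [← hc₁]
        gcongr
    _ = ENNReal.ofReal (r / c₁ * (16 / (1 + j) ^ 4)) *
          ∫⁻ t in Set.Ioc (j * (1 / r)) ((j + 1) * (1 / r)), ‖φ t‖ₑ :=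
        lintegral_const_mul' _ _ ENNReal.ofReal_ne_top
    _ ≤ ENNReal.ofReal (r / c₁ * (16 / (1 + j) ^ 4)) *
          (ENNReal.ofReal (1 / r) * (C * ENNReal.ofReal ((j + 1) * w (1 / r)))) := by
        gcongr
        exact H.lintegral_window_le hp hw (by positivity) j
    _ = ENNReal.ofReal (16 / c₁ * (1 / ((j : ℝ) + 1) ^ 3) * (C * w (1 / r))) := by
        rw [ENNReal.ofReal_mul (by positivity : (0 : ℝ) ≤ j + 1), mul_left_comm (C : ℝ≥0∞), hCw,
          ← ENNReal.ofReal_mul (by positivity), ← ENNReal.ofReal_mul (by positivity),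
          ← ENNReal.ofReal_mul (by positivity)]
        congr 1
        field_simp
        ring
    _ ≤ _ := by
        gcongr ENNReal.ofReal (16 / c₁ * (1 / ?_) * (C * w (1 / r)))
        exact pow_le_pow_right₀ (by linarith [Nat.cast_nonneg (α := ℝ) j]) (by norm_num)

end HasAveragedModulus

/-! ### The block estimate for q ≥ 2 -/

/-- The block estimate for exponents `q ≥ 2`. -/
theorem exists_lqNorm_block_le {c : ℝ} (hc : 0 < c) {p : ℝ} (hp : 1 < p) (hp2 : p ≤ 2)
    {q : ℝ} (hq : 2 ≤ q) (C : ℝ≥0) : ∃ K : ℝ, 0 < K ∧ ∀ (w : ℝ → ℝ) (φ : ℝ → ℂ), IsModulusType w →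
      HasAveragedModulus p w C φ → ∀ m : ℕ, 1 ≤ m →
      (∑ k ∈ Finset.Ico (2 ^ m - 1) (2 * 2 ^ m),
        ‖1 / 2 * ∫ t : ℝ, φ t * trapKernel c k t‖ ^ q) ^ (1 / q) ≤
        K * w (Real.pi / 2 ^ m) * ((2 : ℝ) ^ m) ^ (1 / q) := by
  have hpi := Real.pi_pos
  have hq0 : 0 < q := by linarith
  obtain ⟨K, hK0, hK⟩ := exists_lqNorm_trapKernel_le hc hp hp2 hq
  obtain ⟨D, hD0, hD⟩ := HasAveragedModulus.exists_norm_integral_jackson_mul_le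
  have hM := jacksonMass_pos
  -- R compares w(1/r) with w(π/n): since 1/r = 8/(cn), it is 1 + (n/π)(1/r).
  set R : ℝ := 1 + 8 / (c * Real.pi) with hR
  have hR0 : 0 < R := by positivity
  -- The summand 1 keeps the constant positive when C = 0.
  refine ⟨(K * (jacksonMass * C) + D * C) * R + 1, by positivity, fun w φ hw H m hm => ?_⟩
  set n : ℝ := 2 ^ m with hn
  have hn2 : 2 ≤ n := by
    calc (2 : ℝ) = 2 ^ 1 := (pow_one 2).symm
      _ ≤ 2 ^ m := pow_le_pow_right₀ one_le_two hm
  have hn0 : 0 < n := by linarith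
  -- Then 4r = cn/2 ≤ kc for every k ≥ n - 1, because n ≥ 2; one Jackson kernel thus serves the
  -- whole block.
  set r := c * n / 8 with hr
  have hr0 : 0 < r := by positivity
  set A := w (Real.pi / n) with hA
  have hA0 : 0 ≤ A := hw.nonneg (by positivity)
  have hwr : w (1 / r) ≤ R * A := by
    have h1 := hw.le_one_add_mul (r := n / Real.pi) (s := 1 / r) (by positivity) (by positivity)
    rw [one_div_div n, ← hA] at h1
    refine h1.trans (le_of_eq ?_)
    rw [hr, hR]
    field_simp
  have hw0 : 0 ≤ w (1 / r) := hw.nonneg (by positivity)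
  have h1 := hK (jacksonRem r φ) (H.measurable_jacksonRem r) (H.bounded_jacksonRem hr0)
    (jacksonMass * (C * w (1 / r))) (by positivity)
    (fun δ hδ => H.integral_jacksonRem_le hp.le hw hr0 hδ) m
  have h2 := hD p w C φ hp.le hw H r hr0
  set N := 2 * 2 ^ m with hN
  set x : ℕ → ℂ := fun k => ∫ t in Set.Ioi 0, jacksonRem r φ t * trapKernel c k t with hx
  set y : ℕ → ℂ := fun _ => 1 / 2 * ∫ s : ℝ, (jackson r s : ℂ) * φ s with hy
  have hNn : (N : ℝ) = 2 * n := by rw [hN, hn]; push_cast; ring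
  have h3 : lqNorm q N y ≤ D * (C * w (1 / r)) * n ^ (1 / q) := by
    refine (lqNorm_le_of_norm_le hq0 N (M := 1 / 2 * (D * (C * w (1 / r)))) (by positivity)
      fun k _ => ?_).trans ?_
    · rw [hy, norm_mul, show ‖(1 / 2 : ℂ)‖ = 1 / 2 by norm_num]
      gcongr
    · rw [hNn]
      calc _ ≤ (2 * n ^ (1 / q)) * (1 / 2 * (D * (C * w (1 / r)))) := by
            gcongr; exact two_mul_rpow_inv_le hq hn0.le
        _ = _ := by ring
  calc _ ≤ lqNorm q N (x + y) := by
        unfold lqNorm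
        refine Real.rpow_le_rpow (Finset.sum_nonneg fun _ _ => by positivity) ?_ (by positivity)
        calc _ = ∑ k ∈ Finset.Ico (2 ^ m - 1) N, ‖(x + y) k‖ ^ q := by
              refine Finset.sum_congr rfl fun k hk => ?_
              have hk1 := (Finset.mem_Ico.1 hk).1
              have hk2 : n ≤ k + 1 := by
                rw [hn]; exact_mod_cast Nat.sub_le_iff_le_add.1 hk1
              rw [H.half_integral_mul_trapKernel hc hr0 (k := k) (by rw [hr]; nlinarith)]
              rfl
          _ ≤ _ := by
              refine Finset.sum_le_sum_of_subset_of_nonneg ?_ fun _ _ _ => by positivity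
              intro k hk
              exact Finset.mem_range.2 (Finset.mem_Ico.1 hk).2
    _ ≤ lqNorm q N x + lqNorm q N y := lqNorm_add_le (by linarith) N x y
    _ ≤ K * (jacksonMass * (C * w (1 / r))) * n ^ (1 / q) + D * (C * w (1 / r)) * n ^ (1 / q) :=
        add_le_add h1 h3
    _ = (K * (jacksonMass * C) + D * C) * w (1 / r) * n ^ (1 / q) := by ring
    _ ≤ (K * (jacksonMass * C) + D * C) * (R * A) * n ^ (1 / q) := by gcongr
    _ ≤ _ := by
        have : 0 ≤ A * n ^ (1 / q) := by positivity
        nlinarith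

/-! ### Exponential type zero and the lowest partial sums -/

/-- A half-plane bound for entire functions of exponential type zero bounded on the real axis. -/
theorem IsExpTypeBounded.norm_le_of_re_nonneg {g : ℂ → ℂ} (hg : IsExpTypeBounded 0 g) {M : ℝ}
    (hM : ∀ t : ℝ, ‖g t‖ ≤ M) {s : ℝ} (hs : |s| = 1) {ε : ℝ} (hε : 0 < ε) {z : ℂ} (hz : 0 ≤ z.re) :
    ‖g (s * Complex.I * z)‖ ≤ M * Real.exp (ε * z.re) := by
  obtain ⟨B, hB⟩ := hg.expType ε hε
  have hB0 : 0 ≤ B := by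
    have := (norm_nonneg _).trans (hB 0)
    simpa using this
  have hnorm : ∀ z : ℂ, ‖(s : ℂ) * Complex.I * z‖ = ‖z‖ := fun z => by
    rw [norm_mul, norm_mul, Complex.norm_real, Real.norm_eq_abs, hs, Complex.norm_I, one_mul, one_mul]
  have hexp : ∀ z : ℂ, ‖Complex.exp (-(ε * z))‖ = Real.exp (-(ε * z.re)) := fun z => by
    rw [Complex.norm_exp]; simp
  -- The rotation by s·i sends the imaginary axis to the real axis, where g is bounded by M. The
  -- damping factor compensates the growth e^{ε|z|}, so F is bounded on the positive real axis and
  -- Phragmén–Lindelöf applies in the right half-plane.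
  set F : ℂ → ℂ := fun z => g (s * Complex.I * z) * Complex.exp (-(ε * z)) with hF
  have hFd : Differentiable ℂ F := by
    have := hg.entire
    rw [hF]; fun_prop
  have hmain : ‖F z‖ ≤ M := by
    refine PhragmenLindelof.right_half_plane_of_bounded_on_real hFd.diffContOnCl ?_ ?_ ?_ hz
    · refine ⟨1, by norm_num, 2 * ε, ?_⟩
      refine Asymptotics.IsBigO.of_bound B (Eventually.of_forall fun z => ?_)
      rw [hF, norm_mul, hexp, Real.norm_of_nonneg (Real.exp_pos _).le, Real.rpow_one]
      calc _ ≤ B * Real.exp ((0 + ε) * ‖z‖) * Real.exp (ε * ‖z‖) := by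
            gcongr
            · rw [← hnorm z]; exact hB _
            · have := (abs_le.1 (Complex.abs_re_le_norm z)).1
              nlinarith
        _ = _ := by rw [mul_assoc, ← Real.exp_add]; ring_nf
    · refine ⟨B, eventually_map.2 ?_⟩
      filter_upwards [eventually_ge_atTop 0] with t ht
      rw [hF, norm_mul, hexp]
      calc _ ≤ B * Real.exp ((0 + ε) * t) * Real.exp (-(ε * t)) := by
            gcongr
            · have := hB (s * Complex.I * t)
              rwa [hnorm, Complex.norm_real, Real.norm_of_nonneg ht] at this
            · simp
        _ = B := by rw [mul_assoc, ← Real.exp_add]; simp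
    · intro t
      rw [hF, norm_mul, hexp]
      have e : (s : ℂ) * Complex.I * (t * Complex.I) = ((-(s * t) : ℝ) : ℂ) := by
        push_cast
        linear_combination (s : ℂ) * t * Complex.I_sq
      simp only [e]
      simpa using hM (-(s * t))
  rw [hF, norm_mul, hexp, Real.exp_neg, ← div_eq_mul_inv, div_le_iff₀ (Real.exp_pos _)] at hmain
  exact hmain

/-- Entire functions of exponential type zero that are bounded on the real axis are constant. -/
theorem IsExpTypeBounded.eq_const {g : ℂ → ℂ} (hg : IsExpTypeBounded 0 g) (z : ℂ) :
    g z = g 0 := by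
  obtain ⟨M, hM⟩ := hg.bounded
  refine hg.entire.apply_eq_apply_of_bounded (isBounded_iff_forall_norm_le.2 ⟨M, ?_⟩) z 0
  rintro _ ⟨ζ, rfl⟩
  -- The sign s is chosen so that ζ comes from the right half-plane; letting ε tend to 0 gives a
  -- global bound, and Liouville's theorem finishes.
  have key : ∀ ε : ℝ, 0 < ε → ‖g ζ‖ ≤ M * Real.exp (ε * |ζ.im|) := by
    intro ε hε
    have h : ∀ s : ℝ, |s| = 1 → s * s = 1 → 0 ≤ s * ζ.im →
        ‖g ζ‖ ≤ M * Real.exp (ε * (s * ζ.im)) := by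
      intro s hs hss hsz
      have hre : (-(s : ℂ) * Complex.I * ζ).re = s * ζ.im := by simp
      have := hg.norm_le_of_re_nonneg hM hs hε (z := -(s : ℂ) * Complex.I * ζ) (by rw [hre]; exact hsz)
      rw [hre] at this
      have e : (s : ℂ) * Complex.I * (-(s : ℂ) * Complex.I * ζ) = ζ := by
        have hss' : (s : ℂ) * s = 1 := by exact_mod_cast hss
        linear_combination (-(s : ℂ) * s * ζ) * Complex.I_sq + ζ * hss'
      rwa [e] at this
    rcases le_total 0 ζ.im with h0 | h0
    · have := h 1 (by simp) (by simp) (by simpa using h0)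
      rwa [one_mul, ← abs_of_nonneg h0] at this
    · have := h (-1) (by simp) (by simp) (by linarith)
      rwa [neg_one_mul, ← abs_of_nonpos h0] at this
  have hlim : Tendsto (fun ε : ℝ => M * Real.exp (ε * |ζ.im|)) (𝓝[>] 0)
      (𝓝 (M * Real.exp (0 * |ζ.im|))) :=
    (Continuous.tendsto (by fun_prop) 0).mono_left nhdsWithin_le_nhds
  rw [zero_mul, Real.exp_zero, mul_one] at hlim
  exact ge_of_tendsto hlim (eventually_mem_nhdsWithin.mono fun ε hε => key ε hε)

theorem setLIntegral_comp_sub_left (g : ℝ → ℝ≥0∞) (x δ : ℝ) :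
    ∫⁻ t in Set.Ioc 0 δ, g (x - t) = ∫⁻ t in Set.Ioc (x - δ) x, g t := by
  have h := (Measure.measurePreserving_sub_left (volume : Measure ℝ) x).setLIntegral_comp_preimage_emb
    (MeasurableEquiv.subLeft x).measurableEmbedding g (Set.Ico (x - δ) x)
  rw [setLIntegral_congr (Ico_ae_eq_Ioc (a := x - δ) (b := x))] at h
  rw [← h]
  have e : (fun t => x - t) ⁻¹' Set.Ico (x - δ) x = Set.Ioc 0 δ := by
    ext t
    simp only [Set.mem_preimage, Set.mem_Ico, Set.mem_Ioc]
    constructor <;> rintro ⟨h1, h2⟩ <;> constructor <;> linarith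
  rw [e]

/-- Average 2(f(x) - a) = -φ_x(t) + (f(x+t) - a) + (f(x-t) - a) over t in (0, π]: the last two terms
range over windows of length π to the right and to the left of x. In this way an averaged norm
controls the value at the single point x. -/
theorem norm_apply_sub_le {p : ℝ≥0∞} (hp : 1 ≤ p) {f : ℝ → ℂ} (hf : AEStronglyMeasurable f volume)
    {x : ℝ} {W ε : ℝ} (hW : 0 ≤ W) (hε : 0 ≤ ε) (a : ℂ)
    (hmod : eLpNorm (symmDiff₂ f x) p (averageMeasure 0 Real.pi) ≤ ENNReal.ofReal W)
    (hst : stepanovNorm p (fun t => f t - a) ≤ ENNReal.ofReal ε) : ‖f x - a‖ ≤ W + ε := by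
  have hpi := Real.pi_pos
  have hfa : AEStronglyMeasurable (fun t => f t - a) volume := hf.sub aestronglyMeasurable_const
  have hfx1 : AEStronglyMeasurable (fun t => f (x + t)) volume :=
    aestronglyMeasurable_comp_add_left hf x
  have hfx2 : AEStronglyMeasurable (fun t => f (x - t)) volume :=
    hf.comp_measurePreserving (Measure.measurePreserving_sub_left volume x)
  have hφ : AEStronglyMeasurable (symmDiff₂ f x) volume :=
    (hfx1.add hfx2).sub aestronglyMeasurable_const
  have h1 := lintegral_le_of_eLpNorm_averageMeasure hp hφ hpi hmod
  rw [sub_zero, ← ENNReal.ofReal_mul hpi.le] at h1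
  have hwin := lintegral_window_le hp hfa hst
  have h2 : ∫⁻ t in Set.Ioc 0 Real.pi, ‖f (x + t) - a‖ₑ ≤ ENNReal.ofReal (Real.pi * ε) := by
    rw [setLIntegral_comp_add_left (fun t => ‖f t - a‖ₑ), add_zero]; exact hwin x
  have h3 : ∫⁻ t in Set.Ioc 0 Real.pi, ‖f (x - t) - a‖ₑ ≤ ENNReal.ofReal (Real.pi * ε) := by
    rw [setLIntegral_comp_sub_left (fun t => ‖f t - a‖ₑ)]
    have := hwin (x - Real.pi)
    rwa [sub_add_cancel] at this
  have h4 : ENNReal.ofReal (Real.pi * (2 * ‖f x - a‖)) ≤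
      ENNReal.ofReal (Real.pi * W + Real.pi * ε + Real.pi * ε) := by
    calc ENNReal.ofReal (Real.pi * (2 * ‖f x - a‖))
        = ∫⁻ t in Set.Ioc 0 Real.pi, ENNReal.ofReal (2 * ‖f x - a‖) := by
          rw [setLIntegral_const, Real.volume_Ioc, sub_zero, ENNReal.ofReal_mul hpi.le, mul_comm]
      _ ≤ ∫⁻ t in Set.Ioc 0 Real.pi,
            (‖symmDiff₂ f x t‖ₑ + ‖f (x + t) - a‖ₑ + ‖f (x - t) - a‖ₑ) := by
          refine lintegral_mono fun t => ?_
          have e : 2 * (f x - a) =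
              -symmDiff₂ f x t + (f (x + t) - a) + (f (x - t) - a) := by
            rw [symmDiff₂]; ring
          have e2 : ENNReal.ofReal (2 * ‖f x - a‖) = ‖2 * (f x - a)‖ₑ := by
            rw [← ofReal_norm, norm_mul, Complex.norm_ofNat]
          rw [e2, e]
          refine (enorm_add_le _ _).trans ?_
          gcongr
          refine (enorm_add_le _ _).trans ?_
          rw [enorm_neg]
      _ = (∫⁻ t in Set.Ioc 0 Real.pi, ‖symmDiff₂ f x t‖ₑ) +
            (∫⁻ t in Set.Ioc 0 Real.pi, ‖f (x + t) - a‖ₑ) +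
            ∫⁻ t in Set.Ioc 0 Real.pi, ‖f (x - t) - a‖ₑ := by
          rw [lintegral_add_left', lintegral_add_left']
          · exact hφ.enorm.restrict
          · exact hφ.enorm.restrict.add (hfx1.sub aestronglyMeasurable_const).enorm.restrict
      _ ≤ _ := by
          rw [ENNReal.ofReal_add (by positivity) (by positivity),
            ENNReal.ofReal_add (by positivity) (by positivity)]
          gcongr
  rw [ENNReal.ofReal_le_ofReal_iff (by positivity)] at h4
  have h5 : 2 * ‖f x - a‖ ≤ W + ε + ε := by
    refine le_of_mul_le_mul_left ?_ hpi
    linarith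
  linarith [norm_nonneg (f x - a)]

theorem trigPoly_singleton_zero (a : ℂ) (t : ℝ) : trigPoly {0} (fun _ => a) t = a := by
  simp [trigPoly]

/-- Few exponents lie in a short interval around the origin. -/
theorem MemOmega.exists_exponents {α : ℝ} {p : ℝ≥0∞} {f : ℝ → ℂ}
    (hf : MemOmega α p f) {γ : ℝ} (hγ0 : 0 ≤ γ) (hγ : γ ≤ α / 2) :
    ∃ s : Finset ℝ, s.card ≤ 3 ∧ 0 ∈ s ∧ (∀ μ ∈ s, |μ| ≤ γ) ∧
      ∀ μ, |μ| ≤ γ → apCoeff f μ ≠ 0 → μ ∈ s := by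
  by_cases h : ∃ ν ∈ posExponents f, ν ≤ γ
  · obtain ⟨ν, hν, hνγ⟩ := h
    have hν0 := hν.1
    refine ⟨{0, ν, -ν}, Finset.card_le_three, by simp, ?_, ?_⟩
    · intro μ hμ
      simp only [Finset.mem_insert, Finset.mem_singleton] at hμ
      rcases hμ with rfl | rfl | rfl
      · simpa using hγ0
      · rwa [abs_of_pos hν0]
      · rwa [abs_neg, abs_of_pos hν0]
    · intro μ hμγ hμ
      simp only [Finset.mem_insert, Finset.mem_singleton]
      rcases eq_or_ne μ 0 with h0 | h0
      · exact Or.inl h0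
      right
      have h1 := abs_mem_posExponents h0 hμ
      have h2 : |μ| = ν := by
        rcases lt_trichotomy |μ| ν with h3 | h3 | h3
        · have := hf.gap _ h1 _ hν h3
          linarith [abs_pos.2 h0]
        · exact h3
        · have := hf.gap _ hν _ h1 h3
          linarith
      rcases abs_choice μ with h3 | h3
      · left; linarith
      · right; linarith
  · push Not at h
    refine ⟨{0}, by simp, by simp, by simpa using hγ0, fun μ hμγ hμ => ?_⟩
    by_contra h0
    have := h _ (abs_mem_posExponents (by simpa using h0) hμ)
    linarith

/-- The estimate of the lowest partial sums by the best approximation by constants. -/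
theorem MemOmegaAt.enorm_apPartialSum_sub_le {α : ℝ} {p : ℝ≥0∞} (hp : 1 ≤ p)
    {w : ℝ → ℝ} (hw : IsModulusType w) {x : ℝ} {C : ℝ≥0} {f : ℝ → ℂ} (hf : MemOmegaAt α p w x C f)
    {γ : ℝ} (hγ0 : 0 ≤ γ) (hγ : γ ≤ α / 2) :
    ‖apPartialSum f γ x - f x‖ₑ ≤
      (C + 4 : ℝ≥0) * (ENNReal.ofReal (w Real.pi) + bestApprox p 0 f) := by
  have hpi := Real.pi_pos
  have hw0 := hw.nonneg hpi.le
  have hΩ := hf.memOmega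
  have hap := hΩ.isStepanovAP
  have hC4 : ((C + 4 : ℝ≥0) : ℝ≥0∞) ≠ 0 := by
    have : (0 : ℝ≥0) < C + 4 := by positivity
    exact_mod_cast this.ne'
  -- With the infimum outside, each competitor is treated separately; for g outside the class the
  -- inner infimum is ∞.
  rw [bestApprox, ENNReal.add_iInf, ENNReal.mul_iInf_of_ne hC4 ENNReal.coe_ne_top]
  refine le_iInf fun g => ?_
  by_cases hg : IsExpTypeBounded 0 g
  swap
  · simp [hg]
  rw [iInf_pos hg]
  set a := g 0 with ha
  have hga : (fun t : ℝ => f t - g t) = fun t => f t - a := by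
    funext t; rw [hg.eq_const]
  rw [hga]
  rcases eq_or_ne (stepanovNorm p fun t => f t - a) ∞ with htop | htop
  · rw [htop, add_top, ENNReal.mul_top hC4]; exact le_top
  set ε := (stepanovNorm p fun t => f t - a).toReal with hε
  have hε0 : 0 ≤ ε := ENNReal.toReal_nonneg
  have hst : stepanovNorm p (fun t => f t - a) = ENNReal.ofReal ε := (ENNReal.ofReal_toReal htop).symm
  obtain ⟨B, hB⟩ := hΩ.bounded
  have hl := locallyIntegrable_of_bounded hap.aestronglyMeasurable hB
  -- The constant a is a trigonometric polynomial with the single frequency 0, so each coefficient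
  -- is within ε of its own. At most three frequencies occur, which gives 3ε for the partial sum and
  -- C + 4 in all.
  have hcoef : ∀ μ, ‖apCoeff f μ - if μ ∈ ({0} : Finset ℝ) then a else 0‖ ≤ ε := fun μ =>
    norm_apCoeff_sub_le hp hap hl {0} (fun _ => a) hε0 (by
      simp_rw [trigPoly_singleton_zero]; exact hst.le) μ
  have hfx : ‖f x - a‖ ≤ C * w Real.pi + ε := by
    refine norm_apply_sub_le hp hap.aestronglyMeasurable (by positivity) hε0 a ?_ hst.le
    refine (hf.modulus Real.pi hpi).trans (le_of_eq ?_)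
    rw [ENNReal.ofReal_mul (NNReal.coe_nonneg C), ENNReal.ofReal_coe_nnreal]
  obtain ⟨s, hcard, h0s, hsγ, hsall⟩ := hΩ.exists_exponents hγ0 hγ
  have hS : ‖apPartialSum f γ x - a‖ ≤ 3 * ε := by
    have ha' : a = ∑ μ ∈ s, (if μ ∈ ({0} : Finset ℝ) then a else 0) *
        Complex.exp (Complex.I * μ * x) := by
      simp [ite_mul, h0s]
    rw [apPartialSum_eq_trigPoly hsγ hsall, trigPoly]
    conv_lhs => rw [ha', ← Finset.sum_sub_distrib]
    calc _ ≤ ∑ μ ∈ s, ε := by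
          refine norm_sum_le_of_le _ fun μ _ => ?_
          rw [← sub_mul, norm_mul, norm_exp_I_mul_mul, mul_one]
          exact hcoef μ
      _ = s.card * ε := by simp
      _ ≤ 3 * ε := by gcongr; exact_mod_cast hcard
  have hfin : ‖apPartialSum f γ x - f x‖ ≤ (C + 4) * (w Real.pi + ε) := by
    have e : apPartialSum f γ x - f x = (apPartialSum f γ x - a) - (f x - a) := by ring
    rw [e]
    refine (norm_sub_le_of_le hS hfx).trans ?_
    have : 0 ≤ (C : ℝ) * ε := by positivity
    linarith
  rw [hst, ← ofReal_norm, ← ENNReal.ofReal_add hw0 hε0, ← ENNReal.ofReal_coe_nnreal,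
    ← ENNReal.ofReal_mul (NNReal.coe_nonneg _)]
  exact ENNReal.ofReal_le_ofReal (by push_cast; exact hfin)

/-! ### From the class to averaged moduli and to convolutions -/

theorem exists_measurable_bounded_ae_eq {f : ℝ → ℂ} (hf : AEStronglyMeasurable f volume) {B : ℝ}
    (hB : ∀ t, ‖f t‖ ≤ B) : ∃ g : ℝ → ℂ, Measurable g ∧ (∀ t, ‖g t‖ ≤ B) ∧ g =ᵐ[volume] f := by
  have hB0 : 0 ≤ B := (norm_nonneg _).trans (hB 0)
  have hm := hf.stronglyMeasurable_mk.measurable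
  refine ⟨{t | ‖hf.mk f t‖ ≤ B}.indicator (hf.mk f),
    hm.indicator (measurableSet_le hm.norm measurable_const), fun t => ?_, ?_⟩
  · by_cases ht : t ∈ {t | ‖hf.mk f t‖ ≤ B}
    · rw [Set.indicator_of_mem ht]; exact ht
    · rw [Set.indicator_of_notMem ht]; simpa using hB0
  · filter_upwards [hf.ae_eq_mk] with t ht
    have : t ∈ {t | ‖hf.mk f t‖ ≤ B} := by
      change ‖hf.mk f t‖ ≤ B
      rw [← ht]; exact hB t
    rw [Set.indicator_of_mem this, ht]

theorem ae_eq_symmDiff₂ {f g : ℝ → ℂ} (h : g =ᵐ[volume] f) (x : ℝ) :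
    (fun t => g (x + t) + g (x - t) - 2 * f x) =ᵐ[volume] symmDiff₂ f x := by
  have h1 := (measurePreserving_add_left volume x).quasiMeasurePreserving.ae_eq h
  have h2 := (Measure.measurePreserving_sub_left volume x).quasiMeasurePreserving.ae_eq h
  filter_upwards [h1, h2] with t ht1 ht2
  simp only [Function.comp] at ht1 ht2
  rw [symmDiff₂, ht1, ht2]

/-- The second symmetric difference has a representative with the averaged smoothness
estimates. -/
theorem MemOmegaAt.exists_hasAveragedModulus {α : ℝ} {p : ℝ≥0∞} {w : ℝ → ℝ} {x : ℝ} {C : ℝ≥0}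
    {f : ℝ → ℂ} (hf : MemOmegaAt α p w x C f) {p' : ℝ} (hp : ENNReal.ofReal p' ≤ p) :
    ∃ φ : ℝ → ℂ, HasAveragedModulus p' w C φ ∧ φ =ᵐ[volume] symmDiff₂ f x := by
  obtain ⟨B, hB⟩ := hf.memOmega.bounded
  obtain ⟨g, hg, hgB, hgf⟩ := exists_measurable_bounded_ae_eq
    hf.memOmega.isStepanovAP.aestronglyMeasurable hB
  -- Only the translates are replaced by the measurable representative; the term 2f(x) keeps the
  -- true value of f at x.
  set φ : ℝ → ℂ := fun t => g (x + t) + g (x - t) - 2 * f x with hφ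
  have hφm : Measurable φ := by rw [hφ]; fun_prop
  have hae : φ =ᵐ[volume] symmDiff₂ f x := ae_eq_symmDiff₂ hgf x
  have lower : ∀ (u v : ℝ → ℂ) (δ : ℝ) (A : ℝ≥0∞), 0 < δ → Measurable u → u =ᵐ[volume] v →
      eLpNorm v p (averageMeasure 0 δ) ≤ A →
      eLpNorm u (ENNReal.ofReal p') (averageMeasure 0 δ) ≤ A := by
    intro u v δ A hδ hu huv hA
    have := isProbabilityMeasure_averageMeasure hδ
    refine (eLpNorm_le_eLpNorm_of_exponent_le hp hu.aestronglyMeasurable).trans ?_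
    rwa [eLpNorm_congr_ae (averageMeasure_absolutelyContinuous.ae_le huv)]
  refine ⟨φ, ⟨hφm, ⟨B + B + ‖2 * f x‖, fun t => ?_⟩, fun t => ?_, fun γ δ hγ hδ => ?_,
    fun γ δ hγ hδ => ?_, fun δ hδ => lower _ _ _ _ hδ hφm hae (hf.modulus δ hδ)⟩, hae⟩
  · exact norm_sub_le_of_le (norm_add_le_of_le (hgB _) (hgB _)) le_rfl
  · simp only [hφ, sub_neg_eq_add, ← sub_eq_add_neg]
    ring
  · refine lower _ _ _ _ hδ (by fun_prop) ?_ (hf.shift_add γ δ hγ hδ)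
    exact hae.sub ((measurePreserving_add_right volume γ).quasiMeasurePreserving.ae_eq hae)
  · refine lower _ _ _ _ hδ (by fun_prop) ?_ (hf.shift_sub γ δ hγ hδ)
    exact hae.sub ((measurePreserving_sub_right volume γ).quasiMeasurePreserving.ae_eq hae)

/-- Since the kernel is even, f(x+t) and f(x-t) have the same integral against it; since its
integral is 1, f(x) can be moved under the integral sign. -/
theorem trapConv_sub_apply {c : ℝ} (hc : 0 < c) (k : ℕ) {f : ℝ → ℂ}
    (hf : AEStronglyMeasurable f volume) {B : ℝ} (hB : ∀ t, ‖f t‖ ≤ B) {x : ℝ} {φ : ℝ → ℂ}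
    (hφ : φ =ᵐ[volume] symmDiff₂ f x) :
    trapConv c k f x - f x = 1 / 2 * ∫ t : ℝ, φ t * trapKernel c k t := by
  have h1 : ∫ t : ℝ, (trapKernel c k t : ℂ) = 1 := by
    have := integral_trapKernel_mul_exp_of_le hc k (μ := 0) (by simp; positivity)
    simpa using this
  have hi1 : Integrable fun t => f (x + t) * (trapKernel c k t : ℂ) :=
    integrable_mul_trapKernel hc k (aestronglyMeasurable_comp_add_left hf x) fun t => hB _
  have hi2 : Integrable fun t => f (x - t) * (trapKernel c k t : ℂ) :=
    integrable_mul_trapKernel hc k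
      (hf.comp_measurePreserving (Measure.measurePreserving_sub_left volume x)) fun t => hB _
  have hi3 : Integrable fun t => 2 * f x * (trapKernel c k t : ℂ) :=
    (integrable_trapKernel hc k).ofReal.const_mul _
  have h2 : ∫ t : ℝ, f (x - t) * (trapKernel c k t : ℂ) = trapConv c k f x := by
    rw [trapConv, ← integral_neg_eq_self]
    refine integral_congr_ae (ae_of_all _ fun t => ?_)
    simp only [trapKernel_neg, sub_neg_eq_add]
  have h3 : ∫ t : ℝ, φ t * trapKernel c k t = ∫ t : ℝ, (f (x + t) * (trapKernel c k t : ℂ) +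
      f (x - t) * (trapKernel c k t : ℂ) - 2 * f x * (trapKernel c k t : ℂ)) := by
    refine integral_congr_ae ?_
    filter_upwards [hφ] with t ht
    rw [ht, symmDiff₂]
    ring
  have hi12 : Integrable fun t => f (x + t) * (trapKernel c k t : ℂ) +
      f (x - t) * (trapKernel c k t : ℂ) := hi1.add hi2
  rw [h3, integral_sub hi12 hi3, integral_add hi1 hi2, h2, integral_const_mul, h1]
  change _ = 1 / 2 * (trapConv c k f x + trapConv c k f x - _)
  ring

/-- Each partial sum is one of two consecutive convolutions with trapezoidal kernels. -/
theorem MemOmega.apPartialSum_eq_or {α : ℝ} (hα : 0 < α) {p : ℝ≥0∞} (hp : 1 ≤ p) {f : ℝ → ℂ}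
    (hf : MemOmega α p f) (x : ℝ) (k : ℕ) :
    apPartialSum f (α * ((k + 1 : ℕ) : ℝ) / 2) x = trapConv (α / 2) (k + 1) f x ∨
      apPartialSum f (α * ((k + 1 : ℕ) : ℝ) / 2) x = trapConv (α / 2) k f x := by
  have hc : 0 < α / 2 := by positivity
  have hfin : ∀ k : ℕ, {μ : ℝ | |μ| ≤ k * (α / 2) ∧ apCoeff f μ ≠ 0}.Finite := fun k =>
    hf.finite_exponents hα _
  have hk0 : (0 : ℝ) ≤ k * (α / 2) := by positivity
  rw [show α * ((k + 1 : ℕ) : ℝ) / 2 = ((k + 1 : ℕ) : ℝ) * (α / 2) by ring]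
  -- With c = α/2: if no exponent lies in ((k+1)c, (k+2)c), the trapezoid of index k+1 works.
  -- Otherwise an exponent ν there excludes all others within 2c, in particular from (kc, (k+1)c];
  -- the partial sums at kc and (k+1)c agree and the index k works.
  by_cases h : ∃ ν ∈ posExponents f, (k + 1 : ℝ) * (α / 2) < ν ∧ ν < (k + 2) * (α / 2)
  · right
    obtain ⟨ν, hν, hν1, hν2⟩ := h
    have hno : ∀ μ : ℝ, k * (α / 2) < |μ| → |μ| ≤ (k + 1) * (α / 2) → apCoeff f μ = 0 := by
      intro μ h1 h2
      by_contra h3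
      have hμ0 : μ ≠ 0 := by
        rintro rfl
        rw [abs_zero] at h1
        linarith
      have := hf.gap _ (abs_mem_posExponents hμ0 h3) _ hν (by linarith)
      linarith
    rw [← apPartialSum_eq_trapConv hc k hp hf.isStepanovAP hf.bounded (hfin k)
      (fun μ h1 h2 => hno μ h1 h2.le),
      apPartialSum_eq_trigPoly (s := (hfin k).toFinset) (γ := k * (α / 2)),
      apPartialSum_eq_trigPoly (s := (hfin k).toFinset)]
    · intro μ hμ
      have := ((hfin k).mem_toFinset.1 hμ).1
      push_cast
      linarith
    · intro μ h1 h2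
      refine (hfin k).mem_toFinset.2 ⟨?_, h2⟩
      by_contra! h3
      push_cast at h1
      exact h2 (hno μ h3 h1)
    · exact fun μ hμ => ((hfin k).mem_toFinset.1 hμ).1
    · exact fun μ h1 h2 => (hfin k).mem_toFinset.2 ⟨h1, h2⟩
  · left
    refine apPartialSum_eq_trapConv hc (k + 1) hp hf.isStepanovAP hf.bounded (hfin (k + 1)) ?_ x
    intro μ h1 h2
    by_contra h3
    push_cast at h1 h2
    have hμ0 : μ ≠ 0 := by
      rintro rfl
      rw [abs_zero] at h1
      linarith
    exact h ⟨|μ|, abs_mem_posExponents hμ0 h3, h1, by linarith⟩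

/-! ### Dyadic blocks for all exponents -/

/-- The power mean inequality over a block of n indices; it transfers the block estimate from max(q,
2) to q. -/
theorem sum_rpow_le_of_sum_rpow_le {ι : Type*} (s : Finset ι) {x : ι → ℝ} (hx : ∀ i, 0 ≤ x i)
    {q q' : ℝ} (hq : 0 < q) (hqq : q ≤ q') {n A : ℝ} (hn : 0 < n) (hcard : (s.card : ℝ) = n)
    (hA : 0 ≤ A) (h : ∑ i ∈ s, x i ^ q' ≤ A ^ q' * n) : ∑ i ∈ s, x i ^ q ≤ A ^ q * n := by
  have hq' : 0 < q' := hq.trans_le hqq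
  have hr : 1 ≤ q' / q := by rwa [le_div_iff₀ hq, one_mul]
  have h1 := Real.rpow_sum_le_const_mul_sum_rpow s (fun i => x i ^ q) hr
  have hnn : ∀ i, 0 ≤ x i ^ q := fun i => Real.rpow_nonneg (hx i) q
  have e : ∀ i, |x i ^ q| ^ (q' / q) = x i ^ q' := fun i => by
    rw [abs_of_nonneg (hnn i), ← Real.rpow_mul (hx i), mul_div_cancel₀ _ hq.ne']
  simp_rw [e, abs_of_nonneg (hnn _), hcard] at h1
  have h2 : (∑ i ∈ s, x i ^ q) ^ (q' / q) ≤ (A ^ q * n) ^ (q' / q) := by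
    refine h1.trans ?_
    calc n ^ (q' / q - 1) * ∑ i ∈ s, x i ^ q' ≤ n ^ (q' / q - 1) * (A ^ q' * n) := by gcongr
      _ = _ := by
          rw [Real.mul_rpow (by positivity) hn.le, ← Real.rpow_mul hA, mul_div_cancel₀ _ hq.ne',
            Real.rpow_sub_one hn.ne']
          field_simp
  exact (Real.rpow_le_rpow_iff (Finset.sum_nonneg fun i _ => hnn i) (by positivity)
    (by positivity)).1 h2

/-- The estimate of the deviations of the partial sums over a dyadic block. -/
theorem exists_sum_block_le {α : ℝ} (hα : 0 < α) {p : ℝ≥0∞} (hp : 1 < p) {q : ℝ} (hq : 0 < q)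
    (C : ℝ≥0) : ∃ K : ℝ, 0 < K ∧ ∀ (x : ℝ) (w : ℝ → ℝ) (f : ℝ → ℂ), IsModulusType w →
      MemOmegaAt α p w x C f → ∀ m : ℕ, 1 ≤ m →
      ∑ k ∈ Finset.Ico (2 ^ m : ℕ) (2 ^ (m + 1)),
        ‖apPartialSum f (α * (k : ℝ) / 2) x - f x‖ ^ q ≤
          (K * w (Real.pi / 2 ^ m)) ^ q * 2 ^ m := by
  have hpi := Real.pi_pos
  have hp2 : min p 2 ≠ ∞ := ne_top_of_le_ne_top (by simp) (min_le_right p 2)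
  -- Averages over (0, δ] are taken with respect to a probability measure, so the hypotheses for p
  -- imply those for min(p, 2), which is finite and lies in (1, 2].
  set p' := (min p 2).toReal with hp'
  have hp'e : ENNReal.ofReal p' = min p 2 := ENNReal.ofReal_toReal hp2
  have hp'1 : 1 < p' := by
    rw [← ENNReal.ofReal_lt_ofReal_iff_of_nonneg zero_le_one, hp'e, ENNReal.ofReal_one]
    exact lt_min hp (by norm_num)
  have hp'2 : p' ≤ 2 := by
    rw [← ENNReal.ofReal_le_ofReal_iff (by norm_num), hp'e]
    exact (min_le_right p 2).trans (by simp)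
  set q' := max q 2 with hq'
  have hq'2 : 2 ≤ q' := le_max_right _ _
  have hq'0 : 0 < q' := by linarith
  have hc : 0 < α / 2 := by positivity
  obtain ⟨K, hK0, hK⟩ := exists_lqNorm_block_le hc hp'1 hp'2 hq'2 C
  refine ⟨2 * K, by positivity, fun x w f hw hf m hm => ?_⟩
  obtain ⟨φ, hφ, hφe⟩ := hf.exists_hasAveragedModulus (p' := p') (hp'e.le.trans (min_le_left _ _))
  obtain ⟨B, hB⟩ := hf.memOmega.bounded
  have hw0 : 0 ≤ w (Real.pi / 2 ^ m) := hw.nonneg (by positivity)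
  set D : ℕ → ℝ := fun k => ‖1 / 2 * ∫ t : ℝ, φ t * trapKernel (α / 2) k t‖ with hD
  have hDf : ∀ k, ‖trapConv (α / 2) k f x - f x‖ = D k := fun k => by
    rw [trapConv_sub_apply hc k hf.memOmega.isStepanovAP.aestronglyMeasurable hB hφe]
  have hD0 : ∀ k, 0 ≤ D k := fun k => norm_nonneg _
  have h1 := hK w φ hw hφ m hm
  have hblock : ∑ k ∈ Finset.Ico (2 ^ m - 1) (2 * 2 ^ m), D k ^ q' ≤
      (K * w (Real.pi / 2 ^ m)) ^ q' * 2 ^ m := by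
    have h2 := Real.rpow_le_rpow
      (Real.rpow_nonneg (Finset.sum_nonneg fun _ _ => Real.rpow_nonneg (norm_nonneg _) _) _)
      h1 hq'0.le
    rw [← Real.rpow_mul (Finset.sum_nonneg fun _ _ => Real.rpow_nonneg (norm_nonneg _) _),
      one_div_mul_cancel hq'0.ne', Real.rpow_one,
      Real.mul_rpow (by positivity) (by positivity), ← Real.rpow_mul (by positivity),
      one_div_mul_cancel hq'0.ne', Real.rpow_one] at h2
    exact h2
  refine sum_rpow_le_of_sum_rpow_le _ (fun k => norm_nonneg _) hq (le_max_left q 2)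
    (by positivity) ?_ (by positivity) ?_
  · rw [Nat.card_Ico, pow_succ, mul_two, Nat.add_sub_cancel]; push_cast; rfl
  -- Which of the two kernels represents the partial sum depends on k, so both deviations are added.
  -- The index k - 1 is the reason why the block for the kernels starts at 2^m - 1.
  have hstep : ∀ k ∈ Finset.Ico (2 ^ m : ℕ) (2 ^ (m + 1)),
      ‖apPartialSum f (α * (k : ℝ) / 2) x - f x‖ ^ q' ≤ D k ^ q' + D (k - 1) ^ q' := by
    intro k hk
    have hk1 : k ≠ 0 := by
      have := (Finset.mem_Ico.1 hk).1
      have := Nat.one_le_two_pow (n := m)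
      omega
    obtain ⟨j, rfl⟩ := Nat.exists_eq_succ_of_ne_zero hk1
    have h3 : 0 ≤ D (j + 1) ^ q' := Real.rpow_nonneg (hD0 _) _
    have h4 : 0 ≤ D j ^ q' := Real.rpow_nonneg (hD0 _) _
    simp only [Nat.succ_eq_add_one, Nat.add_sub_cancel]
    rcases hf.memOmega.apPartialSum_eq_or hα hp.le x j with h | h
    · rw [h, hDf]; linarith
    · rw [h, hDf]; linarith
  calc _ ≤ ∑ k ∈ Finset.Ico (2 ^ m) (2 ^ (m + 1)), (D k ^ q' + D (k - 1) ^ q') :=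
        Finset.sum_le_sum hstep
    _ = ∑ k ∈ Finset.Ico (2 ^ m) (2 ^ (m + 1)), D k ^ q' +
          ∑ k ∈ Finset.Ico (2 ^ m) (2 ^ (m + 1)), D (k - 1) ^ q' := Finset.sum_add_distrib
    _ ≤ ∑ k ∈ Finset.Ico (2 ^ m - 1) (2 * 2 ^ m), D k ^ q' +
          ∑ k ∈ Finset.Ico (2 ^ m - 1) (2 * 2 ^ m), D k ^ q' := by
        have hpow : 2 ^ (m + 1) = 2 * 2 ^ m := pow_succ' 2 m
        have hone := Nat.one_le_two_pow (n := m)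
        refine add_le_add ?_ ?_
        · refine Finset.sum_le_sum_of_subset_of_nonneg ?_
            fun _ _ _ => Real.rpow_nonneg (hD0 _) _
          intro k hk
          rw [Finset.mem_Ico] at hk ⊢
          omega
        · rw [← Finset.sum_image (f := fun k => D k ^ q') (g := fun k => k - 1)]
          · refine Finset.sum_le_sum_of_subset_of_nonneg ?_
              fun _ _ _ => Real.rpow_nonneg (hD0 _) _
            intro k hk
            obtain ⟨j, hj, rfl⟩ := Finset.mem_image.1 hk
            rw [Finset.mem_Ico] at hj ⊢
            omega
          · intro a ha b hb hab
            have ha' := Finset.mem_Ico.1 ha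
            have hb' := Finset.mem_Ico.1 hb
            simp only at hab
            omega
    _ ≤ 2 * ((K * w (Real.pi / 2 ^ m)) ^ q' * 2 ^ m) := by linarith
    _ ≤ 2 ^ q' * ((K * w (Real.pi / 2 ^ m)) ^ q' * 2 ^ m) := by
        gcongr
        calc (2 : ℝ) = 2 ^ (1 : ℝ) := (Real.rpow_one 2).symm
          _ ≤ 2 ^ q' := Real.rpow_le_rpow_of_exponent_le one_le_two (by linarith)
    _ = _ := by
        rw [← mul_assoc, ← Real.mul_rpow (by norm_num) (by positivity), mul_assoc 2 K]

/-! ### Summation over blocks and the theorem -/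

/-- Summation of dyadic block estimates with nonincreasing weights. -/
theorem tsum_mul_le_of_block_le {a x R : ℕ → ℝ≥0∞} (ha : Antitone a) (hR : Antitone R) {K : ℝ≥0∞}
    (h0 : x 0 ≤ K * R 0) (h1 : x 1 ≤ K * R 0)
    (hblock : ∀ m, 1 ≤ m → ∑ k ∈ Finset.Ico (2 ^ m) (2 ^ (m + 1)), x k ≤ K * R (2 ^ m - 1) * 2 ^ m) :
    ∑' k, a k * x k ≤ 4 * K * ∑' k, a k * R k := by
  have hpart : ∀ N : ℕ, ∑ k ∈ Finset.range (2 ^ (N + 1)), a k * x k ≤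
      2 * K * (a 0 * R 0) + 2 * K * ∑ k ∈ Finset.range (2 ^ N), a k * R k := by
    intro N
    induction N with
    | zero =>
      refine le_trans ?_ (self_le_add_right _ _)
      simp only [zero_add, pow_one, Finset.sum_range_succ, Finset.sum_range_zero]
      calc a 0 * x 0 + a 1 * x 1 ≤ a 0 * (K * R 0) + a 0 * (K * R 0) := by
            gcongr
            exact ha zero_le_one
        _ = _ := by ring
    | succ N ih =>
      rw [← Finset.sum_range_add_sum_Ico _ (Nat.pow_le_pow_right two_pos (Nat.le_succ (N + 1))),
        ← Finset.sum_range_add_sum_Ico (fun k => a k * R k)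
          (Nat.pow_le_pow_right two_pos (Nat.le_succ N)), mul_add, ← add_assoc]
      refine add_le_add ih ?_
      calc ∑ k ∈ Finset.Ico (2 ^ (N + 1)) (2 ^ (N + 1).succ), a k * x k
          ≤ ∑ k ∈ Finset.Ico (2 ^ (N + 1)) (2 ^ (N + 1).succ), a (2 ^ (N + 1)) * x k := by
            refine Finset.sum_le_sum fun k hk => ?_
            gcongr
            exact ha (Finset.mem_Ico.1 hk).1
        _ = a (2 ^ (N + 1)) * ∑ k ∈ Finset.Ico (2 ^ (N + 1)) (2 ^ (N + 1 + 1)), x k := by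
            rw [Finset.mul_sum]
        _ ≤ a (2 ^ (N + 1)) * (K * R (2 ^ (N + 1) - 1) * 2 ^ (N + 1)) := by
            gcongr
            exact hblock (N + 1) (Nat.le_add_left 1 N)
        -- The factor 2^(N+1) is twice the number of indices in the preceding block, on which both
        -- `a` and `R` are at least as large as at 2^(N+1) and 2^(N+1) - 1 respectively.
        _ = 2 * K * ∑ k ∈ Finset.Ico (2 ^ N) (2 ^ N.succ), a (2 ^ (N + 1)) * R (2 ^ (N + 1) - 1) := by
            rw [Finset.sum_const, Nat.card_Ico, Nat.succ_eq_add_one, pow_succ, mul_two,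
              Nat.add_sub_cancel, nsmul_eq_mul]
            push_cast
            ring
        _ ≤ 2 * K * ∑ k ∈ Finset.Ico (2 ^ N) (2 ^ N.succ), a k * R k := by
            gcongr with k hk
            · exact ha (Finset.mem_Ico.1 hk).2.le
            · exact hR (Nat.le_sub_one_of_lt (Finset.mem_Ico.1 hk).2)
  refine ENNReal.tsum_le_of_sum_range_le fun n => ?_
  have hn : n ≤ 2 ^ (n + 1) := (Nat.lt_two_pow_self (n := n)).le.trans
    (Nat.pow_le_pow_right two_pos (Nat.le_succ n))
  calc ∑ k ∈ Finset.range n, a k * x k ≤ ∑ k ∈ Finset.range (2 ^ (n + 1)), a k * x k :=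
        Finset.sum_le_sum_of_subset (Finset.range_mono hn)
    _ ≤ _ := hpart n
    _ ≤ 2 * K * (∑' k, a k * R k) + 2 * K * ∑' k, a k * R k := by
        gcongr
        · exact ENNReal.le_tsum (f := fun k => a k * R k) 0
        · exact ENNReal.sum_le_tsum _
    _ = _ := by ring

theorem IsExpTypeBounded.mono {σ σ' : ℝ} (h : σ ≤ σ') {g : ℂ → ℂ} (hg : IsExpTypeBounded σ g) :
    IsExpTypeBounded σ' g := by
  refine ⟨hg.entire, fun ε hε => ?_, hg.bounded⟩
  obtain ⟨M, hM⟩ := hg.expType ε hε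
  have hM0 : 0 ≤ M := by
    have := (norm_nonneg _).trans (hM 0)
    simpa using this
  refine ⟨M, fun z => (hM z).trans ?_⟩
  gcongr

theorem bestApprox_antitone (p : ℝ≥0∞) (f : ℝ → ℂ) : Antitone fun σ => bestApprox p σ f := by
  intro σ σ' h
  exact le_iInf₂ fun g hg => iInf₂_le g (hg.mono h)

theorem theorem6 (α : ℝ) (hα : 0 < α) (p : ℝ≥0∞) (hp : 1 < p) (q : ℝ) (hq : 0 < q) (C : ℝ≥0) :
    ∃ K : ℝ≥0, 0 < K ∧
      ∀ (x : ℝ) (w : ℝ → ℝ) (f : ℝ → ℂ), IsModulusType w → MemOmegaAt α p w x C f →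
      ∀ a : ℕ → ℕ → ℝ, (∀ n, IsMS (a n)) → (∀ n, HasSum (a n) 1) →
        Tendsto (fun n => a n 0) atTop (𝓝 0) →
      ∀ n : ℕ,
        strongMean q (a n) (fun k => α * k / 2) f x ≤
          K * (∑' k : ℕ, ENNReal.ofReal (a n k) *
            (ENNReal.ofReal (w (Real.pi / (k + 1))) + bestApprox p (α * k / 2) f) ^ q)
              ^ (1 / q) := by
  have hpi := Real.pi_pos
  obtain ⟨K₁, hK₁0, hK₁⟩ := exists_sum_block_le hα hp hq C
  -- The maximum covers the dyadic blocks and the two exceptional indices; both constants are raised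
  -- to the power q because the sums are compared before the q-th root is taken.
  set K₂ : ℝ≥0 := max (K₁.toNNReal ^ q) ((C + 4) ^ q) with hK₂
  have hK₂0 : 0 < K₂ := lt_max_of_lt_right (by positivity)
  refine ⟨(4 * K₂) ^ (1 / q), by positivity, fun x w f hw hf a ha _ _ n => ?_⟩
  set R : ℕ → ℝ≥0∞ := fun k =>
    (ENNReal.ofReal (w (Real.pi / (k + 1))) + bestApprox p (α * k / 2) f) ^ q with hR
  have hRanti : Antitone R := by
    intro i j hij
    have hij' : (i : ℝ) ≤ j := by exact_mod_cast hij
    simp only [hR]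
    gcongr
    · refine hw.mono (Set.mem_Ici.2 (by positivity)) (Set.mem_Ici.2 (by positivity)) ?_
      gcongr
    · exact bestApprox_antitone p f (by gcongr)
  -- Here k ≤ 1 means αk/2 ≤ α/2, so at most one positive exponent takes part, and both terms are
  -- charged to R 0, which contains w(π) and E_0(f).
  have hsmall : ∀ k : ℕ, k ≤ 1 → ‖apPartialSum f (α * k / 2) x - f x‖ₑ ^ q ≤ K₂ * R 0 := by
    intro k hk
    have hk' : (k : ℝ) ≤ 1 := by exact_mod_cast hk
    have h := hf.enorm_apPartialSum_sub_le hp.le hw (γ := α * k / 2) (by positivity) (by nlinarith)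
    calc _ ≤ (((C + 4 : ℝ≥0) : ℝ≥0∞) * (ENNReal.ofReal (w Real.pi) + bestApprox p 0 f)) ^ q := by
          gcongr
      _ = ((C + 4 : ℝ≥0) : ℝ≥0∞) ^ q * R 0 := by
          rw [ENNReal.mul_rpow_of_nonneg _ _ hq.le]
          simp [hR]
      _ ≤ _ := by
          gcongr
          rw [← ENNReal.coe_rpow_of_nonneg _ hq.le]
          exact_mod_cast le_max_right _ _
  have hmain := tsum_mul_le_of_block_le (a := fun k => ENNReal.ofReal (a n k))
    (x := fun k => ‖apPartialSum f (α * k / 2) x - f x‖ₑ ^ q) (R := R) (K := K₂)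
    (fun i j hij => ENNReal.ofReal_le_ofReal ((ha n).2 hij)) hRanti
    (hsmall 0 zero_le_one) (hsmall 1 le_rfl) ?_
  · rw [strongMean]
    calc _ ≤ (4 * (K₂ : ℝ≥0∞) * ∑' k, ENNReal.ofReal (a n k) * R k) ^ (1 / q) := by
          gcongr
      _ = _ := by
          rw [ENNReal.mul_rpow_of_nonneg _ _ (by positivity),
            ENNReal.coe_rpow_of_nonneg _ (by positivity)]
          push_cast
          rfl
  · intro m hm
    have hw0 : 0 ≤ w (Real.pi / 2 ^ m) := hw.nonneg (by positivity)
    have h := ENNReal.ofReal_le_ofReal (hK₁ x w f hw hf m hm)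
    rw [ENNReal.ofReal_sum_of_nonneg (fun _ _ => by positivity)] at h
    calc ∑ k ∈ Finset.Ico (2 ^ m : ℕ) (2 ^ (m + 1)), ‖apPartialSum f (α * k / 2) x - f x‖ₑ ^ q
        = ∑ k ∈ Finset.Ico (2 ^ m : ℕ) (2 ^ (m + 1)),
            ENNReal.ofReal (‖apPartialSum f (α * k / 2) x - f x‖ ^ q) := by
          refine Finset.sum_congr rfl fun k _ => ?_
          rw [← ENNReal.ofReal_rpow_of_nonneg (norm_nonneg _) hq.le, ofReal_norm]
      _ ≤ ENNReal.ofReal ((K₁ * w (Real.pi / 2 ^ m)) ^ q * 2 ^ m) := h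
      _ = (K₁.toNNReal : ℝ≥0∞) ^ q * ENNReal.ofReal (w (Real.pi / 2 ^ m)) ^ q * 2 ^ m := by
          rw [ENNReal.ofReal_mul (by positivity), ← ENNReal.ofReal_rpow_of_nonneg (by positivity)
            hq.le, ENNReal.ofReal_mul hK₁0.le, ENNReal.mul_rpow_of_nonneg _ _ hq.le,
            ENNReal.ofReal_pow (by norm_num), ENNReal.ofReal_ofNat]
          rfl
      _ ≤ _ := by
          -- The block bound w(π/2^m) is exactly the modulus term of R at the index 2^m - 1; the
          -- best approximation in R is simply dropped.
          have hcast : ((2 ^ m - 1 : ℕ) : ℝ) + 1 = 2 ^ m := by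
            rw [Nat.cast_sub Nat.one_le_two_pow]; push_cast; ring
          gcongr
          · rw [← ENNReal.coe_rpow_of_nonneg _ hq.le]
            exact_mod_cast le_max_left _ _
          · simp only [hR, hcast]
            gcongr
            exact self_le_add_right _ _
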